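/- Let $n\ge 3$, $a>0$, $L>0$ and $\tfrac12<\sigma<4(n-2)^2$. Write $x=(x_1,\vec y)\in\mathbb R\times\mathbb R^{n-1}$, and let $V:\mathbb R^n\to\mathbb R$ be axially repulsive with respect to the $x_1$-axis, meaning: (A1) $V$ is $C^1$ and $V\ge 0$; (A2) $-\vec y\cdot\nabla_{\vec y}V(x)\ge 0$ for all $x$, and $-x_1\,\partial_{x_1}V(x)\ge 0$ whenever $|x_1|>L$; (A3) for every $0<\delta<L$ there is $\Lambda_\delta>0$ such that $|\partial_{x_1}V(x)|\le\Lambda_\delta\,\bigl|\nabla_{\vec y}V(x)\cdot\tfrac{\vec y}{|\vec y|}\bigr|$ for all $x$ with $|x_1|\le L$ and $|\vec y|\ge\delta$. Let $\langle x\rangle=(1+a|x|^2)^{1/2}$, $f(r)=\int_0^r(1+as^2)^{-\sigma}\,ds$, $F(r)=\int_0^r f(t)\,dt$, and, for $c\in\mathbb R^n$, $F_c(x)=F(|x-c|)$ and $$\gamma_c=-i\sum_{j=1}^n\bigl(\partial_j\,(\partial_jF_c)+(\partial_jF_c)\,\partial_j\bigr).$$ For $k\in\mathbb Z$ write $k$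 also for the point $(k,\vec 0)\in\mathbb R^n$, and let $\gamma_N=\sum_{k=-N}^{N}\gamma_{(k,\vec 0)}$. Let $H=-\Delta+V$ in $L^2(\mathbb R^n)$, where $D(-\Delta)=H^2(\mathbb R^n)$. Then for every $\varepsilon\in(0,1)$ there is $N_\varepsilon$ such that for all $N\ge N_\varepsilon$ $$i[H,\gamma_N]\;\ge\;(1-\varepsilon)\,i[-\Delta,\gamma_N]\;\ge\;-(1-\varepsilon)\Bigl(4-\frac{\sigma}{(n-2)^2}\Bigr)\sum_{k=-N}^{N}\frac1{\langle x-k\rangle^{\sigma}}\,\Delta\,\frac1{\langle x-k\rangle^{\sigma}}$$ in the sense of quadratic forms on $D(-\Delta)$. Here, for symmetric operators $A$ and $B$, the form of $i[A,B]$ is $\psi\mapsto i\bigl((A\psi,B\psi)-(B\psi,A\psi)\bigr)$, with the inner product conjugate-linear in its first argument; every $\psi\in D(-\Delta)$ lies in the domains of all the operators involved. -/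

import Mathlib

open MeasureTheory TemperedDistribution
open scoped SchwartzMap LineDeriv Laplacian ENNReal

noncomputable section

namespace MultiCenter

/-- Euclidean space `ℝⁿ`. -/
abbrev E (n : ℕ) := EuclideanSpace ℝ (Fin n)

/-- The complex Hilbert space `L²(ℝⁿ)`. -/
abbrev L2 (n : ℕ) := Lp ℂ 2 (volume : Measure (E n))

/-! ### Unbounded operators on `L²(ℝⁿ)` -/

/-- The partially defined linear operator whose graph is the relation `R`, where `R` is a
linear and single-valued relation. -/
def ofRel {M : Type*} [AddCommGroup M] [Module ℂ M] (R : M → M → Prop) (zero : R 0 0)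
    (add : ∀ x y u v, R x u → R y v → R (x + y) (u + v))
    (smul : ∀ (z : ℂ) x u, R x u → R (z • x) (z • u))
    (unique : ∀ x u v, R x u → R x v → u = v) : M →ₗ.[ℂ] M where
  domain :=
    { carrier := {x | ∃ u, R x u}
      zero_mem' := ⟨0, zero⟩
      add_mem' := fun ⟨u, hu⟩ ⟨v, hv⟩ => ⟨u + v, add _ _ _ _ hu hv⟩
      smul_mem' := fun z _ ⟨u, hu⟩ => ⟨z • u, smul z _ _ hu⟩ }
  toFun :=
    { toFun := fun x => x.2.choose
      map_add' := fun x y => unique _ _ _ (x + y).2.choose_spec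
        (add _ _ _ _ x.2.choose_spec y.2.choose_spec)
      map_smul' := fun z x => unique _ _ _ (z • x).2.choose_spec
        (smul z _ _ x.2.choose_spec) }

/-- The maximal realization in `L²(ℝⁿ)` of an operator `T` acting on tempered distributions:
its domain is `{ψ ∈ L² : T ψ ∈ L²}`, and it maps `ψ` to `T ψ`. -/
def realization {n : ℕ} (T : 𝓢'(E n, ℂ) →L[ℂ] 𝓢'(E n, ℂ)) : L2 n →ₗ.[ℂ] L2 n :=
  ofRel (fun ψ u => Lp.toTemperedDistributionCLM ℂ volume 2 u =
      T (Lp.toTemperedDistributionCLM ℂ volume 2 ψ))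
    (by simp only [map_zero])
    (by intro x y u v hu hv; rw [map_add, map_add, map_add, hu, hv])
    (by intro z x u hu; rw [map_smul, map_smul, map_smul, hu])
    (by
      intro x u v hu hv
      exact LinearMap.ker_eq_bot.mp Lp.ker_toTemperedDistributionCLM_eq_bot (hu.trans hv.symm))

/-- The Laplacian `Δ` in `L²(ℝⁿ)`, with domain `{ψ ∈ L² : Δψ ∈ L²} = H²(ℝⁿ)`. -/
def laplacian (n : ℕ) : L2 n →ₗ.[ℂ] L2 n :=
  realization (LineDeriv.laplacianCLM ℂ (E n) 𝓢'(E n, ℂ))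

/-- The partial derivative `∂ⱼ` in `L²(ℝⁿ)`, with domain `{ψ ∈ L² : ∂ⱼψ ∈ L²}`. -/
def partialDeriv {n : ℕ} (j : Fin n) : L2 n →ₗ.[ℂ] L2 n :=
  realization (LineDeriv.lineDerivOpCLM ℂ 𝓢'(E n, ℂ) (EuclideanSpace.single j (1 : ℝ)))

/-- Multiplication by the real function `w` in `L²(ℝⁿ)`, with domain
`{ψ ∈ L² : w ψ ∈ L²}`. -/
def mulOp {n : ℕ} (w : E n → ℝ) : L2 n →ₗ.[ℂ] L2 n :=
  ofRel (fun ψ u => ∀ᵐ x, u x = (w x : ℂ) * ψ x)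
    (by
      filter_upwards [Lp.coeFn_zero ℂ 2 (volume : Measure (E n))] with x hx
      rw [hx, Pi.zero_apply, mul_zero])
    (by
      intro ψ φ u v hu hv
      filter_upwards [hu, hv, Lp.coeFn_add ψ φ, Lp.coeFn_add u v] with x h1 h2 h3 h4
      rw [h3, h4, Pi.add_apply, Pi.add_apply, h1, h2, mul_add])
    (by
      intro z ψ u hu
      filter_upwards [hu, Lp.coeFn_smul z ψ, Lp.coeFn_smul z u] with x h1 h2 h3
      rw [h2, h3, Pi.smul_apply, Pi.smul_apply, h1, smul_eq_mul, smul_eq_mul, mul_left_comm])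
    (by
      intro ψ u v hu hv
      apply Lp.ext
      filter_upwards [hu, hv] with x h1 h2
      rw [h1, h2])

/-- The product `A B` of two unbounded operators, with its natural domain
`{ψ ∈ D(B) : B ψ ∈ D(A)}`. -/
def opMul {M : Type*} [AddCommGroup M] [Module ℂ M] (A B : M →ₗ.[ℂ] M) : M →ₗ.[ℂ] M :=
  ofRel (fun x u => ∃ v, (x, v) ∈ B.graph ∧ (v, u) ∈ A.graph)
    ⟨0, B.graph.zero_mem, A.graph.zero_mem⟩
    (fun _ _ _ _ ⟨v, h1, h2⟩ ⟨v', h1', h2'⟩ =>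
      ⟨v + v', B.graph.add_mem h1 h1', A.graph.add_mem h2 h2'⟩)
    (fun z _ _ ⟨v, h1, h2⟩ => ⟨z • v, B.graph.smul_mem z h1, A.graph.smul_mem z h2⟩)
    (by
      rintro x u u' ⟨v, h1, h2⟩ ⟨v', h1', h2'⟩
      obtain rfl := B.mem_graph_snd_inj h1 h1' rfl
      exact A.mem_graph_snd_inj h2 h2' rfl)

/-- The quadratic form of the operator `A`: the real part of `(ψ, A ψ)`. -/
def opForm {n : ℕ} (A : L2 n →ₗ.[ℂ] L2 n) (ψ : L2 n) (hA : ψ ∈ A.domain) : ℝ :=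
  (inner ℂ ψ (A ⟨ψ, hA⟩)).re

/-- The quadratic form of the commutator `i[A, B]` of two symmetric operators on
`D(A) ∩ D(B)`: the number `i ((A ψ, B ψ) - (B ψ, A ψ))`, which is real. -/
def commForm {n : ℕ} (A B : L2 n →ₗ.[ℂ] L2 n) (ψ : L2 n)
    (hA : ψ ∈ A.domain) (hB : ψ ∈ B.domain) : ℝ :=
  (Complex.I * (inner ℂ (A ⟨ψ, hA⟩) (B ⟨ψ, hB⟩) - inner ℂ (B ⟨ψ, hB⟩) (A ⟨ψ, hA⟩))).re

/-- Taking the real part in `commForm` loses nothing. -/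
theorem ofReal_commForm {n : ℕ} (A B : L2 n →ₗ.[ℂ] L2 n) (ψ : L2 n)
    (hA : ψ ∈ A.domain) (hB : ψ ∈ B.domain) :
    (commForm A B ψ hA hB : ℂ) =
      Complex.I * (inner ℂ (A ⟨ψ, hA⟩) (B ⟨ψ, hB⟩) - inner ℂ (B ⟨ψ, hB⟩) (A ⟨ψ, hA⟩)) := by
  unfold commForm
  generalize A ⟨ψ, hA⟩ = u
  generalize B ⟨ψ, hB⟩ = v
  have h : inner ℂ v u = (starRingEnd ℂ) (inner ℂ u v) := (inner_conj_symm v u).symm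
  rw [h]
  generalize (inner ℂ u v : ℂ) = z
  apply Complex.ext <;> simp

/-! ### Axially repulsive potentials -/

/-- The unit vector along the `x₁`-axis (the coordinate with index `0`). -/
def axis (n : ℕ) [NeZero n] : E n := EuclideanSpace.single 0 1

/-- The component `(0, y)` of `x = (x₁, y)` orthogonal to the `x₁`-axis. -/
def transverse {n : ℕ} [NeZero n] (x : E n) : E n := x - x 0 • axis n

/-- The potential `V` is axially repulsive with respect to the `x₁`-axis, with
parameter `L`.  Note that `fderiv ℝ V x (axis n) = ∂V/∂x₁` and
`fderiv ℝ V x (transverse x) = y · ∇_y V(x)`. -/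
structure AxiallyRepulsive {n : ℕ} [NeZero n] (L : ℝ) (V : E n → ℝ) : Prop where
  contDiff : ContDiff ℝ 1 V
  nonneg : ∀ x, 0 ≤ V x
  transverse_repulsive : ∀ x, 0 ≤ -fderiv ℝ V x (transverse x)
  axis_repulsive : ∀ x, L < |x 0| → 0 ≤ -(x 0 * fderiv ℝ V x (axis n))
  axis_controlled : ∀ δ, 0 < δ → δ < L → ∃ Λ > 0, ∀ x, |x 0| ≤ L → δ ≤ ‖transverse x‖ →
    |fderiv ℝ V x (axis n)| ≤ Λ * |fderiv ℝ V x (‖transverse x‖⁻¹ • transverse x)|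

/-! ### The multipliers -/

/-- The radial profile `f(r) = ∫₀ʳ (1 + a s²)^(-σ) ds`. -/
def profile (a σ r : ℝ) : ℝ := ∫ s in (0 : ℝ)..r, (1 + a * s ^ 2) ^ (-σ)

/-- The function `F_c(x) = F(|x - c|)`, where `F(r) = ∫₀ʳ f(t) dt`. -/
def radialF {n : ℕ} (a σ : ℝ) (c x : E n) : ℝ := ∫ t in (0 : ℝ)..‖x - c‖, profile a σ t

/-- The function `∂ⱼ F_c`. -/
def partialF {n : ℕ} (a σ : ℝ) (c : E n) (j : Fin n) (x : E n) : ℝ :=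
  fderiv ℝ (radialF a σ c) x (EuclideanSpace.single j 1)

/-- The multiplier `γ_c = -i ∑ⱼ (∂ⱼ (∂ⱼF_c) + (∂ⱼF_c) ∂ⱼ)`, as an operator in `L²(ℝⁿ)`. -/
def multiplier {n : ℕ} (a σ : ℝ) (c : E n) : L2 n →ₗ.[ℂ] L2 n :=
  (-Complex.I) • ∑ j : Fin n,
    (opMul (partialDeriv j) (mulOp (partialF a σ c j)) +
      opMul (mulOp (partialF a σ c j)) (partialDeriv j))

/-- The center `c_k = (k, 0)`. -/
def center (n : ℕ) [NeZero n] (k : ℤ) : E n := (k : ℝ) • axis n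

/-- The multi-center multiplier `γ_N = ∑_{k=-N}^{N} γ_{c_k}`. -/
def multiCenterMultiplier (n : ℕ) [NeZero n] (a σ : ℝ) (N : ℕ) : L2 n →ₗ.[ℂ] L2 n :=
  ∑ k ∈ Finset.Icc (-(N : ℤ)) N, multiplier a σ (center n k)

/-- The weight `⟨x - c⟩^(-σ)`, where `⟨x⟩ = (1 + a |x|²)^(1/2)`. -/
def weight {n : ℕ} (a σ : ℝ) (c x : E n) : ℝ := (√(1 + a * ‖x - c‖ ^ 2)) ^ (-σ)

/-- The operator `∑_{k=-N}^{N} ⟨x - c_k⟩^(-σ) Δ ⟨x - c_k⟩^(-σ)`. -/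
def weightedLaplacian (n : ℕ) [NeZero n] (a σ : ℝ) (N : ℕ) : L2 n →ₗ.[ℂ] L2 n :=
  ∑ k ∈ Finset.Icc (-(N : ℤ)) N,
    opMul (mulOp (weight a σ (center n k)))
      (opMul (laplacian n) (mulOp (weight a σ (center n k))))

/-- The Schrödinger operator `H = -Δ + V`. -/
def schrodinger {n : ℕ} (V : E n → ℝ) : L2 n →ₗ.[ℂ] L2 n := -laplacian n + mulOp V

end MultiCenter

end

/-! Write `γ_c = -i (2 ∇F_c · ∇ + ΔF_c)`. For symmetric `A`, the form of `i[A, γ_c]` at `ψ` is `2 Re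
(Aψ, (2 ∇F_c · ∇ + ΔF_c) ψ)`. Integration by parts turns this into the virial identity `i[-Δ, γ_c] =
-4 ∂ⱼ (∂ⱼ∂ₖF_c) ∂ₖ - Δ²F_c` (`virial_identity`) and into `i[V, γ_c] = -2 ∇V · ∇F_c`.

Kinetic part. The Hessian of `F_c` has eigenvalues `f'` and `f/r`. Since `f` is concave with `f(0) =
0`, it is at least `f' = w²` with `w = ⟨x - c⟩^(-σ)` (`hessF_ge`). Moving `w` through the
derivatives (`dirichlet_mulS`) leaves `-4 wΔw` plus the potential `4 w (Δw) - Δ²F_c`. With `t = a|x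
- c|²` and `n ≥ 3`, this potential is at least `-2aσ w² (1 - t)/(1 + t)²`. As `(1 + t)² - 8t(1 - t)
= (1 - 3t)²`, it is at least `-(σ/4) w² |x - c|⁻²`. Hardy's inequality absorbs this at the price of
`σ/(n-2)²` (`virialS_ge_dirichlet`).

Potential part. It must be shown that `i[V, γ_N] ≥ -ε i[-Δ, γ_N]`. All centers lie on the axis, so
`∇V · ∇∑F_{c_k}` is an axial sum times `∂₁V` plus a transverse sum times `y · ∇_y V`. The axial sum
is odd and increasing in `x₁`, hence has the good sign for `|x₁| > L`. For `|x₁| ≤ L` it is bounded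
uniformly in `N`, because a unit shift changes it only by two boundary terms and `f` is bounded. The
transverse sum dominates a harmonic series, so for `|y| ≥ δ` and large `N` condition (A3) lets the
transverse term win. In the remaining tube `|x₁| ≤ L`, `|y| < δ` the error is at most a constant `C`
independent of `δ` and `N` (`AxiallyRepulsive.exists_tube_bound`).

To absorb `C`, Hardy weights are averaged over about `m` points of the segment. Within distance of
order `1/m` of the segment one term is of order `m²`, so the average is of order `m` there, whereas
its form bound does not depend on `m` (`exists_segmentWeight_ge`, `integral_segmentWeight_le`). An
`ε`-fraction of the kinetic commutator of the single center `0` controls it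
(`AxiallyRepulsive.exists_core_estimate`).

These estimates are proved on Schwartz functions. They form a core for `Δ`
(`exists_schwartz_approx`), `V` is bounded, and the multipliers have bounded coefficients, so every
form passes to the limit. -/

noncomputable section

namespace MultiCenter

open Filter Topology
open scoped ContDiff

variable {n : ℕ}

/-! ### Schwartz functions as a calculus of symmetric operators -/

/-- The real part of the `L²` inner product of two Schwartz functions. -/
def realInner {n : ℕ} : 𝓢(E n, ℂ) →ₗ[ℝ] 𝓢(E n, ℂ) →ₗ[ℝ] ℝ :=
  LinearMap.mk₂ ℝ (fun φ η => (inner ℂ (φ.toLp 2 volume) (η.toLp 2 volume)).re)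
    (fun φ φ' η => by
      change (inner ℂ (φ.toLp 2 volume + φ'.toLp 2 volume) (η.toLp 2 volume)).re = _
      rw [inner_add_left, Complex.add_re])
    (fun c φ η => by
      change (inner ℂ ((c : ℂ) • φ.toLp 2 volume) (η.toLp 2 volume)).re = _
      rw [inner_smul_left, Complex.conj_ofReal, Complex.re_ofReal_mul, smul_eq_mul])
    (fun φ η η' => by
      change (inner ℂ (φ.toLp 2 volume) (η.toLp 2 volume + η'.toLp 2 volume)).re = _
      rw [inner_add_right, Complex.add_re])
    (fun c φ η => by
      change (inner ℂ (φ.toLp 2 volume) ((c : ℂ) • η.toLp 2 volume)).re = _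
      rw [inner_smul_right, Complex.re_ofReal_mul, smul_eq_mul])

theorem realInner_def {n : ℕ} (φ η : 𝓢(E n, ℂ)) :
    realInner φ η = (inner ℂ (φ.toLp 2 volume) (η.toLp 2 volume)).re := rfl

theorem integrable_inner {n : ℕ} (φ η : 𝓢(E n, ℂ)) :
    Integrable (fun x => inner ℝ (φ x) (η x)) :=
  (SchwartzMap.pairing (innerSL ℝ : ℂ →L[ℝ] ℂ →L[ℝ] ℝ) φ η).integrable

theorem realInner_eq_integral {n : ℕ} (φ η : 𝓢(E n, ℂ)) :
    realInner φ η = ∫ x, inner ℝ (φ x) (η x) := by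
  have h : Integrable (fun x => inner ℂ (φ x) (η x)) := by
    have h1 := L2.integrable_inner (𝕜 := ℂ) (φ.toLp 2 (volume : Measure (E n)))
      (η.toLp 2 (volume : Measure (E n)))
    refine h1.congr ?_
    filter_upwards [φ.coeFn_toLp 2 volume, η.coeFn_toLp 2 volume] with x h2 h3
    rw [h2, h3]
  rw [realInner_def, SchwartzMap.inner_toL2_toL2_eq φ η volume]
  have := integral_re h
  simp only [RCLike.re_eq_complex_re] at this
  rw [← this]
  rfl

theorem realInner_comm {n : ℕ} (φ η : 𝓢(E n, ℂ)) : realInner φ η = realInner η φ := by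
  simp only [realInner_eq_integral, real_inner_comm]

theorem realInner_self {n : ℕ} (φ : 𝓢(E n, ℂ)) : realInner φ φ = ‖φ.toLp 2 volume‖ ^ 2 := by
  rw [realInner_def]
  exact inner_self_eq_norm_sq (𝕜 := ℂ) _

theorem realInner_self_nonneg {n : ℕ} (φ : 𝓢(E n, ℂ)) : 0 ≤ realInner φ φ := by
  rw [realInner_self]; positivity

/-- The `j`-th vector of the standard basis. -/
abbrev basisVec {n : ℕ} (j : Fin n) : E n := EuclideanSpace.single j 1

/-- The partial derivative `∂ⱼ` on Schwartz functions. -/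
def dS {n : ℕ} (j : Fin n) : 𝓢(E n, ℂ) →L[ℝ] 𝓢(E n, ℂ) :=
  LineDeriv.lineDerivOpCLM ℝ 𝓢(E n, ℂ) (basisVec j)

theorem dS_eq {n : ℕ} (j : Fin n) (φ : 𝓢(E n, ℂ)) : dS j φ = ∂_{basisVec j} φ := rfl

theorem dS_apply {n : ℕ} (j : Fin n) (φ : 𝓢(E n, ℂ)) (x : E n) :
    dS j φ x = fderiv ℝ φ x (basisVec j) := rfl

/-- Integration by parts. -/
theorem realInner_dS {n : ℕ} (j : Fin n) (φ η : 𝓢(E n, ℂ)) :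
    realInner φ (dS j η) = -realInner (dS j φ) η := by
  rw [realInner_eq_integral, realInner_eq_integral]
  exact SchwartzMap.integral_bilinear_lineDerivOp_right_eq_neg_left φ η
    (innerSL ℝ : ℂ →L[ℝ] ℂ →L[ℝ] ℝ) (basisVec j)

theorem laplacian_schwartz {n : ℕ} (φ : 𝓢(E n, ℂ)) :
    Δ φ = ∑ j, dS j (dS j φ) := by
  rw [SchwartzMap.laplacian_eq_sum (EuclideanSpace.basisFun (Fin n) ℝ)]
  simp [dS_eq]

theorem realInner_laplacian {n : ℕ} (φ η : 𝓢(E n, ℂ)) :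
    realInner (Δ φ) η = -∑ j, realInner (dS j φ) (dS j η) := by
  rw [laplacian_schwartz, map_sum, LinearMap.sum_apply, ← Finset.sum_neg_distrib]
  refine Finset.sum_congr rfl fun j _ => ?_
  rw [realInner_dS, neg_neg]

/-- Multiplication of a Schwartz function by a real function of temperate growth. -/
abbrev mulS {n : ℕ} (u : E n → ℝ) : 𝓢(E n, ℂ) →L[ℝ] 𝓢(E n, ℂ) := SchwartzMap.smulLeftCLM ℂ u

theorem mulS_apply {n : ℕ} {u : E n → ℝ} (hu : u.HasTemperateGrowth) (φ : 𝓢(E n, ℂ)) (x : E n) :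
    mulS u φ x = (u x : ℂ) * φ x := by
  rw [SchwartzMap.smulLeftCLM_apply_apply hu, Complex.real_smul]

theorem inner_mulS {n : ℕ} {u : E n → ℝ} (hu : u.HasTemperateGrowth) (φ η : 𝓢(E n, ℂ)) (x : E n) :
    inner ℝ (φ x) (mulS u η x) = u x * inner ℝ (φ x) (η x) := by
  rw [SchwartzMap.smulLeftCLM_apply_apply hu, real_inner_smul_right]

theorem realInner_mulS {n : ℕ} {u : E n → ℝ} (hu : u.HasTemperateGrowth) (φ η : 𝓢(E n, ℂ)) :
    realInner φ (mulS u η) = realInner (mulS u φ) η := by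
  rw [realInner_eq_integral, realInner_eq_integral]
  congr 1 with x
  rw [inner_mulS hu, real_inner_comm, real_inner_comm (η x), inner_mulS hu]

theorem realInner_mulS_self {n : ℕ} {u : E n → ℝ} (hu : u.HasTemperateGrowth) (φ : 𝓢(E n, ℂ)) :
    realInner φ (mulS u φ) = ∫ x, u x * ‖φ x‖ ^ 2 := by
  rw [realInner_eq_integral]
  congr 1 with x
  rw [inner_mulS hu, real_inner_self_eq_norm_sq]

theorem integrable_mul_normSq {n : ℕ} {u : E n → ℝ} (hu : u.HasTemperateGrowth)
    (φ : 𝓢(E n, ℂ)) : Integrable fun x => u x * ‖φ x‖ ^ 2 := by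
  refine (integrable_inner φ (mulS u φ)).congr (Eventually.of_forall fun x => ?_)
  simp only [inner_mulS hu, real_inner_self_eq_norm_sq]

theorem realInner_mulS_self_mono {n : ℕ} {u v : E n → ℝ} (hu : u.HasTemperateGrowth)
    (hv : v.HasTemperateGrowth) (h : ∀ x, u x ≤ v x) (φ : 𝓢(E n, ℂ)) :
    realInner φ (mulS u φ) ≤ realInner φ (mulS v φ) := by
  rw [realInner_mulS_self hu, realInner_mulS_self hv]
  exact integral_mono (integrable_mul_normSq hu φ) (integrable_mul_normSq hv φ)
    fun x => mul_le_mul_of_nonneg_right (h x) (sq_nonneg _)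

theorem mulS_mulS {n : ℕ} {u v : E n → ℝ} (hu : u.HasTemperateGrowth)
    (hv : v.HasTemperateGrowth) (φ : 𝓢(E n, ℂ)) : mulS u (mulS v φ) = mulS (fun x => u x * v x) φ := by
  ext x
  rw [mulS_apply hu, mulS_apply hv, mulS_apply (u := fun x => u x * v x) (hu.mul hv), Complex.ofReal_mul, mul_assoc]

theorem mulS_add {n : ℕ} {u v : E n → ℝ} (hu : u.HasTemperateGrowth)
    (hv : v.HasTemperateGrowth) (φ : 𝓢(E n, ℂ)) : mulS (fun x => u x + v x) φ = mulS u φ + mulS v φ := by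
  ext x
  rw [add_apply, mulS_apply hu, mulS_apply hv, mulS_apply (u := fun x => u x + v x) (hu.add hv),
    Complex.ofReal_add, add_mul]

theorem mulS_const_mul {n : ℕ} {u : E n → ℝ} (hu : u.HasTemperateGrowth) (c : ℝ)
    (φ : 𝓢(E n, ℂ)) : mulS (fun x => c * u x) φ = c • mulS u φ := by
  ext x
  rw [smul_apply, mulS_apply hu, mulS_apply (u := fun x => c * u x) ((Function.HasTemperateGrowth.const c).mul hu),
    Complex.ofReal_mul, mul_assoc, Complex.real_smul]

theorem mulS_const {n : ℕ} (c : ℝ) (φ : 𝓢(E n, ℂ)) : mulS (fun _ => c) φ = c • φ := by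
  ext x
  rw [smul_apply, mulS_apply (Function.HasTemperateGrowth.const c), Complex.real_smul]

theorem mulS_sum {n : ℕ} {ι : Type*} (s : Finset ι) {u : ι → E n → ℝ}
    (hu : ∀ i ∈ s, (u i).HasTemperateGrowth) (φ : 𝓢(E n, ℂ)) :
    mulS (fun x => ∑ i ∈ s, u i x) φ = ∑ i ∈ s, mulS (u i) φ := by
  rw [mulS, SchwartzMap.smulLeftCLM_sum hu, sum_apply]

/-- `u'` is the partial derivative `∂ⱼ u`; both functions have temperate growth. -/
structure HasPartial {n : ℕ} (u : E n → ℝ) (j : Fin n) (u' : E n → ℝ) : Prop where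
  temp : u.HasTemperateGrowth
  temp' : u'.HasTemperateGrowth
  fderiv_eq : ∀ x, fderiv ℝ u x (basisVec j) = u' x

theorem HasPartial.dS_mulS {n : ℕ} {u u' : E n → ℝ} {j : Fin n} (h : HasPartial u j u')
    (φ : 𝓢(E n, ℂ)) :
    dS j (mulS u φ) = mulS u (dS j φ) + mulS u' φ := by
  ext x
  have hd : DifferentiableAt ℝ u x := h.temp.1.differentiable (by simp) x
  rw [add_apply, dS_apply,
    SchwartzMap.smulLeftCLM_apply h.temp,
    SchwartzMap.smulLeftCLM_apply_apply h.temp, SchwartzMap.smulLeftCLM_apply_apply h.temp',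
    dS_apply]
  have := (hd.hasFDerivAt.smul (φ.hasFDerivAt x)).fderiv
  rw [show (fun x => u x • φ x) = u • ⇑φ from rfl] at *
  rw [this]
  simp [h.fderiv_eq]

/-- `u ∂ⱼ` is antisymmetric up to `∂ⱼ u`. -/
theorem HasPartial.two_mul_realInner {n : ℕ} {u u' : E n → ℝ} {j : Fin n} (h : HasPartial u j u')
    (φ : 𝓢(E n, ℂ)) :
    2 * realInner φ (mulS u (dS j φ)) = -realInner φ (mulS u' φ) := by
  have h1 : realInner φ (mulS u (dS j φ)) =
      -realInner (mulS u (dS j φ) + mulS u' φ) φ := by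
    rw [realInner_mulS h.temp, realInner_dS, h.dS_mulS]
  rw [map_add, LinearMap.add_apply, realInner_comm _ φ, realInner_comm _ φ] at h1
  linarith

theorem dS_comm {n : ℕ} (j k : Fin n) (φ : 𝓢(E n, ℂ)) :
    dS j (dS k φ) = dS k (dS j φ) := by
  ext x
  have hs : ContDiffAt ℝ 2 φ x := φ.contDiffAt 2
  have hsym := hs.isSymmSndFDerivAt (by simp)
  have key : ∀ j k : Fin n, (dS j (dS k φ)) x =
      fderiv ℝ (fderiv ℝ φ) x (basisVec j) (basisVec k) := by
    intro j k
    rw [dS_apply]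
    have : (dS k φ : E n → ℂ) = fun y => fderiv ℝ φ y (basisVec k) := by
      ext y; rw [dS_apply]
    have hd : DifferentiableAt ℝ (fderiv ℝ φ) x :=
      (SchwartzMap.fderivCLM ℝ (E n) ℂ φ).differentiable x
    rw [this, fderiv_clm_apply hd (differentiableAt_const _)]
    simp
  rw [key, key, hsym.eq]

/-! ### The radial functions -/

/-- The integrals `∫₀¹ tᵐ (1 + s t²)^(-τ) dt`. -/
def kfun (m : ℕ) (τ s : ℝ) : ℝ := ∫ t in (0 : ℝ)..1, t ^ m * (1 + s * t ^ 2) ^ (-τ)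

/-- The half line `s > -1/2` is an open neighbourhood of the values `s = a|x - c|² ≥ 0`, so
smoothness at the center `s = 0` needs no one-sided derivatives. -/
theorem half_le_one_add_mul_sq {s t : ℝ} (hs : -(1 / 2) < s) (ht : t ∈ Set.Icc (0 : ℝ) 1) :
    1 / 2 ≤ 1 + s * t ^ 2 := by
  have h1 : t ^ 2 ≤ 1 := pow_le_one₀ ht.1 ht.2
  nlinarith [sq_nonneg t]

theorem continuousOn_kfun_integrand (m : ℕ) (τ : ℝ) {s : ℝ} (hs : -(1 / 2) < s) :
    ContinuousOn (fun t : ℝ => t ^ m * (1 + s * t ^ 2) ^ (-τ)) (Set.Icc 0 1) := by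
  refine ContinuousOn.mul (by fun_prop) (ContinuousOn.rpow_const (by fun_prop) fun t ht => Or.inl ?_)
  have := half_le_one_add_mul_sq hs ht
  linarith

theorem intervalIntegrable_kfun (m : ℕ) (τ : ℝ) {s : ℝ} (hs : -(1 / 2) < s) :
    IntervalIntegrable (fun t : ℝ => t ^ m * (1 + s * t ^ 2) ^ (-τ)) volume 0 1 :=
  ContinuousOn.intervalIntegrable (by
    rw [Set.uIcc_of_le zero_le_one]; exact continuousOn_kfun_integrand m τ hs)

theorem abs_kfun_integrand_le (m : ℕ) {τ : ℝ} (hτ : 0 ≤ τ) {s t : ℝ} (hs : -(1 / 2) < s)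
    (ht : t ∈ Set.Icc (0 : ℝ) 1) : |t ^ m * (1 + s * t ^ 2) ^ (-τ)| ≤ (2 : ℝ) ^ τ := by
  have h0 := half_le_one_add_mul_sq hs ht
  have h1 : |t ^ m| ≤ 1 := by
    rw [abs_of_nonneg (pow_nonneg ht.1 m)]; exact pow_le_one₀ ht.1 ht.2
  have h2 : |(1 + s * t ^ 2) ^ (-τ)| ≤ (2 : ℝ) ^ τ := by
    rw [abs_of_nonneg (Real.rpow_nonneg (by linarith) _)]
    calc (1 + s * t ^ 2) ^ (-τ) ≤ (1 / 2 : ℝ) ^ (-τ) :=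
          Real.rpow_le_rpow_of_nonpos (by norm_num) h0 (by linarith)
      _ = (2 : ℝ) ^ τ := by
          rw [one_div, Real.inv_rpow (by norm_num), Real.rpow_neg (by norm_num), inv_inv]
  rw [abs_mul]
  calc _ ≤ 1 * (2 : ℝ) ^ τ := mul_le_mul h1 h2 (abs_nonneg _) zero_le_one
    _ = _ := one_mul _

theorem abs_kfun_le (m : ℕ) {τ : ℝ} (hτ : 0 ≤ τ) {s : ℝ} (hs : -(1 / 2) < s) :
    |kfun m τ s| ≤ (2 : ℝ) ^ τ := by
  have := intervalIntegral.norm_integral_le_of_norm_le_const (a := (0 : ℝ)) (b := 1)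
    (f := fun t : ℝ => t ^ m * (1 + s * t ^ 2) ^ (-τ)) (C := (2 : ℝ) ^ τ) (fun t ht => by
      rw [Set.uIoc_of_le zero_le_one] at ht
      exact abs_kfun_integrand_le m hτ hs ⟨ht.1.le, ht.2⟩)
  simpa [kfun] using this

/-- Differentiation under the integral stays within the family, shifting `(m, τ)` to `(m + 2, τ +
1)`. Smoothness and bounds on all derivatives then follow by induction. -/
theorem hasDerivAt_kfun (m : ℕ) {τ : ℝ} (hτ : 0 ≤ τ) {s : ℝ} (hs : -(1 / 2) < s) :
    HasDerivAt (kfun m τ) (-τ * kfun (m + 2) (τ + 1) s) s := by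
  have hopen : Set.Ioi (-(1 / 2) : ℝ) ∈ 𝓝 s := Ioi_mem_nhds hs
  have h := intervalIntegral.hasDerivAt_integral_of_dominated_loc_of_deriv_le
    (F := fun s t : ℝ => t ^ m * (1 + s * t ^ 2) ^ (-τ))
    (F' := fun s t : ℝ => -τ * (t ^ (m + 2) * (1 + s * t ^ 2) ^ (-(τ + 1))))
    (bound := fun _ => τ * (2 : ℝ) ^ (τ + 1)) (a := 0) (b := 1) (μ := volume) hopen ?_
    (intervalIntegrable_kfun m τ hs) ?_ ?_ (by simp) ?_
  · rw [intervalIntegral.integral_const_mul] at h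
    exact h.2
  · filter_upwards [hopen] with s' hs'
    exact (intervalIntegrable_kfun m τ hs').aestronglyMeasurable_restrict_uIoc
  · exact ((intervalIntegrable_kfun (m + 2) (τ + 1) hs).const_mul (-τ)).aestronglyMeasurable_restrict_uIoc
  · refine Eventually.of_forall fun t ht s' hs' => ?_
    rw [Set.uIoc_of_le zero_le_one] at ht
    rw [norm_mul, norm_neg, Real.norm_of_nonneg hτ]
    exact mul_le_mul_of_nonneg_left
      (abs_kfun_integrand_le (m + 2) (by linarith) hs' ⟨ht.1.le, ht.2⟩) hτ
  · refine Eventually.of_forall fun t ht s' hs' => ?_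
    rw [Set.uIoc_of_le zero_le_one] at ht
    have h0 := half_le_one_add_mul_sq hs' ⟨ht.1.le, ht.2⟩
    have h1 : HasDerivAt (fun s : ℝ => 1 + s * t ^ 2) (t ^ 2) s' := by
      simpa using ((hasDerivAt_id s').mul_const (t ^ 2)).const_add 1
    have h2 := (h1.rpow_const (p := -τ) (Or.inl (by linarith))).const_mul (t ^ m)
    refine h2.congr_deriv ?_
    rw [show -(τ + 1) = -τ - 1 by ring]
    ring

theorem contDiffOn_kfun (N : ℕ) : ∀ (m : ℕ) {τ : ℝ}, 0 ≤ τ →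
    ContDiffOn ℝ N (kfun m τ) (Set.Ioi (-(1 / 2))) := by
  induction N with
  | zero =>
    intro m τ hτ
    exact contDiffOn_zero.2 fun s hs => (hasDerivAt_kfun m hτ hs).continuousAt.continuousWithinAt
  | succ N ih =>
    intro m τ hτ
    rw [Nat.cast_add_one, contDiffOn_succ_iff_deriv_of_isOpen isOpen_Ioi]
    refine ⟨fun s hs => (hasDerivAt_kfun m hτ hs).differentiableAt.differentiableWithinAt,
      by simp, ?_⟩
    exact (contDiffOn_const.mul (ih (m + 2) (τ := τ + 1) (by linarith))).congr
      fun s hs => (hasDerivAt_kfun m hτ hs).deriv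

theorem iteratedDerivWithin_kfun (N : ℕ) : ∀ (m : ℕ) {τ : ℝ}, 0 ≤ τ →
    ∃ C : ℝ, ∀ s ∈ Set.Ioi (-(1 / 2) : ℝ),
      |iteratedDerivWithin N (kfun m τ) (Set.Ioi (-(1 / 2))) s| ≤ C := by
  induction N with
  | zero =>
    intro m τ hτ
    exact ⟨2 ^ τ, fun s hs => by simpa using abs_kfun_le m hτ hs⟩
  | succ N ih =>
    intro m τ hτ
    obtain ⟨C, hC⟩ := ih (m + 2) (τ := τ + 1) (by linarith)
    refine ⟨τ * C, fun s hs => ?_⟩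
    have h1 : Set.EqOn (derivWithin (kfun m τ) (Set.Ioi (-(1 / 2))))
        (fun s => -τ * kfun (m + 2) (τ + 1) s) (Set.Ioi (-(1 / 2))) := fun s hs =>
      (hasDerivAt_kfun m hτ hs).hasDerivWithinAt.derivWithin (isOpen_Ioi.uniqueDiffWithinAt hs)
    rw [iteratedDerivWithin_succ', iteratedDerivWithin_congr h1 hs,
      iteratedDerivWithin_const_mul_field, abs_mul, abs_neg, abs_of_nonneg hτ]
    exact mul_le_mul_of_nonneg_left (hC s hs) hτ

/-! ### Temperate growth and derivatives of radial functions -/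

theorem hasTemperateGrowth_normSq_sub (a : ℝ) (c : E n) :
    (fun x : E n => a * ‖x - c‖ ^ 2).HasTemperateGrowth := by
  have h1 : (fun x : E n => x - c).HasTemperateGrowth :=
    Function.HasTemperateGrowth.id'.sub (.const c)
  exact (Function.HasTemperateGrowth.const a).mul
    ((Function.hasTemperateGrowth_norm_sq (E n)).comp h1)

theorem hasTemperateGrowth_kfun {a : ℝ} (ha : 0 ≤ a) (c : E n) (m : ℕ) {τ : ℝ} (hτ : 0 ≤ τ) :
    (fun x : E n => kfun m τ (a * ‖x - c‖ ^ 2)).HasTemperateGrowth := by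
  refine Function.HasTemperateGrowth.comp' (g := kfun m τ) (f := fun x : E n => a * ‖x - c‖ ^ 2)
    (t := Set.Ioi (-(1 / 2))) ?_ isOpen_Ioi.uniqueDiffOn
    (contDiffOn_infty.2 fun N => contDiffOn_kfun N m hτ) ?_ (hasTemperateGrowth_normSq_sub a c)
  · rintro _ ⟨x, rfl⟩
    have : 0 ≤ a * ‖x - c‖ ^ 2 := by positivity
    simp only [Set.mem_Ioi]
    linarith
  · intro N
    choose C hC using fun N => iteratedDerivWithin_kfun N m hτ
    refine ⟨0, ∑ i ∈ Finset.range (N + 1), |C i|, by positivity, fun i hi s hs => ?_⟩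
    rw [norm_iteratedFDerivWithin_eq_norm_iteratedDerivWithin, pow_zero, mul_one, Real.norm_eq_abs]
    exact (hC i s hs).trans ((le_abs_self _).trans (Finset.single_le_sum
      (f := fun i => |C i|) (fun _ _ => abs_nonneg _) (Finset.mem_range.2 (by omega))))

/-- Integrate `d/dt (t^(m+1) (1 + s t²)^(-τ))` over `[0, 1]`. For `m = 0` this is the relation
between `f/r`, its radial derivative and `f'`. It serves the Hessian, the Laplacian, the bilaplacian
and the monotonicity of the axial component. -/
theorem kfun_recursion (m : ℕ) (τ : ℝ) {s : ℝ} (hs : 0 ≤ s) :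
    (m + 1) * kfun m τ s - 2 * τ * (s * kfun (m + 2) (τ + 1) s) = (1 + s) ^ (-τ) := by
  have hs' : -(1 / 2) < s := by linarith
  have h := intervalIntegral.integral_eq_sub_of_hasDerivAt (a := (0 : ℝ)) (b := 1)
    (f := fun t => t ^ (m + 1) * (1 + s * t ^ 2) ^ (-τ))
    (f' := fun t => (m + 1) * (t ^ m * (1 + s * t ^ 2) ^ (-τ)) -
      2 * τ * (s * (t ^ (m + 2) * (1 + s * t ^ 2) ^ (-(τ + 1))))) ?_ ?_
  · rw [intervalIntegral.integral_sub, intervalIntegral.integral_const_mul,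
      intervalIntegral.integral_const_mul, intervalIntegral.integral_const_mul] at h
    · simpa [kfun] using h
    · exact (intervalIntegrable_kfun m τ hs').const_mul _
    · exact ((intervalIntegrable_kfun (m + 2) (τ + 1) hs').const_mul _).const_mul _
  · intro t _
    have h1 : HasDerivAt (fun t : ℝ => 1 + s * t ^ 2) (s * (2 * t)) t := by
      simpa using ((hasDerivAt_pow 2 t).const_mul s).const_add 1
    have h2 := (hasDerivAt_pow (m + 1) t).mul
      (h1.rpow_const (p := -τ) (Or.inl (by positivity)))
    refine h2.congr_deriv ?_
    rw [show -(τ + 1) = -τ - 1 by ring]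
    push_cast
    ring
  · exact ((intervalIntegrable_kfun m τ hs').const_mul _).sub
      (((intervalIntegrable_kfun (m + 2) (τ + 1) hs').const_mul _).const_mul _)

theorem kfun_nonneg (m : ℕ) (τ : ℝ) {s : ℝ} (hs : 0 ≤ s) : 0 ≤ kfun m τ s :=
  intervalIntegral.integral_nonneg zero_le_one fun t ht =>
    mul_nonneg (pow_nonneg ht.1 m) (Real.rpow_nonneg (by positivity) _)

theorem kfun_le_one (m : ℕ) {τ : ℝ} (hτ : 0 ≤ τ) {s : ℝ} (hs : 0 ≤ s) : kfun m τ s ≤ 1 := by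
  have h : kfun m τ s ≤ ∫ t in (0 : ℝ)..1, (1 : ℝ) := by
    refine intervalIntegral.integral_mono_on zero_le_one
      (intervalIntegrable_kfun m τ (by linarith)) (by simp) fun t ht => ?_
    have h1 : (1 + s * t ^ 2) ^ (-τ) ≤ 1 :=
      Real.rpow_le_one_of_one_le_of_nonpos (by nlinarith [mul_nonneg hs (sq_nonneg t)])
        (by linarith)
    calc _ ≤ (1 : ℝ) * 1 := mul_le_mul (pow_le_one₀ ht.1 ht.2) h1
          (Real.rpow_nonneg (by positivity) _) zero_le_one
      _ = 1 := one_mul 1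
  simpa using h

/-- Gradient of a radial function. -/
theorem hasFDerivAt_radial {a p' : ℝ} {p : ℝ → ℝ} {c x : E n}
    (h : HasDerivAt p p' (a * ‖x - c‖ ^ 2)) :
    HasFDerivAt (fun x : E n => p (a * ‖x - c‖ ^ 2)) ((2 * a * p') • innerSL ℝ (x - c)) x := by
  have h1 : HasFDerivAt (fun x : E n => ‖x - c‖ ^ 2) (2 • innerSL ℝ (x - c)) x :=
    ((hasFDerivAt_id x).sub_const c).norm_sq.congr_fderiv (by ext; simp)
  refine (h.comp_hasFDerivAt x (h1.const_mul a)).congr_fderiv ?_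
  ext v
  simp only [smul_apply, smul_eq_mul, nsmul_eq_mul]
  simp
  ring

theorem inner_basisVec (v : E n) (j : Fin n) : inner ℝ v (basisVec j) = v j := by
  simp [basisVec, EuclideanSpace.inner_single_right]

theorem HasPartial.of_radial {a : ℝ} {p p' : ℝ → ℝ} {c : E n}
    (hp : (fun x : E n => p (a * ‖x - c‖ ^ 2)).HasTemperateGrowth)
    (hp' : (fun x : E n => p' (a * ‖x - c‖ ^ 2)).HasTemperateGrowth)
    (h : ∀ x : E n, HasDerivAt p (p' (a * ‖x - c‖ ^ 2)) (a * ‖x - c‖ ^ 2)) (j : Fin n) :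
    HasPartial (fun x => p (a * ‖x - c‖ ^ 2)) j
      (fun x => (x - c) j * (2 * a * p' (a * ‖x - c‖ ^ 2))) where
  temp := hp
  temp' := by
    refine Function.HasTemperateGrowth.mul ?_ ((Function.HasTemperateGrowth.const _).mul hp')
    have : (fun x : E n => (x - c) j) = fun x => inner ℝ (x - c) (basisVec j) := by
      ext x; rw [inner_basisVec]
    rw [this]
    exact (Function.hasTemperateGrowth_inner_left (basisVec j)).comp
      (Function.HasTemperateGrowth.id'.sub (.const c))
  fderiv_eq x := by
    rw [(hasFDerivAt_radial (h x)).fderiv, smul_apply, innerSL_apply_apply, inner_basisVec,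
      smul_eq_mul]
    ring

theorem HasPartial.mul {u u' v v' : E n → ℝ} {j : Fin n} (hu : HasPartial u j u')
    (hv : HasPartial v j v') :
    HasPartial (fun x => u x * v x) j (fun x => u' x * v x + u x * v' x) where
  temp := hu.temp.mul hv.temp
  temp' := (hu.temp'.mul hv.temp).add (hu.temp.mul hv.temp')
  fderiv_eq x := by
    rw [fderiv_fun_mul (hu.temp.1.differentiable (by simp) x)
      (hv.temp.1.differentiable (by simp) x)]
    simp [hu.fderiv_eq, hv.fderiv_eq]
    ring

theorem HasPartial.add {u u' v v' : E n → ℝ} {j : Fin n} (hu : HasPartial u j u')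
    (hv : HasPartial v j v') :
    HasPartial (fun x => u x + v x) j (fun x => u' x + v' x) where
  temp := hu.temp.add hv.temp
  temp' := hu.temp'.add hv.temp'
  fderiv_eq x := by
    rw [fderiv_fun_add (hu.temp.1.differentiable (by simp) x)
      (hv.temp.1.differentiable (by simp) x)]
    simp [hu.fderiv_eq, hv.fderiv_eq]

theorem HasPartial.const_mul {u u' : E n → ℝ} {j : Fin n} (hu : HasPartial u j u') (b : ℝ) :
    HasPartial (fun x => b * u x) j (fun x => b * u' x) where
  temp := (Function.HasTemperateGrowth.const b).mul hu.temp
  temp' := (Function.HasTemperateGrowth.const b).mul hu.temp'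
  fderiv_eq x := by
    rw [fderiv_const_mul (hu.temp.1.differentiable (by simp) x)]
    simp [hu.fderiv_eq]

theorem hasTemperateGrowth_coord (c : E n) (j : Fin n) :
    (fun x : E n => (x - c) j).HasTemperateGrowth := by
  have : (fun x : E n => (x - c) j) = fun x => inner ℝ (x - c) (basisVec j) := by
    ext x; rw [inner_basisVec]
  rw [this]
  exact (Function.hasTemperateGrowth_inner_left (basisVec j)).comp
    (Function.HasTemperateGrowth.id'.sub (.const c))

theorem hasPartial_coord (c : E n) (j k : Fin n) :
    HasPartial (fun x : E n => (x - c) j) k (fun _ => if j = k then 1 else 0) where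
  temp := hasTemperateGrowth_coord c j
  temp' := .const _
  fderiv_eq x := by
    have : (fun x : E n => (x - c) j) = fun x => innerSL ℝ (basisVec j) x - c j := by
      ext x; rw [innerSL_apply_apply, real_inner_comm, inner_basisVec]; simp
    rw [this, fderiv_sub_const, ContinuousLinearMap.fderiv, innerSL_apply_apply, inner_basisVec]
    simp [basisVec, PiLp.single_apply, eq_comm]

theorem HasPartial.congr {u u' v v' : E n → ℝ} {j : Fin n} (hu : HasPartial u j u')
    (h : ∀ x, v x = u x) (h' : ∀ x, v' x = u' x) : HasPartial v j v' := by
  rwa [show v = u from funext h, show v' = u' from funext h']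

theorem HasPartial.sum {ι : Type*} (s : Finset ι) {u u' : ι → E n → ℝ} {j : Fin n}
    (hu : ∀ i ∈ s, HasPartial (u i) j (u' i)) :
    HasPartial (fun x => ∑ i ∈ s, u i x) j (fun x => ∑ i ∈ s, u' i x) where
  temp := by
    simpa [Finset.sum_fn] using Function.HasTemperateGrowth.sum (fun i hi => (hu i hi).temp)
  temp' := by
    simpa [Finset.sum_fn] using Function.HasTemperateGrowth.sum (fun i hi => (hu i hi).temp')
  fderiv_eq x := by
    rw [fderiv_fun_sum (fun i hi => (hu i hi).temp.1.differentiable (by simp) x)]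
    simp only [sum_apply]
    exact Finset.sum_congr rfl fun i hi => (hu i hi).fderiv_eq x

/-- `(1 + a |x - c|²)^r` has temperate growth. -/
theorem hasTemperateGrowth_rpow {a : ℝ} (ha : 0 ≤ a) (c : E n) (r : ℝ) :
    (fun x : E n => (1 + a * ‖x - c‖ ^ 2) ^ r).HasTemperateGrowth := by
  have h1 : (fun x : E n => √a • (x - c)).HasTemperateGrowth :=
    (Function.HasTemperateGrowth.const (√a)).smul
      (Function.HasTemperateGrowth.id'.sub (.const c))
  have h2 := (Function.hasTemperateGrowth_one_add_norm_sq_rpow (E n) r).comp h1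
  have h3 : (fun x : E n => (1 + a * ‖x - c‖ ^ 2) ^ r) =
      (fun x : E n => (1 + ‖x‖ ^ 2) ^ r) ∘ fun x => √a • (x - c) := by
    ext x
    simp [norm_smul, mul_pow, Real.sq_sqrt ha]
  rw [h3]
  exact h2

theorem hasPartial_rpow {a : ℝ} (ha : 0 ≤ a) (c : E n) (r : ℝ) (j : Fin n) :
    HasPartial (fun x : E n => (1 + a * ‖x - c‖ ^ 2) ^ r) j
      (fun x => (x - c) j * (2 * a * (r * (1 + a * ‖x - c‖ ^ 2) ^ (r - 1)))) := by
  refine HasPartial.of_radial (p := fun s => (1 + s) ^ r) (p' := fun s => r * (1 + s) ^ (r - 1))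
    (hasTemperateGrowth_rpow ha c r)
    ((Function.HasTemperateGrowth.const r).mul (hasTemperateGrowth_rpow ha c (r - 1)))
    (fun x => ?_) j
  have h1 : HasDerivAt (fun s : ℝ => 1 + s) 1 (a * ‖x - c‖ ^ 2) := (hasDerivAt_id _).const_add 1
  refine (h1.rpow_const (p := r) (Or.inl (by positivity))).congr_deriv (by ring)

theorem hasPartial_kfun {a : ℝ} (ha : 0 ≤ a) (c : E n) (m : ℕ) {τ : ℝ} (hτ : 0 ≤ τ)
    (j : Fin n) :
    HasPartial (fun x : E n => kfun m τ (a * ‖x - c‖ ^ 2)) j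
      (fun x => (x - c) j * (2 * a * (-τ * kfun (m + 2) (τ + 1) (a * ‖x - c‖ ^ 2)))) := by
  refine HasPartial.of_radial (p := kfun m τ) (p' := fun s => -τ * kfun (m + 2) (τ + 1) s)
    (hasTemperateGrowth_kfun ha c m hτ)
    ((Function.HasTemperateGrowth.const _).mul (hasTemperateGrowth_kfun ha c _ (by linarith)))
    (fun x => hasDerivAt_kfun m hτ ?_) j
  have : 0 ≤ a * ‖x - c‖ ^ 2 := by positivity
  linarith

/-! ### Quadratic form identities on Schwartz functions -/

/-- The Dirichlet form `∑ⱼ ‖∂ⱼ φ‖²`. -/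
def dirichlet (φ : 𝓢(E n, ℂ)) : ℝ := ∑ j, realInner (dS j φ) (dS j φ)

theorem dirichlet_nonneg (φ : 𝓢(E n, ℂ)) : 0 ≤ dirichlet φ :=
  Finset.sum_nonneg fun _ _ => realInner_self_nonneg _

theorem realInner_mulS_sum {ι : Type*} (s : Finset ι) {u : ι → E n → ℝ}
    (hu : ∀ i ∈ s, (u i).HasTemperateGrowth) (φ η : 𝓢(E n, ℂ)) :
    realInner φ (mulS (fun x => ∑ i ∈ s, u i x) η) = ∑ i ∈ s, realInner φ (mulS (u i) η) := by
  rw [mulS_sum s hu, map_sum]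

/-- Completing the square: `-Δ ≥ div G - |G|²`. -/
theorem dirichlet_ge_of_field {G G' : Fin n → E n → ℝ} (hG : ∀ j, HasPartial (G j) j (G' j))
    (u : 𝓢(E n, ℂ)) :
    realInner u (mulS (fun x => ∑ j, (G' j x + (-1) * (G j x * G j x))) u) ≤ dirichlet u := by
  have hG2 : ∀ j, (fun x => G j x * G j x).HasTemperateGrowth := fun j =>
    (hG j).temp.mul (hG j).temp
  have hG3 : ∀ j, (fun x => (-1) * (G j x * G j x)).HasTemperateGrowth := fun j =>
    (Function.HasTemperateGrowth.const (-1)).mul (hG2 j)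
  rw [realInner_mulS_sum Finset.univ (u := fun j x => G' j x + (-1) * (G j x * G j x))
    (fun j _ => (hG j).temp'.add (hG3 j))]
  refine Finset.sum_le_sum fun j _ => ?_
  have h0 := realInner_self_nonneg (dS j u + mulS (G j) u)
  have h1 := (hG j).two_mul_realInner u
  rw [realInner_mulS (hG j).temp] at h1
  have h2 : realInner (mulS (G j) u) (mulS (G j) u) =
      realInner u (mulS (fun x => G j x * G j x) u) := by
    rw [← realInner_mulS (hG j).temp, mulS_mulS (hG j).temp (hG j).temp]
  rw [mulS_add (hG j).temp' (hG3 j), mulS_const_mul (hG2 j), map_add, map_smul, smul_eq_mul, ← h2]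
  rw [map_add, map_add, LinearMap.add_apply, LinearMap.add_apply,
    realInner_comm (dS j u) (mulS _ _)] at h0
  linarith

/-- The localization formula `∇ w² ∇ = w Δ w - w (Δ w)`. -/
theorem dirichlet_mulS {w : E n → ℝ} {w' w'' : Fin n → E n → ℝ}
    (hw : ∀ j, HasPartial w j (w' j)) (hw' : ∀ j, HasPartial (w' j) j (w'' j))
    (φ : 𝓢(E n, ℂ)) :
    ∑ j, realInner (dS j φ) (mulS (fun x => w x * w x) (dS j φ)) =
      dirichlet (mulS w φ) + realInner φ (mulS (fun x => ∑ j, w x * w'' j x) φ) := by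
  rw [realInner_mulS_sum Finset.univ (u := fun j x => w x * w'' j x)
      (fun j _ => (hw j).temp.mul (hw' j).temp'), dirichlet,
    ← Finset.sum_add_distrib]
  refine Finset.sum_congr rfl fun j _ => ?_
  -- The cross term of `‖∂ⱼ(wφ)‖²` is `2 (φ, w w' ∂ⱼφ)`. Integrated by parts it gives `-(φ, (w'² + w
  -- w'') φ)`, whose first half cancels `‖w' φ‖²`.
  have hp := (hw j).mul (hw' j)
  have h1 := hp.two_mul_realInner φ
  have hw1 := (hw j).temp
  have hw2 := (hw j).temp'
  rw [mulS_add (u := fun x => w' j x * w' j x) (v := fun x => w x * w'' j x) (hw2.mul hw2)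
    (hw1.mul (hw' j).temp'), map_add] at h1
  have h2 : realInner (mulS w (dS j φ)) (mulS (w' j) φ) =
      realInner φ (mulS (fun x => w x * w' j x) (dS j φ)) := by
    rw [realInner_comm, ← realInner_mulS hw2, mulS_mulS hw2 hw1]
    simp only [mul_comm]
  have h3 : realInner (mulS (w' j) φ) (mulS (w' j) φ) =
      realInner φ (mulS (fun x => w' j x * w' j x) φ) := by
    rw [← realInner_mulS hw2, mulS_mulS hw2 hw2]
  have h4 : realInner (mulS w (dS j φ)) (mulS w (dS j φ)) =
      realInner (dS j φ) (mulS (fun x => w x * w x) (dS j φ)) := by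
    rw [← realInner_mulS hw1, mulS_mulS hw1 hw1]
  rw [(hw j).dS_mulS, map_add, map_add, LinearMap.add_apply, LinearMap.add_apply,
    realInner_comm (mulS (w' j) φ) (mulS w (dS j φ)), h2, h3, h4]
  linarith

/-- The virial identity: the form of `i[-Δ, γ]` on Schwartz functions, where
`γ = -i (2 A · ∇ + div A)`. -/
theorem virial_identity {A : Fin n → E n → ℝ} {A' : Fin n → Fin n → E n → ℝ} {D : E n → ℝ}
    {D' D'' : Fin n → E n → ℝ} (hA : ∀ j k, HasPartial (A j) k (A' j k))
    (hD : ∀ x, D x = ∑ j, A' j j x) (hD' : ∀ j, HasPartial D j (D' j))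
    (hD'' : ∀ j, HasPartial (D' j) j (D'' j)) (φ : 𝓢(E n, ℂ)) :
    2 * ∑ j, realInner (dS j φ) (dS j ((2 : ℝ) • ∑ k, mulS (A k) (dS k φ) + mulS D φ)) =
      4 * ∑ j, ∑ k, realInner (dS j φ) (mulS (A' k j) (dS k φ)) -
        realInner φ (mulS (fun x => ∑ j, D'' j x) φ) := by
  rw [realInner_mulS_sum _ (fun j _ => (hD'' j).temp'), Finset.mul_sum, Finset.mul_sum,
    ← Finset.sum_sub_distrib]
  refine Finset.sum_congr rfl fun j _ => ?_
  -- The term `A k ∂ₖ∂ⱼφ`, paired with `∂ⱼφ`, is half a divergence. Summed over `k` with the factor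
  -- 2, these terms cancel the contribution of `D ∂ⱼφ` in `h2`.
  have h1 : ∀ k, realInner (dS j φ) (dS j (mulS (A k) (dS k φ))) =
      -(1 / 2) * realInner (dS j φ) (mulS (A' k k) (dS j φ)) +
        realInner (dS j φ) (mulS (A' k j) (dS k φ)) := by
    intro k
    have := (hA k k).two_mul_realInner (dS j φ)
    rw [(hA k j).dS_mulS, map_add, dS_comm j k]
    linarith
  have h2 : realInner (dS j φ) (mulS D (dS j φ)) =
      ∑ k, realInner (dS j φ) (mulS (A' k k) (dS j φ)) := by
    rw [← realInner_mulS_sum _ (fun k _ => (hA k k).temp'), show D = _ from funext hD]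
  have h3 := (hD'' j).two_mul_realInner φ
  rw [realInner_mulS (hD'' j).temp, realInner_comm] at h3
  rw [map_add, map_smul, map_sum, (hD' j).dS_mulS, map_add, map_smul, map_add, map_sum,
    Finset.sum_congr rfl (fun k _ => h1 k), Finset.sum_add_distrib, ← Finset.mul_sum, h2,
    smul_eq_mul]
  linarith

/-! ### Hardy's inequality -/

/-- The regularized Hardy inequality. -/
theorem hardy (hn : 2 ≤ n) {η : ℝ} (hη : 0 < η) (c : E n) (u : 𝓢(E n, ℂ)) :
    ((n : ℝ) - 2) ^ 2 / 4 * realInner u (mulS (fun x => (‖x - c‖ ^ 2 + η)⁻¹) u) ≤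
      dirichlet u := by
  have hn' : (2 : ℝ) ≤ n := by exact_mod_cast hn
  have ha : 0 ≤ η⁻¹ := by positivity
  have hq : ∀ x : E n, (1 + η⁻¹ * ‖x - c‖ ^ 2) ^ (-1 : ℝ) = η * (‖x - c‖ ^ 2 + η)⁻¹ := fun x => by
    rw [Real.rpow_neg_one]
    field_simp
    ring
  have hq2 : ∀ x : E n, (1 + η⁻¹ * ‖x - c‖ ^ 2) ^ (-1 - 1 : ℝ) =
      η ^ 2 * ((‖x - c‖ ^ 2 + η)⁻¹) ^ 2 := fun x => by
    rw [show (-1 - 1 : ℝ) = -1 * 2 by norm_num, Real.rpow_mul (by positivity), hq]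
    norm_num [mul_pow]
  have hT : (fun x : E n => (‖x - c‖ ^ 2 + η)⁻¹).HasTemperateGrowth := by
    have := (Function.HasTemperateGrowth.const (η⁻¹)).mul (hasTemperateGrowth_rpow ha c (-1))
    have h2 : (fun x : E n => (‖x - c‖ ^ 2 + η)⁻¹) =
        (fun _ => η⁻¹) * fun x => (1 + η⁻¹ * ‖x - c‖ ^ 2) ^ (-1 : ℝ) := by
      ext x
      rw [Pi.mul_apply, hq, inv_mul_cancel_left₀ hη.ne']
    rw [h2]
    exact this
  -- The field is `G = α (x - c)/(|x - c|² + η)`. This value of `α` maximizes `α (n - 2) - α²`, the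
  -- coefficient in `div G - |G|²` when `η = 0`.
  set α : ℝ := ((n : ℝ) - 2) / 2 with hα
  have hα0 : 0 ≤ α := by rw [hα]; linarith
  have hG : ∀ j, HasPartial (fun x : E n => α * ((x - c) j * (‖x - c‖ ^ 2 + η)⁻¹)) j
      (fun x => α * ((‖x - c‖ ^ 2 + η)⁻¹ -
        2 * ((x - c) j ^ 2 * ((‖x - c‖ ^ 2 + η)⁻¹) ^ 2))) := by
    intro j
    refine ((hasPartial_coord c j j).mul
      ((hasPartial_rpow ha c (-1) j).const_mul (η⁻¹))).const_mul α |>.congr (fun x => ?_)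
      (fun x => ?_)
    · rw [hq, inv_mul_cancel_left₀ hη.ne']
    · rw [hq, hq2, inv_mul_cancel_left₀ hη.ne', if_pos rfl]
      field_simp
      ring
  refine le_trans ?_ (dirichlet_ge_of_field hG u)
  rw [← smul_eq_mul, ← map_smul, ← mulS_const_mul hT]
  have hG3 : (fun x : E n => ∑ j, (α * ((‖x - c‖ ^ 2 + η)⁻¹ -
        2 * ((x - c) j ^ 2 * ((‖x - c‖ ^ 2 + η)⁻¹) ^ 2)) +
        -1 * (α * ((x - c) j * (‖x - c‖ ^ 2 + η)⁻¹) * (α * ((x - c) j * (‖x - c‖ ^ 2 + η)⁻¹)))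
        )).HasTemperateGrowth := by
    simpa [Finset.sum_fn] using Function.HasTemperateGrowth.sum (s := Finset.univ) (fun j _ =>
      (hG j).temp'.add ((Function.HasTemperateGrowth.const (-1)).mul ((hG j).temp.mul (hG j).temp)))
  refine realInner_mulS_self_mono ((Function.HasTemperateGrowth.const _).mul hT) hG3 (fun x => ?_) u
  have hr : ‖x - c‖ ^ 2 = ∑ j, (x - c) j ^ 2 := EuclideanSpace.real_norm_sq_eq _
  have hpos : 0 < ‖x - c‖ ^ 2 + η := by positivity
  set T := (‖x - c‖ ^ 2 + η)⁻¹ with hTdef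
  have hTpos : 0 < T := inv_pos.2 hpos
  have hT1 : T * (‖x - c‖ ^ 2 + η) = 1 := inv_mul_cancel₀ hpos.ne'
  have hsum : ∑ j, (α * (T - 2 * ((x - c) j ^ 2 * T ^ 2)) +
        -1 * (α * ((x - c) j * T) * (α * ((x - c) j * T)))) =
      α * (n * T) - (2 * α + α ^ 2) * T ^ 2 * ‖x - c‖ ^ 2 := by
    have : ∀ j, (α * (T - 2 * ((x - c) j ^ 2 * T ^ 2)) +
        -1 * (α * ((x - c) j * T) * (α * ((x - c) j * T)))) =
        α * T - (2 * α + α ^ 2) * T ^ 2 * ((x - c) j ^ 2) := fun j => by ring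
    rw [Finset.sum_congr rfl (fun j _ => this j), Finset.sum_sub_distrib,
      ← Finset.mul_sum Finset.univ (fun j => (x - c) j ^ 2), ← hr]
    simp
    ring
  rw [hsum]
  have h5 : T * ‖x - c‖ ^ 2 = 1 - T * η := by linarith
  have h6 : (2 * α + α ^ 2) * T ^ 2 * ‖x - c‖ ^ 2 = (2 * α + α ^ 2) * T * (1 - T * η) := by
    rw [← h5]; ring
  have h7 : (n : ℝ) = 2 * α + 2 := by rw [hα]; ring
  have h8 : ((n : ℝ) - 2) ^ 2 / 4 = α ^ 2 := by rw [hα]; ring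
  rw [h6, h8, h7]
  -- The regularization only adds this nonnegative term to `α² T`, so the constant stays that of
  -- Hardy's inequality for every `η`.
  have h9 : 0 ≤ (2 * α + α ^ 2) * T * (T * η) := by positivity
  change α ^ 2 * T ≤ _
  linarith

/-! ### The functions `F_c` and their derivatives -/

/-- Substituting `s = r t` exhibits `f(r)/r` as a smooth function of `a r²`, so the gradient of
`F_c` has no singularity at `c`. -/
theorem profile_eq (a σ r : ℝ) : profile a σ r = r * kfun 0 σ (a * r ^ 2) := by
  have h := intervalIntegral.mul_integral_comp_mul_left (a := (0 : ℝ)) (b := 1)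
    (f := fun s : ℝ => (1 + a * s ^ 2) ^ (-σ)) r
  rw [mul_zero, mul_one] at h
  rw [profile, ← h, kfun]
  congr 1
  refine intervalIntegral.integral_congr fun t _ => ?_
  simp only [pow_zero, one_mul]
  congr 2
  ring

theorem hasDerivAt_integral_kfun {a σ : ℝ} (ha : 0 < a) (hσ : 0 ≤ σ) {v : ℝ} (hv : 0 ≤ v) :
    HasDerivAt (fun v => ∫ u in (0 : ℝ)..v, kfun 0 σ (a * u)) (kfun 0 σ (a * v)) v := by
  have hcont : ∀ u ∈ Set.Ioi (-(1 / 2) / a), ContinuousAt (fun u => kfun 0 σ (a * u)) u := by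
    intro u hu
    have hu' : -(1 / 2) < a * u := by
      rw [Set.mem_Ioi, div_lt_iff₀ ha] at hu
      linarith
    exact ContinuousAt.comp (f := fun u => a * u) (g := kfun 0 σ)
      (hasDerivAt_kfun 0 hσ hu').continuousAt (by fun_prop)
  have hneg : -(1 / 2) / a < 0 := div_neg_of_neg_of_pos (by norm_num) ha
  have hv' : v ∈ Set.Ioi (-(1 / 2) / a) := lt_of_lt_of_le hneg hv
  refine intervalIntegral.integral_hasDerivAt_right ?_ ?_ (hcont v hv')
  · refine ContinuousOn.intervalIntegrable fun u hu => (hcont u ?_).continuousWithinAt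
    rw [Set.uIcc_of_le hv] at hu
    exact lt_of_lt_of_le hneg hu.1
  · exact ContinuousOn.stronglyMeasurableAtFilter isOpen_Ioi
      (fun u hu => (hcont u hu).continuousWithinAt) v hv'

theorem continuous_profile {a : ℝ} (ha : 0 ≤ a) (σ : ℝ) : Continuous (profile a σ) := by
  have hc : Continuous fun s : ℝ => (1 + a * s ^ 2) ^ (-σ) :=
    Continuous.rpow_const (by fun_prop) fun s => Or.inl (by positivity)
  exact intervalIntegral.continuous_primitive (fun _ _ => hc.intervalIntegrable _ _) 0

/-- As a function of `|x - c|²`, and not of `|x - c|`, `F_c` can be differentiated at `c` too. The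
factor `1 *` fits the form `a * ‖x - c‖ ^ 2` used in `hasFDerivAt_radial`. -/
theorem radialF_eq {a σ : ℝ} (ha : 0 < a) (hσ : 0 ≤ σ) (c x : E n) :
    radialF a σ c x = (1 / 2) * ∫ u in (0 : ℝ)..(1 * ‖x - c‖ ^ 2), kfun 0 σ (a * u) := by
  have h := intervalIntegral.integral_eq_sub_of_hasDerivAt (a := (0 : ℝ)) (b := ‖x - c‖)
    (f := fun r => (1 / 2) * ∫ u in (0 : ℝ)..r ^ 2, kfun 0 σ (a * u)) (f' := profile a σ)
    (fun r _ => ?_) ((continuous_profile ha.le σ).intervalIntegrable _ _)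
  · rw [radialF, h]
    simp
  · have h1 := (HasDerivAt.comp (h := fun r : ℝ => r ^ 2) r
      (hasDerivAt_integral_kfun ha hσ (sq_nonneg r)) (hasDerivAt_pow 2 r)).const_mul (1 / 2)
    refine h1.congr_deriv ?_
    rw [profile_eq]
    push_cast
    ring

theorem partialF_eq {a σ : ℝ} (ha : 0 < a) (hσ : 0 ≤ σ) (c : E n) (j : Fin n) :
    partialF a σ c j = fun x => (x - c) j * kfun 0 σ (a * ‖x - c‖ ^ 2) := by
  ext x
  have h1 := hasFDerivAt_radial (a := 1) (c := c) (x := x)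
    (p := fun v => (1 / 2) * ∫ u in (0 : ℝ)..v, kfun 0 σ (a * u))
    ((hasDerivAt_integral_kfun ha hσ (by positivity)).const_mul (1 / 2))
  rw [partialF, show radialF a σ c = _ from funext (radialF_eq ha hσ c), h1.fderiv,
    smul_apply, innerSL_apply_apply, inner_basisVec, smul_eq_mul, one_mul]
  ring

/-- The second derivatives `∂ₖ ∂ⱼ F_c`. -/
def hessF (a σ : ℝ) (c : E n) (j k : Fin n) (x : E n) : ℝ :=
  (if j = k then 1 else 0) * kfun 0 σ (a * ‖x - c‖ ^ 2) +
    (x - c) j * ((x - c) k * (2 * a * (-σ * kfun 2 (σ + 1) (a * ‖x - c‖ ^ 2))))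

/-- The Laplacian `Δ F_c`. -/
def lapF (a σ : ℝ) (c x : E n) : ℝ :=
  ((n : ℝ) - 1) * kfun 0 σ (a * ‖x - c‖ ^ 2) + (1 + a * ‖x - c‖ ^ 2) ^ (-σ)

/-- The radial factor of `∇ Δ F_c`. -/
def lapFRad (a σ : ℝ) (c x : E n) : ℝ :=
  -(2 * a * σ) * (((n : ℝ) - 1) * kfun 2 (σ + 1) (a * ‖x - c‖ ^ 2) +
    (1 + a * ‖x - c‖ ^ 2) ^ (-σ - 1))

/-- The radial factor of `∇ (lapFRad)`. -/
def lapFRad' (a σ : ℝ) (c x : E n) : ℝ :=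
  4 * a ^ 2 * σ * (σ + 1) * (((n : ℝ) - 1) * kfun 4 (σ + 2) (a * ‖x - c‖ ^ 2) +
    (1 + a * ‖x - c‖ ^ 2) ^ (-σ - 2))

theorem hasPartial_partialF {a σ : ℝ} (ha : 0 < a) (hσ : 0 ≤ σ) (c : E n) (j k : Fin n) :
    HasPartial (partialF a σ c j) k (hessF a σ c j k) := by
  rw [partialF_eq ha hσ]
  exact ((hasPartial_coord c j k).mul (hasPartial_kfun ha.le c 0 hσ k))

/-- The trace of the Hessian is `n f/r + r (f/r)'`, and the recursion with `m = 0` rewrites it as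
`(n - 1) f/r + f'`. -/
theorem lapF_eq_sum {a σ : ℝ} (ha : 0 < a) (c x : E n) : lapF a σ c x = ∑ j, hessF a σ c j j x := by
  have hr : ‖x - c‖ ^ 2 = ∑ j, (x - c) j ^ 2 := EuclideanSpace.real_norm_sq_eq _
  have h1 : ∀ j, hessF a σ c j j x = kfun 0 σ (a * ‖x - c‖ ^ 2) +
      (x - c) j ^ 2 * (2 * a * (-σ * kfun 2 (σ + 1) (a * ‖x - c‖ ^ 2))) := fun j => by
    rw [hessF, if_pos rfl]; ring
  have h2 := kfun_recursion 0 σ (s := a * ‖x - c‖ ^ 2) (by positivity)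
  rw [Finset.sum_congr rfl (fun j _ => h1 j), Finset.sum_add_distrib, ← Finset.sum_mul, ← hr,
    lapF, ← h2]
  simp
  ring

theorem hasPartial_lapF {a σ : ℝ} (ha : 0 < a) (hσ : 0 ≤ σ) (c : E n) (j : Fin n) :
    HasPartial (lapF a σ c) j (fun x => (x - c) j * lapFRad a σ c x) := by
  refine (((hasPartial_kfun ha.le c 0 hσ j).const_mul ((n : ℝ) - 1)).add
    (hasPartial_rpow ha.le c (-σ) j)).congr (fun x => rfl) fun x => ?_
  rw [lapFRad]
  ring

theorem hasPartial_lapFRad {a σ : ℝ} (ha : 0 < a) (hσ : 0 ≤ σ) (c : E n) (j : Fin n) :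
    HasPartial (lapFRad a σ c) j (fun x => (x - c) j * lapFRad' a σ c x) := by
  refine (((hasPartial_kfun ha.le c 2 (τ := σ + 1) (by linarith) j).const_mul ((n : ℝ) - 1)).add
    (hasPartial_rpow ha.le c (-σ - 1) j)).const_mul (-(2 * a * σ)) |>.congr
    (fun x => rfl) fun x => ?_
  rw [lapFRad', show σ + 1 + 1 = σ + 2 by ring, show -σ - 1 - 1 = -σ - 2 by ring]
  ring

theorem hasPartial_lapF' {a σ : ℝ} (ha : 0 < a) (hσ : 0 ≤ σ) (c : E n) (j : Fin n) :
    HasPartial (fun x => (x - c) j * lapFRad a σ c x) j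
      (fun x => lapFRad a σ c x + (x - c) j ^ 2 * lapFRad' a σ c x) := by
  refine ((hasPartial_coord c j j).mul (hasPartial_lapFRad ha hσ c j)).congr (fun x => rfl)
    fun x => ?_
  rw [if_pos rfl]
  ring

/-- The recursion with `m = 2` and `τ = σ + 1` eliminates `kfun 4`. What remains of `kfun 2` has
coefficient `-2aσ(n-1)(n-3)`, which is nonpositive for `n ≥ 3` and is dropped. -/
theorem bilaplacian_le {a σ : ℝ} (ha : 0 < a) (hσ : 0 ≤ σ) (hn : 3 ≤ n) (c x : E n) :
    ∑ j, (lapFRad a σ c x + (x - c) j ^ 2 * lapFRad' a σ c x) ≤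
      -(2 * a * σ) * ((2 * n - 1) * (1 + a * ‖x - c‖ ^ 2) ^ (-σ - 1) -
        2 * (σ + 1) * (a * ‖x - c‖ ^ 2) * (1 + a * ‖x - c‖ ^ 2) ^ (-σ - 2)) := by
  have hn' : (3 : ℝ) ≤ n := by exact_mod_cast hn
  have hr : ‖x - c‖ ^ 2 = ∑ j, (x - c) j ^ 2 := EuclideanSpace.real_norm_sq_eq _
  have h2 := kfun_recursion 2 (σ + 1) (s := a * ‖x - c‖ ^ 2) (by positivity)
  have hk : 0 ≤ kfun 2 (σ + 1) (a * ‖x - c‖ ^ 2) := kfun_nonneg _ _ (by positivity)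
  rw [Finset.sum_add_distrib, ← Finset.sum_mul, ← hr, lapFRad, lapFRad']
  rw [show σ + 1 + 1 = σ + 2 by ring, show -(σ + 1) = -σ - 1 by ring] at h2
  have h3 : 0 ≤ 2 * a * σ * (((n : ℝ) - 1) * ((n : ℝ) - 3)) *
      kfun 2 (σ + 1) (a * ‖x - c‖ ^ 2) := by
    have h4 : 0 ≤ ((n : ℝ) - 1) * ((n : ℝ) - 3) := mul_nonneg (by linarith) (by linarith)
    positivity
  have h5 : 2 * (σ + 1) * (a * ‖x - c‖ ^ 2 * kfun 4 (σ + 2) (a * ‖x - c‖ ^ 2)) =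
      3 * kfun 2 (σ + 1) (a * ‖x - c‖ ^ 2) - (1 + a * ‖x - c‖ ^ 2) ^ (-σ - 1) := by
    push_cast at h2
    linarith
  simp only [Finset.sum_const, Finset.card_univ, Fintype.card_fin, nsmul_eq_mul]
  generalize kfun 2 (σ + 1) (a * ‖x - c‖ ^ 2) = K2 at *
  generalize kfun 4 (σ + 2) (a * ‖x - c‖ ^ 2) = K4 at *
  generalize (1 + a * ‖x - c‖ ^ 2) ^ (-σ - 1) = G1 at *
  generalize (1 + a * ‖x - c‖ ^ 2) ^ (-σ - 2) = G2 at *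
  generalize ‖x - c‖ ^ 2 = r at *
  have h6 : r * (4 * a ^ 2 * σ * (σ + 1) * (((n : ℝ) - 1) * K4 + G2)) =
      2 * a * σ * (((n : ℝ) - 1) * (2 * (σ + 1) * (a * r * K4)) +
        2 * (σ + 1) * (a * r) * G2) := by ring
  rw [h6, h5]
  linarith

/-! ### The weights and the pointwise comparison of potentials -/

theorem weight_eq {a σ : ℝ} (ha : 0 < a) (c x : E n) : weight a σ c x = (1 + a * ‖x - c‖ ^ 2) ^ (-σ / 2) := by
  rw [weight, Real.sqrt_eq_rpow, ← Real.rpow_mul (by positivity)]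
  congr 1
  ring

/-- The radial factor of `∇ ⟨x - c⟩^(-σ)`. -/
def weightRad (a σ : ℝ) (c x : E n) : ℝ := -(a * σ) * (1 + a * ‖x - c‖ ^ 2) ^ (-σ / 2 - 1)

/-- The radial factor of `∇ (weightRad)`. -/
def weightRad' (a σ : ℝ) (c x : E n) : ℝ :=
  a ^ 2 * σ * (σ + 2) * (1 + a * ‖x - c‖ ^ 2) ^ (-σ / 2 - 2)

theorem hasPartial_weight {a σ : ℝ} (ha : 0 < a) (c : E n) (j : Fin n) :
    HasPartial (weight a σ c) j (fun x => (x - c) j * weightRad a σ c x) := by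
  refine (hasPartial_rpow ha.le c (-σ / 2) j).congr (weight_eq ha c) fun x => ?_
  rw [weightRad]
  ring

theorem hasPartial_weight' {a σ : ℝ} (ha : 0 < a) (c : E n) (j : Fin n) :
    HasPartial (fun x => (x - c) j * weightRad a σ c x) j
      (fun x => weightRad a σ c x + (x - c) j ^ 2 * weightRad' a σ c x) := by
  refine ((hasPartial_coord c j j).mul
    ((hasPartial_rpow ha.le c (-σ / 2 - 1) j).const_mul (-(a * σ)))).congr (fun x => rfl)
    fun x => ?_
  rw [if_pos rfl, weightRad, weightRad', show -σ / 2 - 1 - 1 = -σ / 2 - 2 by ring]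
  ring

theorem weight_mul_weight {a σ : ℝ} (ha : 0 < a) (c x : E n) :
    weight a σ c x * weight a σ c x = (1 + a * ‖x - c‖ ^ 2) ^ (-σ) := by
  rw [weight_eq ha, ← Real.rpow_add (by positivity)]
  congr 1
  ring

/-- The elementary inequality behind the second inequality of the theorem. -/
theorem hardy_scalar {s t : ℝ} (hs : 0 < s) (hs' : s ≤ 1 / 32) (ht : 0 ≤ t) :
    8 * (1 - t) * ((1 + t)⁻¹) ^ 2 ≤ (t + s)⁻¹ + 48 * s := by
  have h1 : 8 * (1 - t) * (t + s) ≤ (1 + t) ^ 2 * (1 + 48 * s * (t + s)) := by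
    -- For `s = 0` the difference of the two sides is `(3t - 1)²`, which vanishes at `t = 1/3`. The
    -- extra `8s(1 - t)` is paid by the term with `48 s` if `t ≥ 1/6`, because `48/6 = 8`. If `t ≤
    -- 1/6` it is paid by `(3t - 1)² ≥ 1/4 ≥ 8s`.
    rcases le_total (1 / 6) t with h | h
    · nlinarith [sq_nonneg (3 * t - 1), mul_nonneg hs.le (sub_nonneg.2 h), mul_nonneg hs.le hs.le,
        mul_nonneg (mul_nonneg hs.le ht) ht, mul_nonneg (mul_nonneg hs.le hs.le) ht,
        mul_nonneg (mul_nonneg hs.le hs.le) (mul_nonneg ht ht),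
        mul_nonneg (mul_nonneg hs.le ht) (mul_nonneg ht ht)]
    · have h2 : 0 ≤ (1 + t) ^ 2 * (48 * s * (t + s)) := by positivity
      nlinarith [mul_nonneg hs.le ht]
  have hp : 0 < (1 + t) ^ 2 := by positivity
  have hq : 0 < t + s := by positivity
  calc 8 * (1 - t) * ((1 + t)⁻¹) ^ 2 = 8 * (1 - t) * (t + s) / ((1 + t) ^ 2 * (t + s)) := by
        field_simp
    _ ≤ (1 + t) ^ 2 * (1 + 48 * s * (t + s)) / ((1 + t) ^ 2 * (t + s)) := by gcongr
    _ = (t + s)⁻¹ + 48 * s := by field_simp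

/-- With `t = a|x - c|²` and `g = (1 + t)^(-σ)`, the dimension cancels between `4 w Δw` and the
bound on `Δ²F_c`. The right side is then at least `-2aσ g (1 - t)/(1 + t)²`, and `hardy_scalar` with
`s = a η` compares this with the regularized Hardy weight. -/
theorem potential_ge {a σ : ℝ} (ha : 0 < a) (hσ : 0 ≤ σ) (hn : 3 ≤ n) {η : ℝ} (hη : 0 < η) (hη' : a * η ≤ 1 / 32) (c x : E n) :
    -(σ / 4) * (weight a σ c x * weight a σ c x * (‖x - c‖ ^ 2 + η)⁻¹) +
        -(12 * σ * a ^ 2 * η) ≤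
      4 * (∑ j, weight a σ c x * (weightRad a σ c x + (x - c) j ^ 2 * weightRad' a σ c x)) +
        (-1) * ∑ j, (lapFRad a σ c x + (x - c) j ^ 2 * lapFRad' a σ c x) := by
  have hr : ‖x - c‖ ^ 2 = ∑ j, (x - c) j ^ 2 := EuclideanSpace.real_norm_sq_eq _
  have h1 := bilaplacian_le ha hσ hn c x
  have hpos : 0 < 1 + a * ‖x - c‖ ^ 2 := by positivity
  set t := a * ‖x - c‖ ^ 2 with ht
  have ht0 : 0 ≤ t := by positivity
  have hG1 : (1 + t) ^ (-σ - 1) = (1 + t) ^ (-σ) * (1 + t)⁻¹ := by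
    rw [Real.rpow_sub hpos, Real.rpow_one, div_eq_mul_inv]
  have hG2 : (1 + t) ^ (-σ - 2) = (1 + t) ^ (-σ) * ((1 + t)⁻¹) ^ 2 := by
    rw [Real.rpow_sub hpos, Real.rpow_two, div_eq_mul_inv, inv_pow]
  have hw1 : weight a σ c x * weightRad a σ c x = -(a * σ) * ((1 + t) ^ (-σ) * (1 + t)⁻¹) := by
    rw [weight_eq ha, weightRad, ← ht, ← hG1, mul_left_comm, ← Real.rpow_add hpos]
    congr 2
    ring
  have hw2 : weight a σ c x * weightRad' a σ c x =
      a ^ 2 * σ * (σ + 2) * ((1 + t) ^ (-σ) * ((1 + t)⁻¹) ^ 2) := by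
    rw [weight_eq ha, weightRad', ← ht, ← hG2, mul_left_comm, ← Real.rpow_add hpos]
    congr 2
    ring
  have hsum : ∑ j, weight a σ c x * (weightRad a σ c x + (x - c) j ^ 2 * weightRad' a σ c x) =
      n * (weight a σ c x * weightRad a σ c x) +
        ‖x - c‖ ^ 2 * (weight a σ c x * weightRad' a σ c x) := by
    rw [hr, Finset.sum_mul, ← Finset.mul_sum, Finset.sum_add_distrib, mul_add, Finset.mul_sum]
    congr 1
    · simp
    · rw [Finset.mul_sum]
      exact Finset.sum_congr rfl fun j _ => by ring
  rw [hsum, hw1, hw2, weight_mul_weight ha, ← ht]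
  rw [hG1, hG2] at h1
  have hg0 : 0 ≤ (1 + t) ^ (-σ) := by positivity
  have hg1 : (1 + t) ^ (-σ) ≤ 1 :=
    Real.rpow_le_one_of_one_le_of_nonpos (by linarith) (by linarith)
  have hsc := hardy_scalar (mul_pos ha hη) hη' ht0
  have hinv : (t + a * η)⁻¹ = a⁻¹ * (‖x - c‖ ^ 2 + η)⁻¹ := by
    rw [ht, ← mul_add, mul_inv]
  rw [hinv] at hsc
  have h2 : ‖x - c‖ ^ 2 * (a ^ 2 * σ * (σ + 2) * ((1 + t) ^ (-σ) * ((1 + t)⁻¹) ^ 2)) =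
      t * (a * σ * (σ + 2) * ((1 + t) ^ (-σ) * ((1 + t)⁻¹) ^ 2)) := by rw [ht]; ring
  have hJ : (1 + t)⁻¹ = ((1 + t)⁻¹) ^ 2 * (1 + t) := by field_simp
  have h3 : a * σ * (1 + t) ^ (-σ) / 4 * (8 * (1 - t) * ((1 + t)⁻¹) ^ 2) ≤
      a * σ * (1 + t) ^ (-σ) / 4 * (a⁻¹ * (‖x - c‖ ^ 2 + η)⁻¹ + 48 * (a * η)) :=
    mul_le_mul_of_nonneg_left hsc (by positivity)
  have h4 : a * σ * (1 + t) ^ (-σ) / 4 * (a⁻¹ * (‖x - c‖ ^ 2 + η)⁻¹ + 48 * (a * η)) =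
      σ / 4 * ((1 + t) ^ (-σ) * (‖x - c‖ ^ 2 + η)⁻¹) +
        12 * σ * a ^ 2 * η * (1 + t) ^ (-σ) := by
    field_simp
    ring
  have h5 : 12 * σ * a ^ 2 * η * (1 + t) ^ (-σ) ≤ 12 * σ * a ^ 2 * η :=
    mul_le_of_le_one_right (by positivity) hg1
  rw [h2]
  rw [hJ] at h1 ⊢
  generalize (1 + t) ^ (-σ) = g at *
  have h6 : ((1 + t)⁻¹ ^ 2 * (1 + t)) ^ 2 = ((1 + t)⁻¹) ^ 2 := by rw [← hJ]
  rw [h6] at h1 ⊢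
  rw [h4] at h3
  generalize ((1 + t)⁻¹) ^ 2 = J at *
  linarith

/-! ### The virial inequality on Schwartz functions -/

/-- The operator `i γ_c = 2 ∇F_c · ∇ + Δ F_c` on Schwartz functions. -/
def gammaS (a σ : ℝ) (c : E n) (φ : 𝓢(E n, ℂ)) : 𝓢(E n, ℂ) :=
  (2 : ℝ) • ∑ k, mulS (partialF a σ c k) (dS k φ) + mulS (lapF a σ c) φ

theorem hasTemperateGrowth_fun_sum {ι : Type*} (s : Finset ι) {u : ι → E n → ℝ}
    (hu : ∀ i ∈ s, (u i).HasTemperateGrowth) :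
    (fun x => ∑ i ∈ s, u i x).HasTemperateGrowth := by
  simpa [Finset.sum_fn] using Function.HasTemperateGrowth.sum hu

theorem norm_sum_smul_sq_le (v : Fin n → ℝ) (z : Fin n → ℂ) :
    ‖∑ j, v j • z j‖ ^ 2 ≤ (∑ j, v j ^ 2) * ∑ j, ‖z j‖ ^ 2 := by
  have h1 : ‖∑ j, v j • z j‖ ≤ ∑ j, |v j| * ‖z j‖ :=
    (norm_sum_le _ _).trans_eq (Finset.sum_congr rfl fun j _ => by
      rw [norm_smul, Real.norm_eq_abs])
  calc ‖∑ j, v j • z j‖ ^ 2 ≤ (∑ j, |v j| * ‖z j‖) ^ 2 := by gcongr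
    _ ≤ (∑ j, |v j| ^ 2) * ∑ j, ‖z j‖ ^ 2 := Finset.sum_mul_sq_le_sq_mul_sq _ _ _
    _ = _ := by simp only [sq_abs]

/-- The Hessian of `F_c` is bounded below by `⟨x - c⟩^(-2σ)`. -/
theorem hessF_ge {a σ : ℝ} (ha : 0 < a) (hσ : 0 ≤ σ) (c x : E n) (z : Fin n → ℂ) :
    ∑ j, weight a σ c x * weight a σ c x * inner ℝ (z j) (z j) ≤
      ∑ j, ∑ k, hessF a σ c k j x * inner ℝ (z j) (z k) := by
  have hr : ‖x - c‖ ^ 2 = ∑ j, (x - c) j ^ 2 := EuclideanSpace.real_norm_sq_eq _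
  have h2 := kfun_recursion 0 σ (s := a * ‖x - c‖ ^ 2) (by positivity)
  have hk : 0 ≤ kfun 2 (σ + 1) (a * ‖x - c‖ ^ 2) := kfun_nonneg _ _ (by positivity)
  -- Cauchy–Schwarz replaces `|(x - c) · z|²` by `|x - c|² |z|²`. The resulting factor is the one
  -- that the recursion identifies with `f' = w²`.
  have hcs := norm_sum_smul_sq_le (fun j => (x - c) j) z
  have hdiag : ∀ j k, hessF a σ c k j x * inner ℝ (z j) (z k) =
      (if k = j then kfun 0 σ (a * ‖x - c‖ ^ 2) * inner ℝ (z j) (z k) else 0) +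
        -(2 * a * σ * kfun 2 (σ + 1) (a * ‖x - c‖ ^ 2)) *
          inner ℝ ((x - c) j • z j) ((x - c) k • z k) := by
    intro j k
    rw [hessF, real_inner_smul_left, real_inner_smul_right]
    split_ifs <;> ring
  have hcross : ∑ j, ∑ k, inner ℝ ((x - c) j • z j) ((x - c) k • z k) =
      ‖∑ j, (x - c) j • z j‖ ^ 2 := by
    rw [← real_inner_self_eq_norm_sq, sum_inner]
    simp only [inner_sum]
  have hsum : ∑ j, ∑ k, hessF a σ c k j x * inner ℝ (z j) (z k) =
      kfun 0 σ (a * ‖x - c‖ ^ 2) * (∑ j, ‖z j‖ ^ 2) -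
        (2 * a * σ * kfun 2 (σ + 1) (a * ‖x - c‖ ^ 2)) * ‖∑ j, (x - c) j • z j‖ ^ 2 := by
    simp only [hdiag, Finset.sum_add_distrib, Finset.sum_ite_eq', Finset.mem_univ, if_true,
      ← Finset.mul_sum, hcross, real_inner_self_eq_norm_sq]
    ring
  rw [hsum, ← Finset.mul_sum, weight_mul_weight ha, ← h2]
  simp only [real_inner_self_eq_norm_sq]
  rw [← hr] at hcs
  have h3 := mul_le_mul_of_nonneg_left hcs
    (show 0 ≤ 2 * a * σ * kfun 2 (σ + 1) (a * ‖x - c‖ ^ 2) by positivity)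
  push_cast
  linarith

theorem realInner_hessF_ge {a σ : ℝ} (ha : 0 < a) (hσ : 0 ≤ σ) (c : E n) (φ : 𝓢(E n, ℂ)) :
    ∑ j, realInner (dS j φ) (mulS (fun x => weight a σ c x * weight a σ c x) (dS j φ)) ≤
      ∑ j, ∑ k, realInner (dS j φ) (mulS (hessF a σ c k j) (dS k φ)) := by
  have hH : ∀ k j, (hessF a σ c k j).HasTemperateGrowth := fun k j =>
    (hasPartial_partialF ha hσ c k j).temp'
  have hi : ∀ j k, Integrable fun x => hessF a σ c k j x * inner ℝ (dS j φ x) (dS k φ x) :=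
    fun j k => (integrable_inner (dS j φ) (mulS (hessF a σ c k j) (dS k φ))).congr
      (Eventually.of_forall fun x => inner_mulS (hH k j) _ _ x)
  have hw : (fun x => weight a σ c x * weight a σ c x).HasTemperateGrowth := by
    by_cases h : Nonempty (Fin n)
    · obtain ⟨j⟩ := h
      exact (hasPartial_weight ha c j).temp.mul (hasPartial_weight ha c j).temp
    · simp only [weight_mul_weight ha]
      exact hasTemperateGrowth_rpow ha.le c _
  have hi' : ∀ j, Integrable fun x =>
      weight a σ c x * weight a σ c x * inner ℝ (dS j φ x) (dS j φ x) :=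
    fun j => (integrable_inner (dS j φ)
      (mulS (fun x => weight a σ c x * weight a σ c x) (dS j φ))).congr
      (Eventually.of_forall fun x => inner_mulS hw _ _ x)
  simp only [realInner_eq_integral, inner_mulS hw, inner_mulS (hH _ _)]
  rw [← integral_finsetSum _ (fun j _ => hi' j),
    Finset.sum_congr rfl (fun j _ => (integral_finsetSum _ (fun k _ => hi j k)).symm),
    ← integral_finsetSum _ (fun j _ => integrable_finsetSum _ (fun k _ => hi j k))]
  exact integral_mono (integrable_finsetSum _ (fun j _ => hi' j))
    (integrable_finsetSum _ (fun j _ => integrable_finsetSum _ (fun k _ => hi j k)))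
    fun x => hessF_ge ha hσ c x fun j => dS j φ x

/-- The form of `i[-Δ, γ_c]` on Schwartz functions. -/
def virialS (a σ : ℝ) (c : E n) (φ : 𝓢(E n, ℂ)) : ℝ :=
  2 * ∑ j, realInner (dS j φ) (dS j (gammaS a σ c φ))

theorem hasTemperateGrowth_hardy {η : ℝ} (hη : 0 < η) (c : E n) :
    (fun x : E n => (‖x - c‖ ^ 2 + η)⁻¹).HasTemperateGrowth := by
  have h := (Function.HasTemperateGrowth.const (η⁻¹)).mul
    (hasTemperateGrowth_rpow (inv_nonneg.2 hη.le) c (-1))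
  have h2 : (fun x : E n => (‖x - c‖ ^ 2 + η)⁻¹) =
      (fun _ => η⁻¹) * fun x => (1 + η⁻¹ * ‖x - c‖ ^ 2) ^ (-1 : ℝ) := by
    ext x
    rw [Pi.mul_apply, Real.rpow_neg_one]
    field_simp
    ring
  rw [h2]
  exact h

/-- The Hessian bound and the localization formula give `4 ‖∇(wφ)‖²` plus a potential no worse than
`-(σ/4) w²` times a Hardy weight, up to `O(η)`. Hardy's inequality applied to `wφ`, with constant
`4/(n-2)²`, turns `σ/4` into `σ/(n-2)²`. -/
theorem virialS_ge_dirichlet (hn : 3 ≤ n) {a σ : ℝ} (ha : 0 < a) (hσ : 0 ≤ σ) (c : E n)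
    (φ : 𝓢(E n, ℂ)) :
    (4 - σ / ((n : ℝ) - 2) ^ 2) * dirichlet (mulS (weight a σ c) φ) ≤ virialS a σ c φ := by
  have hn' : (3 : ℝ) ≤ n := by exact_mod_cast hn
  have hn1 : (n : ℝ) - 2 ≠ 0 := by linarith
  have hn2 : 0 < ((n : ℝ) - 2) ^ 2 := pow_pos (by linarith) 2
  have : Nonempty (Fin n) := ⟨⟨0, by omega⟩⟩
  obtain ⟨j₀⟩ := ‹Nonempty (Fin n)›
  have hw := (hasPartial_weight (σ := σ) ha c j₀).temp
  have hw2 : (fun x => weight a σ c x * weight a σ c x).HasTemperateGrowth := hw.mul hw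
  -- The Hardy weight `|x - c|⁻²` is not of temperate growth, so the estimate is made with `η > 0`
  -- and an error linear in `η`, which then tends to `0`.
  have key : ∀ η : ℝ, 0 < η → a * η ≤ 1 / 32 →
      (4 - σ / ((n : ℝ) - 2) ^ 2) * dirichlet (mulS (weight a σ c) φ) ≤
        virialS a σ c φ + η * (12 * σ * a ^ 2 * realInner φ φ) := by
    intro η hη hη'
    have hT := hasTemperateGrowth_hardy hη c
    have h1 := virial_identity (fun j k => hasPartial_partialF ha hσ c j k)
      (lapF_eq_sum ha c) (hasPartial_lapF ha hσ c) (hasPartial_lapF' ha hσ c) φ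
    have h2 := realInner_hessF_ge ha hσ c φ
    rw [dirichlet_mulS (hasPartial_weight ha c) (hasPartial_weight' ha c)] at h2
    have hA : ∀ j, (fun x => weight a σ c x * (weightRad a σ c x +
        (x - c) j ^ 2 * weightRad' a σ c x)).HasTemperateGrowth := fun j =>
      hw.mul (hasPartial_weight' ha c j).temp'
    have hA' := hasTemperateGrowth_fun_sum Finset.univ (fun j _ => hA j)
    have hD' := hasTemperateGrowth_fun_sum Finset.univ
      (fun j _ => (hasPartial_lapF' ha hσ c j).temp')
    have hL : (fun x => weight a σ c x * weight a σ c x *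
        (‖x - c‖ ^ 2 + η)⁻¹).HasTemperateGrowth := hw2.mul hT
    have h3 := realInner_mulS_self_mono
      (((Function.HasTemperateGrowth.const (-(σ / 4))).mul hL).add
        (Function.HasTemperateGrowth.const (-(12 * σ * a ^ 2 * η))))
      (((Function.HasTemperateGrowth.const 4).mul hA').add
        ((Function.HasTemperateGrowth.const (-1)).mul hD'))
      (potential_ge ha hσ hn hη hη' c) φ
    have e1 : realInner φ (mulS (fun x => -(σ / 4) * (weight a σ c x * weight a σ c x *
        (‖x - c‖ ^ 2 + η)⁻¹) + -(12 * σ * a ^ 2 * η)) φ) =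
        -(σ / 4) * realInner (mulS (weight a σ c) φ)
          (mulS (fun x => (‖x - c‖ ^ 2 + η)⁻¹) (mulS (weight a σ c) φ)) +
          -(12 * σ * a ^ 2 * η) * realInner φ φ := by
      rw [mulS_add (u := fun x => -(σ / 4) * (weight a σ c x * weight a σ c x *
          (‖x - c‖ ^ 2 + η)⁻¹)) ((Function.HasTemperateGrowth.const (-(σ / 4))).mul hL)
          (Function.HasTemperateGrowth.const _), mulS_const_mul hL, map_add, map_smul, smul_eq_mul,
        mulS_const, map_smul, smul_eq_mul, ← realInner_mulS hw,
        mulS_mulS hT hw, mulS_mulS hw (v := fun x => (‖x - c‖ ^ 2 + η)⁻¹ * weight a σ c x)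
          (hT.mul hw)]
      congr 5
      ext x
      ring
    have e2 : realInner φ (mulS (fun x => 4 * (∑ j, weight a σ c x * (weightRad a σ c x +
        (x - c) j ^ 2 * weightRad' a σ c x)) + (-1) * ∑ j, (lapFRad a σ c x +
        (x - c) j ^ 2 * lapFRad' a σ c x)) φ) =
        4 * realInner φ (mulS (fun x => ∑ j, weight a σ c x * (weightRad a σ c x +
          (x - c) j ^ 2 * weightRad' a σ c x)) φ) +
        (-1) * realInner φ (mulS (fun x => ∑ j, (lapFRad a σ c x +
          (x - c) j ^ 2 * lapFRad' a σ c x)) φ) := by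
      rw [mulS_add (u := fun x => 4 * (∑ j, weight a σ c x * (weightRad a σ c x +
          (x - c) j ^ 2 * weightRad' a σ c x)))
          (v := fun x => (-1) * ∑ j, (lapFRad a σ c x + (x - c) j ^ 2 * lapFRad' a σ c x))
          ((Function.HasTemperateGrowth.const 4).mul hA')
          ((Function.HasTemperateGrowth.const (-1)).mul hD'), mulS_const_mul hA',
        mulS_const_mul hD', map_add, map_smul, map_smul, smul_eq_mul, smul_eq_mul]
    have h4 := hardy (by omega) hη c (mulS (weight a σ c) φ)
    have h5 : σ / 4 * realInner (mulS (weight a σ c) φ)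
        (mulS (fun x => (‖x - c‖ ^ 2 + η)⁻¹) (mulS (weight a σ c) φ)) ≤
        σ / ((n : ℝ) - 2) ^ 2 * dirichlet (mulS (weight a σ c) φ) := by
      have := mul_le_mul_of_nonneg_left h4 (show 0 ≤ σ / ((n : ℝ) - 2) ^ 2 by positivity)
      refine le_trans (le_of_eq ?_) this
      generalize realInner _ _ = r
      field_simp
    have h6 := e1.symm.le.trans (h3.trans e2.le)
    rw [show virialS a σ c φ = _ from h1]
    linarith
  have hlim : Tendsto (fun η : ℝ => virialS a σ c φ + η * (12 * σ * a ^ 2 * realInner φ φ))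
      (𝓝[>] 0) (𝓝 (virialS a σ c φ)) := by
    have : Continuous fun η : ℝ => virialS a σ c φ + η * (12 * σ * a ^ 2 * realInner φ φ) := by
      fun_prop
    have h := (this.tendsto 0).mono_left (nhdsWithin_le_nhds (s := Set.Ioi 0))
    simpa using h
  refine ge_of_tendsto hlim ?_
  have hsmall : Set.Ioo (0 : ℝ) (1 / 32 / a) ∈ 𝓝[>] (0 : ℝ) :=
    Ioo_mem_nhdsGT (by positivity)
  filter_upwards [hsmall] with η hη
  refine key η hη.1 ?_
  have := (lt_div_iff₀ ha).1 hη.2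
  linarith

/-! ### Graphs of the operators -/

/-- Statements about pairs in the graph carry the domain condition and the value at once, and do not
depend on the choice made in `ofRel`. -/
theorem mem_graph_ofRel {M : Type*} [AddCommGroup M] [Module ℂ M] {R : M → M → Prop}
    (zero : R 0 0) (add : ∀ x y u v, R x u → R y v → R (x + y) (u + v))
    (smul : ∀ (z : ℂ) x u, R x u → R (z • x) (z • u))
    (unique : ∀ x u v, R x u → R x v → u = v) {x u : M} :
    (x, u) ∈ (ofRel R zero add smul unique).graph ↔ R x u := by
  rw [LinearPMap.mem_graph_iff]
  constructor
  · rintro ⟨y, rfl, rfl⟩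
    exact y.2.choose_spec
  · intro h
    exact ⟨⟨x, u, h⟩, rfl, unique _ _ _ (Exists.choose_spec (⟨u, h⟩ : ∃ u, R x u)) h⟩

theorem mem_graph_realization {T : 𝓢'(E n, ℂ) →L[ℂ] 𝓢'(E n, ℂ)} {ψ u : L2 n} :
    (ψ, u) ∈ (realization T).graph ↔ Lp.toTemperedDistributionCLM ℂ volume 2 u =
      T (Lp.toTemperedDistributionCLM ℂ volume 2 ψ) :=
  mem_graph_ofRel _ _ _ _

theorem mem_graph_mulOp {w : E n → ℝ} {ψ u : L2 n} :
    (ψ, u) ∈ (mulOp w).graph ↔ ∀ᵐ x, u x = (w x : ℂ) * ψ x :=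
  mem_graph_ofRel _ _ _ _

theorem mem_graph_opMul {M : Type*} [AddCommGroup M] [Module ℂ M] {A B : M →ₗ.[ℂ] M} {x u : M} :
    (x, u) ∈ (opMul A B).graph ↔ ∃ v, (x, v) ∈ B.graph ∧ (v, u) ∈ A.graph :=
  mem_graph_ofRel _ _ _ _

theorem mem_graph_add {M : Type*} [AddCommGroup M] [Module ℂ M] {A B : M →ₗ.[ℂ] M} {x u v : M}
    (hA : (x, u) ∈ A.graph) (hB : (x, v) ∈ B.graph) : (x, u + v) ∈ (A + B).graph := by
  rw [LinearPMap.mem_graph_iff] at *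
  obtain ⟨y, rfl, rfl⟩ := hA
  obtain ⟨z, hz, rfl⟩ := hB
  have hz' : (z : M) = y := hz
  refine ⟨⟨y, y.2, by rw [← hz']; exact z.2⟩, rfl, ?_⟩
  rw [LinearPMap.add_apply]
  congr 2
  exact Subtype.ext hz'.symm

theorem mem_graph_smul {M : Type*} [AddCommGroup M] [Module ℂ M] {A : M →ₗ.[ℂ] M} {x u : M}
    (z : ℂ) (hA : (x, u) ∈ A.graph) : (x, z • u) ∈ (z • A).graph := by
  rw [LinearPMap.mem_graph_iff] at *
  obtain ⟨y, rfl, rfl⟩ := hA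
  exact ⟨y, rfl, LinearPMap.smul_apply _ _ _⟩

theorem mem_graph_neg {M : Type*} [AddCommGroup M] [Module ℂ M] {A : M →ₗ.[ℂ] M} {x u : M}
    (hA : (x, u) ∈ A.graph) : (x, -u) ∈ (-A).graph := by
  rw [LinearPMap.mem_graph_iff] at *
  obtain ⟨y, rfl, rfl⟩ := hA
  exact ⟨y, rfl, LinearPMap.neg_apply _ _⟩

theorem mem_graph_sum {M ι : Type*} [AddCommGroup M] [Module ℂ M] (s : Finset ι)
    {A : ι → M →ₗ.[ℂ] M} {x : M} {u : ι → M} (h : ∀ i ∈ s, (x, u i) ∈ (A i).graph) :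
    (x, ∑ i ∈ s, u i) ∈ (∑ i ∈ s, A i).graph := by
  classical
  induction s using Finset.induction_on with
  | empty =>
    rw [Finset.sum_empty, Finset.sum_empty, LinearPMap.mem_graph_iff]
    exact ⟨⟨x, trivial⟩, rfl, rfl⟩
  | insert i s hi ih =>
    rw [Finset.sum_insert hi, Finset.sum_insert hi]
    exact mem_graph_add (h i (Finset.mem_insert_self i s))
      (ih fun j hj => h j (Finset.mem_insert_of_mem hj))

theorem mem_domain_of_graph {M : Type*} [AddCommGroup M] [Module ℂ M] {A : M →ₗ.[ℂ] M} {x u : M}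
    (h : (x, u) ∈ A.graph) : x ∈ A.domain := LinearPMap.mem_domain_of_mem_graph h

theorem apply_eq_of_graph {M : Type*} [AddCommGroup M] [Module ℂ M] {A : M →ₗ.[ℂ] M} {x u : M}
    (h : (x, u) ∈ A.graph) (hx : x ∈ A.domain) : A ⟨x, hx⟩ = u :=
  A.mem_graph_snd_inj (A.mem_graph ⟨x, hx⟩) h rfl

theorem opForm_eq {A : L2 n →ₗ.[ℂ] L2 n} {ψ u : L2 n} (h : (ψ, u) ∈ A.graph)
    (hA : ψ ∈ A.domain) : opForm A ψ hA = (inner ℂ ψ u).re := by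
  rw [opForm, apply_eq_of_graph h]

/-- Here `v = iBψ`. The factor `i` of the commutator cancels the `-i` of the multiplier, and the two
inner products become complex conjugates of each other. -/
theorem commForm_eq {A B : L2 n →ₗ.[ℂ] L2 n} {ψ u v : L2 n} (hu : (ψ, u) ∈ A.graph)
    (hv : (ψ, (-Complex.I) • v) ∈ B.graph) (hA : ψ ∈ A.domain) (hB : ψ ∈ B.domain) :
    commForm A B ψ hA hB = 2 * (inner ℂ u v).re := by
  rw [commForm, apply_eq_of_graph hu, apply_eq_of_graph hv, inner_smul_left, inner_smul_right,
    ← inner_conj_symm v u]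
  generalize (inner ℂ u v : ℂ) = z
  simp
  ring

/-- A Schwartz function as an element of `L²`. -/
abbrev toL2 (φ : 𝓢(E n, ℂ)) : L2 n := φ.toLp 2 volume

theorem toL2_add (φ η : 𝓢(E n, ℂ)) : toL2 (φ + η) = toL2 φ + toL2 η := rfl

theorem toL2_sub (φ η : 𝓢(E n, ℂ)) : toL2 (φ - η) = toL2 φ - toL2 η := rfl

theorem toL2_sum {ι : Type*} (s : Finset ι) (φ : ι → 𝓢(E n, ℂ)) :
    toL2 (∑ i ∈ s, φ i) = ∑ i ∈ s, toL2 (φ i) :=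
  map_sum (SchwartzMap.toLpCLM ℝ ℂ 2 (volume : Measure (E n))) φ s

theorem graph_partialDeriv_schwartz (j : Fin n) (φ : 𝓢(E n, ℂ)) :
    (toL2 φ, toL2 (dS j φ)) ∈ (partialDeriv j).graph := by
  rw [partialDeriv, mem_graph_realization, Lp.toTemperedDistributionCLM_apply,
    Lp.toTemperedDistributionCLM_apply, Lp.toTemperedDistribution_toLp_eq,
    Lp.toTemperedDistribution_toLp_eq, LineDeriv.lineDerivOpCLM_apply,
    lineDerivOp_toTemperedDistributionCLM_eq]
  rfl

theorem graph_laplacian_schwartz (φ : 𝓢(E n, ℂ)) :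
    (toL2 φ, toL2 (Δ φ)) ∈ (laplacian n).graph := by
  rw [laplacian, mem_graph_realization, Lp.toTemperedDistributionCLM_apply,
    Lp.toTemperedDistributionCLM_apply, Lp.toTemperedDistribution_toLp_eq,
    Lp.toTemperedDistribution_toLp_eq, laplacianCLM_apply,
    laplacian_toTemperedDistributionCLM_eq]

theorem graph_mulOp_schwartz {w : E n → ℝ} (hw : w.HasTemperateGrowth) (φ : 𝓢(E n, ℂ)) :
    (toL2 φ, toL2 (mulS w φ)) ∈ (mulOp w).graph := by
  rw [mem_graph_mulOp]
  filter_upwards [φ.coeFn_toLp 2 volume, (mulS w φ).coeFn_toLp 2 volume] with x h1 h2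
  rw [h1, h2, mulS_apply hw]

/-- The embedding of `L²` in the tempered distributions and `T` are both continuous, and limits of
distributions are unique. -/
theorem graph_realization_closed {T : 𝓢'(E n, ℂ) →L[ℂ] 𝓢'(E n, ℂ)} {ψ u : ℕ → L2 n} {ψ₀ u₀ : L2 n}
    (h : ∀ m, (ψ m, u m) ∈ (realization T).graph) (hψ : Tendsto ψ atTop (𝓝 ψ₀))
    (hu : Tendsto u atTop (𝓝 u₀)) : (ψ₀, u₀) ∈ (realization T).graph := by
  simp only [mem_graph_realization] at *
  have h1 := ((Lp.toTemperedDistributionCLM ℂ (volume : Measure (E n)) 2).continuous.tendsto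
    u₀).comp hu
  have h2 := ((T.continuous.comp
    (Lp.toTemperedDistributionCLM ℂ (volume : Measure (E n)) 2).continuous).tendsto ψ₀).comp hψ
  refine tendsto_nhds_unique h1 (h2.congr fun m => ?_)
  exact (h m).symm

/-- A bounded function of temperate growth. -/
structure BddTemp (w : E n → ℝ) : Prop where
  temp : w.HasTemperateGrowth
  bdd : ∃ C, ∀ x, |w x| ≤ C

theorem norm_le_of_graph_mulOp {w : E n → ℝ} {C : ℝ} (hC : ∀ x, |w x| ≤ C) {ψ u : L2 n}
    (h : (ψ, u) ∈ (mulOp w).graph) : ‖u‖ ≤ C * ‖ψ‖ := by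
  refine Lp.norm_le_mul_norm_of_ae_le_mul ?_
  filter_upwards [mem_graph_mulOp.1 h] with x hx
  rw [hx, norm_mul, Complex.norm_real]
  exact mul_le_mul_of_nonneg_right (hC x) (norm_nonneg _)

theorem exists_graph_mulOp {w : E n → ℝ} (hw : Continuous w) {C : ℝ} (hC : ∀ x, |w x| ≤ C)
    (ψ : L2 n) : ∃ u, (ψ, u) ∈ (mulOp w).graph := by
  have hmem : MemLp (fun x => (w x : ℂ) * ψ x) 2 (volume : Measure (E n)) := by
    refine MemLp.of_le_mul (c := C) (Lp.memLp ψ) ?_ (Eventually.of_forall fun x => ?_)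
    · exact ((Complex.continuous_ofReal.comp hw).aestronglyMeasurable).mul
        (Lp.aestronglyMeasurable ψ)
    · rw [norm_mul, Complex.norm_real]
      exact mul_le_mul_of_nonneg_right (hC x) (norm_nonneg _)
  exact ⟨hmem.toLp _, mem_graph_mulOp.2 hmem.coeFn_toLp⟩

theorem tendsto_graph_mulOp {w : E n → ℝ} {C : ℝ} (hC : ∀ x, |w x| ≤ C) {ψ u : ℕ → L2 n}
    {ψ₀ u₀ : L2 n} (h : ∀ m, (ψ m, u m) ∈ (mulOp w).graph) (h₀ : (ψ₀, u₀) ∈ (mulOp w).graph)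
    (hψ : Tendsto ψ atTop (𝓝 ψ₀)) : Tendsto u atTop (𝓝 u₀) := by
  rw [tendsto_iff_norm_sub_tendsto_zero] at *
  refine squeeze_zero (fun _ => norm_nonneg _)
    (fun m => norm_le_of_graph_mulOp hC ((mulOp w).graph.sub_mem (h m) h₀)) ?_
  simpa using hψ.const_mul C

/-! ### Schwartz functions are a core for the Laplacian -/

/-- The solution is the Fourier multiplier `(1 + (2π)²|ξ|²)⁻¹` applied to `g`. This symbol has
temperate growth, so it preserves Schwartz functions. -/
theorem exists_sub_laplacian_eq (g : 𝓢(E n, ℂ)) : ∃ φ : 𝓢(E n, ℂ), φ - Δ φ = g := by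
  set a : ℝ := (2 * Real.pi) ^ 2 with ha
  have ha0 : 0 ≤ a := by positivity
  have hm := hasTemperateGrowth_rpow ha0 (0 : E n) (-1)
  simp only [sub_zero] at hm
  have hsq := Function.hasTemperateGrowth_norm_sq (E n)
  refine ⟨SchwartzMap.fourierMultiplierCLM ℂ (fun x : E n => (1 + a * ‖x‖ ^ 2) ^ (-1 : ℝ)) g, ?_⟩
  rw [SchwartzMap.laplacian_eq_fourierMultiplierCLM,
    SchwartzMap.fourierMultiplierCLM_fourierMultiplierCLM_apply hsq hm, ← ha, neg_smul,
    sub_neg_eq_add]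
  have h1 : SchwartzMap.fourierMultiplierCLM ℂ (fun _ : E n => (1 : ℝ)) g = g := by
    rw [SchwartzMap.fourierMultiplierCLM_const]; simp
  conv_rhs => rw [← h1]
  simp only [SchwartzMap.fourierMultiplierCLM_apply, ← FourierTransform.fourierInv_smul,
    ← FourierTransform.fourierInv_add]
  congr 1
  ext x
  rw [add_apply, smul_apply, SchwartzMap.smulLeftCLM_apply_apply hm,
    SchwartzMap.smulLeftCLM_apply_apply (hsq.mul hm),
    SchwartzMap.smulLeftCLM_apply_apply (Function.HasTemperateGrowth.const 1), smul_smul,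
    ← add_smul]
  congr 1
  simp only [Pi.mul_apply]
  rw [Real.rpow_neg_one]
  field_simp

theorem dirichlet_eq (φ : 𝓢(E n, ℂ)) : dirichlet φ = -realInner (Δ φ) φ := by
  rw [realInner_laplacian, neg_neg, dirichlet]

/-- The cross term in the expansion of the square is twice the Dirichlet form, hence nonnegative. -/
theorem norm_sub_laplacian_sq (φ : 𝓢(E n, ℂ)) :
    ‖toL2 φ‖ ^ 2 + ‖toL2 (Δ φ)‖ ^ 2 ≤ ‖toL2 (φ - Δ φ)‖ ^ 2 := by
  have h1 := dirichlet_nonneg φ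
  rw [dirichlet_eq] at h1
  rw [← realInner_self, ← realInner_self, ← realInner_self, map_sub, map_sub,
    LinearMap.sub_apply, LinearMap.sub_apply, realInner_comm φ (Δ φ)]
  linarith

theorem norm_dS_le (j : Fin n) (φ : 𝓢(E n, ℂ)) :
    ‖toL2 (dS j φ)‖ ≤ ‖toL2 φ‖ + ‖toL2 (Δ φ)‖ := by
  have h1 : realInner (dS j φ) (dS j φ) ≤ dirichlet φ :=
    Finset.single_le_sum (f := fun j => realInner (dS j φ) (dS j φ))
      (fun _ _ => realInner_self_nonneg _) (Finset.mem_univ j)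
  have h2 : -realInner (Δ φ) φ ≤ ‖toL2 (Δ φ)‖ * ‖toL2 φ‖ := by
    rw [realInner_def]
    refine (neg_le_abs _).trans ((Complex.abs_re_le_norm _).trans (norm_inner_le_norm _ _))
  rw [realInner_self, dirichlet_eq] at h1
  refine abs_le_of_sq_le_sq' ?_ (by positivity) |>.2
  nlinarith [norm_nonneg (toL2 φ), norm_nonneg (toL2 (Δ φ))]

theorem cauchySeq_of_le {X : Type*} [SeminormedAddCommGroup X] {u v w : ℕ → X}
    (hv : CauchySeq v) (hw : CauchySeq w)
    (h : ∀ k l, ‖u k - u l‖ ≤ ‖v k - v l‖ + ‖w k - w l‖) : CauchySeq u := by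
  rw [Metric.cauchySeq_iff] at *
  intro ε hε
  obtain ⟨N₁, h₁⟩ := hv (ε / 2) (by positivity)
  obtain ⟨N₂, h₂⟩ := hw (ε / 2) (by positivity)
  refine ⟨max N₁ N₂, fun k hk l hl => ?_⟩
  have h3 := h₁ k (le_of_max_le_left hk) l (le_of_max_le_left hl)
  have h4 := h₂ k (le_of_max_le_right hk) l (le_of_max_le_right hl)
  rw [dist_eq_norm] at *
  linarith [h k l]

/-- Uniqueness by duality: if `ΔT = T`, then `T` vanishes on every `φ - Δφ`, and these exhaust the
Schwartz functions. -/
theorem laplacian_graph_ext {ψ ψ' χ χ' : L2 n} (h : (ψ, χ) ∈ (laplacian n).graph)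
    (h' : (ψ', χ') ∈ (laplacian n).graph) (he : ψ - χ = ψ' - χ') : ψ = ψ' := by
  have h1 := (laplacian n).graph.sub_mem h h'
  rw [Prod.mk_sub_mk, show χ - χ' = ψ - ψ' by rw [sub_eq_sub_iff_sub_eq_sub] at he; exact he.symm,
    laplacian, mem_graph_realization, laplacianCLM_apply] at h1
  set T := Lp.toTemperedDistributionCLM ℂ (volume : Measure (E n)) 2 (ψ - ψ') with hT
  have h2 : T = 0 := by
    ext g
    obtain ⟨φ, rfl⟩ := exists_sub_laplacian_eq g
    rw [map_sub, ← laplacian_apply_apply, ← h1, sub_self]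
    rfl
  have h3 : ψ - ψ' = 0 :=
    LinearMap.ker_eq_bot'.1 (Lp.ker_toTemperedDistributionCLM_eq_bot (F := ℂ) (μ := volume)
      (p := 2)) _ h2
  exact sub_eq_zero.1 h3

/-- Approximate `ψ - Δψ` in `L²` by Schwartz functions `g m` and solve `φ m - Δ(φ m) = g m`. By
`norm_sub_laplacian_sq` both `φ m` and `Δ(φ m)` are Cauchy. Their limits satisfy the same equation
as `ψ`, so they are `ψ` and `Δψ`. -/
theorem exists_schwartz_approx {ψ χ : L2 n} (h : (ψ, χ) ∈ (laplacian n).graph) :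
    ∃ φ : ℕ → 𝓢(E n, ℂ), Tendsto (fun m => toL2 (φ m)) atTop (𝓝 ψ) ∧
      Tendsto (fun m => toL2 (Δ (φ m))) atTop (𝓝 χ) := by
  have hdense : ψ - χ ∈ closure (Set.range (SchwartzMap.toLpCLM ℝ ℂ 2 (volume : Measure (E n)))) :=
    SchwartzMap.denseRange_toLpCLM (by simp) _
  obtain ⟨g, hg, hlim⟩ := mem_closure_iff_seq_limit.1 hdense
  choose g' hg' using hg
  choose φ hφ using fun m => exists_sub_laplacian_eq (g' m)
  have hlim' : Tendsto (fun m => toL2 (φ m - Δ (φ m))) atTop (𝓝 (ψ - χ)) := by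
    refine hlim.congr fun m => ?_
    rw [hφ, ← hg' m]
    rfl
  have hc := hlim'.cauchySeq
  have hsub : ∀ k l, toL2 (φ k - Δ (φ k)) - toL2 (φ l - Δ (φ l)) =
      toL2 ((φ k - φ l) - Δ (φ k - φ l)) := by
    intro k l
    rw [← toL2_sub]
    congr 1
    rw [← SchwartzMap.laplacianCLM_eq', ← SchwartzMap.laplacianCLM_eq',
      ← SchwartzMap.laplacianCLM_eq', map_sub]
    abel
  have hsub2 : ∀ k l, toL2 (Δ (φ k)) - toL2 (Δ (φ l)) = toL2 (Δ (φ k - φ l)) := by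
    intro k l
    rw [← toL2_sub, ← SchwartzMap.laplacianCLM_eq', ← SchwartzMap.laplacianCLM_eq',
      ← SchwartzMap.laplacianCLM_eq', map_sub]
  have hz : CauchySeq fun _ : ℕ => (0 : L2 n) := cauchySeq_const 0
  have hc1 : CauchySeq fun m => toL2 (φ m) := cauchySeq_of_le hc hz fun k l => by
    rw [sub_zero, norm_zero, add_zero, hsub, ← toL2_sub]
    refine abs_le_of_sq_le_sq' ?_ (by positivity) |>.2
    nlinarith [norm_sub_laplacian_sq (φ k - φ l), sq_nonneg ‖toL2 (Δ (φ k - φ l))‖]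
  have hc2 : CauchySeq fun m => toL2 (Δ (φ m)) := cauchySeq_of_le hc hz fun k l => by
    rw [sub_zero, norm_zero, add_zero, hsub, hsub2]
    refine abs_le_of_sq_le_sq' ?_ (by positivity) |>.2
    nlinarith [norm_sub_laplacian_sq (φ k - φ l), sq_nonneg ‖toL2 (φ k - φ l)‖]
  obtain ⟨ψ', hψ'⟩ := cauchySeq_tendsto_of_complete hc1
  obtain ⟨χ', hχ'⟩ := cauchySeq_tendsto_of_complete hc2
  have hg2 : (ψ', χ') ∈ (laplacian n).graph :=
    graph_realization_closed (fun m => graph_laplacian_schwartz (φ m)) hψ' hχ'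
  have he : ψ - χ = ψ' - χ' := tendsto_nhds_unique hlim' (hψ'.sub hχ')
  obtain rfl := laplacian_graph_ext h hg2 he
  obtain rfl : χ = χ' := by simpa using he
  exact ⟨φ, hψ', hχ'⟩

/-! ### Bounds for the multipliers -/

/-- This is the role of `σ > 1/2`: the profile `f` is bounded, hence so is `∇F_c`. -/
theorem integrable_profile {a σ : ℝ} (ha : 0 < a) (hσ : 1 / 2 < σ) :
    Integrable fun s : ℝ => (1 + a * s ^ 2) ^ (-σ) := by
  have h := integrable_rpow_neg_one_add_norm_sq (E := ℝ) (μ := volume) (r := 2 * σ)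
    (by simp; linarith)
  have h2 := h.comp_mul_left' (R := √a) (by positivity)
  refine h2.congr (Eventually.of_forall fun s => ?_)
  simp only [norm_mul, Real.norm_eq_abs, mul_pow, sq_abs, Real.sq_sqrt ha.le]
  congr 1
  ring

/-- A bound for the profile `f`. -/
def profileBound (a σ : ℝ) : ℝ := ∫ s : ℝ, (1 + a * s ^ 2) ^ (-σ)

theorem profile_le {a σ : ℝ} (ha : 0 < a) (hσ : 1 / 2 < σ) {r : ℝ} (hr : 0 ≤ r) :
    profile a σ r ≤ profileBound a σ := by
  rw [profile, intervalIntegral.integral_of_le hr]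
  exact setIntegral_le_integral (integrable_profile ha hσ)
    (Eventually.of_forall fun s => Real.rpow_nonneg (by positivity) _)

theorem profileBound_nonneg {a : ℝ} (ha : 0 < a) (σ : ℝ) : 0 ≤ profileBound a σ :=
  integral_nonneg fun s => Real.rpow_nonneg (by positivity) _

theorem abs_coord_le (v : E n) (j : Fin n) : |v j| ≤ ‖v‖ := by
  simpa using PiLp.norm_apply_le v j

theorem abs_partialF_le {a σ : ℝ} (ha : 0 < a) (hσ : 1 / 2 < σ) (c : E n) (j : Fin n) (x : E n) :
    |partialF a σ c j x| ≤ profileBound a σ := by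
  have h0 : 0 ≤ kfun 0 σ (a * ‖x - c‖ ^ 2) := kfun_nonneg _ _ (by positivity)
  have h1 := profile_le ha hσ (norm_nonneg (x - c))
  rw [profile_eq] at h1
  rw [partialF_eq ha (by linarith), abs_mul, abs_of_nonneg h0]
  exact (mul_le_mul_of_nonneg_right (abs_coord_le _ j) h0).trans h1

theorem bddTemp_partialF {a σ : ℝ} (ha : 0 < a) (hσ : 1 / 2 < σ) (c : E n) (j : Fin n) :
    BddTemp (partialF a σ c j) where
  temp := (hasPartial_partialF ha (by linarith) c j j).temp
  bdd := ⟨profileBound a σ, abs_partialF_le ha hσ c j⟩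

/-- A diagonal entry of the Hessian lies between the eigenvalues `f'` and `f/r`, which are in `[0,
1]`. -/
theorem bddTemp_hessF {a σ : ℝ} (ha : 0 < a) (hσ : 0 ≤ σ) (c : E n) (j : Fin n) :
    BddTemp (hessF a σ c j j) where
  temp := (hasPartial_partialF ha hσ c j j).temp'
  bdd := by
    refine ⟨1, fun x => ?_⟩
    have h0 := kfun_le_one 0 hσ (s := a * ‖x - c‖ ^ 2) (by positivity)
    have h2 := kfun_recursion 0 σ (s := a * ‖x - c‖ ^ 2) (by positivity)
    have hk : 0 ≤ kfun 2 (σ + 1) (a * ‖x - c‖ ^ 2) := kfun_nonneg _ _ (by positivity)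
    have hg : 0 ≤ (1 + a * ‖x - c‖ ^ 2) ^ (-σ) := Real.rpow_nonneg (by positivity) _
    have h3 : (x - c) j ^ 2 ≤ ‖x - c‖ ^ 2 := by
      rw [← sq_abs]; gcongr; exact abs_coord_le _ j
    have h4 : 2 * σ * a * kfun 2 (σ + 1) (a * ‖x - c‖ ^ 2) * (x - c) j ^ 2 ≤
        2 * σ * a * kfun 2 (σ + 1) (a * ‖x - c‖ ^ 2) * ‖x - c‖ ^ 2 :=
      mul_le_mul_of_nonneg_left h3 (by positivity)
    have h5 : 0 ≤ 2 * σ * a * kfun 2 (σ + 1) (a * ‖x - c‖ ^ 2) * (x - c) j ^ 2 := by positivity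
    rw [hessF, if_pos rfl, abs_le]
    push_cast at h2
    constructor <;> nlinarith

theorem rpow_le_inv {b r : ℝ} (hb : 1 ≤ b) (hr : r ≤ -1) : b ^ r ≤ b⁻¹ := by
  rw [← Real.rpow_neg_one]
  exact Real.rpow_le_rpow_of_exponent_le hb hr

theorem bddTemp_weight {a σ : ℝ} (ha : 0 < a) (hσ : 0 ≤ σ) (c : E n) (j : Fin n) :
    BddTemp (weight a σ c) where
  temp := (hasPartial_weight ha c j).temp
  bdd := by
    refine ⟨1, fun x => ?_⟩
    have hb : 1 ≤ 1 + a * ‖x - c‖ ^ 2 := le_add_of_nonneg_right (by positivity)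
    rw [weight_eq ha, abs_of_nonneg (Real.rpow_nonneg (by positivity) _)]
    exact Real.rpow_le_one_of_one_le_of_nonpos hb (by linarith)

theorem bddTemp_weight_deriv {a σ : ℝ} (ha : 0 < a) (hσ : 0 ≤ σ) (c : E n) (j : Fin n) :
    BddTemp (fun x => (x - c) j * weightRad a σ c x) where
  temp := (hasPartial_weight ha c j).temp'
  bdd := by
    refine ⟨a * σ * (1 + a⁻¹), fun x => ?_⟩
    have hb : 1 ≤ 1 + a * ‖x - c‖ ^ 2 := le_add_of_nonneg_right (by positivity)
    have h1 := rpow_le_inv hb (r := -σ / 2 - 1) (by linarith)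
    have h0 : 0 ≤ (1 + a * ‖x - c‖ ^ 2) ^ (-σ / 2 - 1) := Real.rpow_nonneg (by positivity) _
    have h2 : ‖x - c‖ ≤ (1 + a⁻¹) * (1 + a * ‖x - c‖ ^ 2) := by
      have h3 : (1 + a⁻¹) * (1 + a * ‖x - c‖ ^ 2) =
          1 + a⁻¹ + a * ‖x - c‖ ^ 2 + ‖x - c‖ ^ 2 := by field_simp; ring
      have h4 : 0 ≤ a⁻¹ + a * ‖x - c‖ ^ 2 := by positivity
      rw [h3]
      nlinarith [sq_nonneg (‖x - c‖ - 1)]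
    rw [abs_mul, weightRad, abs_mul, abs_neg, abs_of_nonneg h0,
      abs_of_nonneg (mul_nonneg ha.le hσ)]
    calc |(x - c) j| * (a * σ * (1 + a * ‖x - c‖ ^ 2) ^ (-σ / 2 - 1)) ≤
        ((1 + a⁻¹) * (1 + a * ‖x - c‖ ^ 2)) * (a * σ * (1 + a * ‖x - c‖ ^ 2)⁻¹) := by
          gcongr
          exact (abs_coord_le _ j).trans h2
      _ = a * σ * (1 + a⁻¹) := by field_simp

theorem bddTemp_weight_deriv2 {a σ : ℝ} (ha : 0 < a) (hσ : 0 ≤ σ) (c : E n) (j : Fin n) :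
    BddTemp (fun x => weightRad a σ c x + (x - c) j ^ 2 * weightRad' a σ c x) where
  temp := (hasPartial_weight' ha c j).temp'
  bdd := by
    refine ⟨a * σ + a * σ * (σ + 2), fun x => ?_⟩
    have hb : 1 ≤ 1 + a * ‖x - c‖ ^ 2 := le_add_of_nonneg_right (by positivity)
    have h0 : 0 ≤ (1 + a * ‖x - c‖ ^ 2) ^ (-σ / 2 - 1) := Real.rpow_nonneg (by positivity) _
    have h0' : (1 + a * ‖x - c‖ ^ 2) ^ (-σ / 2 - 1) ≤ 1 :=
      Real.rpow_le_one_of_one_le_of_nonpos hb (by linarith)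
    have h1 := rpow_le_inv hb (r := -σ / 2 - 2) (by linarith)
    have h3 : (x - c) j ^ 2 ≤ ‖x - c‖ ^ 2 := by
      rw [← sq_abs]; gcongr; exact abs_coord_le _ j
    refine (abs_add_le _ _).trans (add_le_add ?_ ?_)
    · rw [weightRad, abs_mul, abs_neg, abs_of_nonneg h0, abs_of_nonneg (by positivity)]
      exact mul_le_of_le_one_right (by positivity) h0'
    · rw [weightRad', abs_of_nonneg (by positivity)]
      calc (x - c) j ^ 2 * (a ^ 2 * σ * (σ + 2) * (1 + a * ‖x - c‖ ^ 2) ^ (-σ / 2 - 2)) ≤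
          ‖x - c‖ ^ 2 * (a ^ 2 * σ * (σ + 2) * (1 + a * ‖x - c‖ ^ 2)⁻¹) := by gcongr
        _ = a * σ * (σ + 2) * ((a * ‖x - c‖ ^ 2) / (1 + a * ‖x - c‖ ^ 2)) := by
          field_simp
        _ ≤ a * σ * (σ + 2) * 1 := by
          gcongr
          rw [div_le_one (by positivity)]
          linarith
        _ = _ := mul_one _

/-! ### Limits along a core sequence -/

/-- The Schwartz functions `φ m` converge to `ψ` in the graph norm of the Laplacian. -/
structure CoreSeq (φ : ℕ → 𝓢(E n, ℂ)) (ψ χ : L2 n) : Prop where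
  tendsto : Tendsto (fun m => toL2 (φ m)) atTop (𝓝 ψ)
  tendsto_laplacian : Tendsto (fun m => toL2 (Δ (φ m))) atTop (𝓝 χ)

theorem laplacian_sub (φ η : 𝓢(E n, ℂ)) : Δ (φ - η) = Δ φ - Δ η := by
  rw [← SchwartzMap.laplacianCLM_eq', ← SchwartzMap.laplacianCLM_eq',
    ← SchwartzMap.laplacianCLM_eq', map_sub]

theorem CoreSeq.exists_dS {φ : ℕ → 𝓢(E n, ℂ)} {ψ χ : L2 n} (h : CoreSeq φ ψ χ) (j : Fin n) :
    ∃ d, Tendsto (fun m => toL2 (dS j (φ m))) atTop (𝓝 d) ∧ (ψ, d) ∈ (partialDeriv j).graph := by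
  have hc : CauchySeq fun m => toL2 (dS j (φ m)) :=
    cauchySeq_of_le h.tendsto.cauchySeq h.tendsto_laplacian.cauchySeq fun k l => by
      rw [← toL2_sub, ← toL2_sub, ← toL2_sub, ← map_sub, ← laplacian_sub]
      exact norm_dS_le j _
  obtain ⟨d, hd⟩ := cauchySeq_tendsto_of_complete hc
  exact ⟨d, hd, graph_realization_closed (fun m => graph_partialDeriv_schwartz j (φ m))
    h.tendsto hd⟩

theorem BddTemp.exists_tendsto {w : E n → ℝ} (hw : BddTemp w) {φ : ℕ → 𝓢(E n, ℂ)} {ψ : L2 n}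
    (h : Tendsto (fun m => toL2 (φ m)) atTop (𝓝 ψ)) :
    ∃ u, Tendsto (fun m => toL2 (mulS w (φ m))) atTop (𝓝 u) ∧ (ψ, u) ∈ (mulOp w).graph := by
  obtain ⟨C, hC⟩ := hw.bdd
  obtain ⟨u, hu⟩ := exists_graph_mulOp hw.temp.1.continuous hC ψ
  exact ⟨u, tendsto_graph_mulOp hC (fun m => graph_mulOp_schwartz hw.temp (φ m)) hu h, hu⟩

theorem gammaS_eq {a σ : ℝ} (ha : 0 < a) (hσ : 0 ≤ σ) (c : E n) (φ : 𝓢(E n, ℂ)) :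
    gammaS a σ c φ = ∑ j, ((mulS (partialF a σ c j) (dS j φ) + mulS (hessF a σ c j j) φ) +
      mulS (partialF a σ c j) (dS j φ)) := by
  have h1 : mulS (lapF a σ c) φ = ∑ j, mulS (hessF a σ c j j) φ := by
    rw [show lapF a σ c = _ from funext (lapF_eq_sum ha c),
      mulS_sum _ (fun j _ => (hasPartial_partialF ha hσ c j j).temp')]
  rw [gammaS, h1, Finset.smul_sum, ← Finset.sum_add_distrib]
  refine Finset.sum_congr rfl fun j _ => ?_
  rw [two_smul]
  abel

/-- The coefficients are bounded, so every term of the Leibniz rule converges. Closedness of `∂ⱼ`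
then places `(∂ⱼF_c) ψ` in its domain, as the first product in `multiplier` requires. -/
theorem CoreSeq.exists_multiplier {φ : ℕ → 𝓢(E n, ℂ)} {ψ χ : L2 n} (h : CoreSeq φ ψ χ)
    {a σ : ℝ} (ha : 0 < a) (hσ : 1 / 2 < σ) (c : E n) :
    ∃ γ, Tendsto (fun m => toL2 (gammaS a σ c (φ m))) atTop (𝓝 γ) ∧
      (ψ, (-Complex.I) • γ) ∈ (multiplier a σ c).graph := by
  have hσ0 : 0 ≤ σ := by linarith
  choose d hd hdg using fun j => h.exists_dS j
  choose f hf hfg using fun j => (bddTemp_partialF ha hσ c j).exists_tendsto h.tendsto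
  choose e he heg using fun j => (bddTemp_partialF ha hσ c j).exists_tendsto (hd j)
  choose k hk _ using fun j => (bddTemp_hessF ha hσ0 c j).exists_tendsto h.tendsto
  have h1 : ∀ j, (f j, e j + k j) ∈ (partialDeriv j).graph := fun j => by
    refine graph_realization_closed
      (fun m => graph_partialDeriv_schwartz j (mulS (partialF a σ c j) (φ m))) (hf j) ?_
    simp only [(hasPartial_partialF ha hσ0 c j j).dS_mulS, toL2_add]
    exact (he j).add (hk j)
  refine ⟨∑ j, ((e j + k j) + e j), ?_, mem_graph_smul _ (mem_graph_sum _ fun j _ =>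
    mem_graph_add (mem_graph_opMul.2 ⟨f j, hfg j, h1 j⟩) (mem_graph_opMul.2 ⟨d j, hdg j, heg j⟩))⟩
  simp only [gammaS_eq ha hσ0, toL2_sum, toL2_add]
  exact tendsto_finsetSum _ fun j _ => ((he j).add (hk j)).add (he j)

/-- The weight and its first and second derivatives are bounded. Hence `Δ(wφ)` converges term by
term in the Leibniz rule, and `wψ` lies in the domain of `Δ`. -/
theorem CoreSeq.exists_weighted {φ : ℕ → 𝓢(E n, ℂ)} {ψ χ : L2 n} (h : CoreSeq φ ψ χ)
    {a σ : ℝ} (ha : 0 < a) (hσ : 0 ≤ σ) (c : E n) (hn : 0 < n) :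
    ∃ u, Tendsto (fun m => toL2 (mulS (weight a σ c) (Δ (mulS (weight a σ c) (φ m))))) atTop (𝓝 u) ∧
      (ψ, u) ∈ (opMul (mulOp (weight a σ c))
        (opMul (laplacian n) (mulOp (weight a σ c)))).graph := by
  have hw := bddTemp_weight ha hσ c ⟨0, hn⟩
  choose d hd _ using fun j => h.exists_dS j
  obtain ⟨f, hf, hfg⟩ := hw.exists_tendsto h.tendsto
  obtain ⟨p, hp, _⟩ := hw.exists_tendsto h.tendsto_laplacian
  choose e he _ using fun j => (bddTemp_weight_deriv ha hσ c j).exists_tendsto (hd j)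
  choose k hk _ using fun j => (bddTemp_weight_deriv2 ha hσ c j).exists_tendsto h.tendsto
  have hlap : ∀ η : 𝓢(E n, ℂ), Δ (mulS (weight a σ c) η) = mulS (weight a σ c) (Δ η) +
      ∑ j, (mulS (fun x => (x - c) j * weightRad a σ c x) (dS j η) +
        (mulS (fun x => (x - c) j * weightRad a σ c x) (dS j η) +
          mulS (fun x => weightRad a σ c x + (x - c) j ^ 2 * weightRad' a σ c x) η)) := by
    intro η
    rw [laplacian_schwartz, laplacian_schwartz, map_sum, ← Finset.sum_add_distrib]
    refine Finset.sum_congr rfl fun j _ => ?_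
    rw [(hasPartial_weight ha c j).dS_mulS, map_add, (hasPartial_weight ha c j).dS_mulS,
      (hasPartial_weight' ha c j).dS_mulS]
    abel
  have h1 : Tendsto (fun m => toL2 (Δ (mulS (weight a σ c) (φ m)))) atTop
      (𝓝 (p + ∑ j, (e j + (e j + k j)))) := by
    simp only [hlap, toL2_add, toL2_sum]
    exact hp.add (tendsto_finsetSum _ fun j _ => (he j).add ((he j).add (hk j)))
  have h2 := graph_realization_closed (fun m => graph_laplacian_schwartz
    (mulS (weight a σ c) (φ m))) hf h1
  obtain ⟨u, hu, hug⟩ := hw.exists_tendsto h1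
  exact ⟨u, hu, mem_graph_opMul.2 ⟨_, mem_graph_opMul.2 ⟨f, hfg, h2⟩, hug⟩⟩

/-! ### Integration by parts against the potential -/

theorem norm_basisVec (j : Fin n) : ‖(basisVec j : E n)‖ = 1 := by
  simp [basisVec]

/-- A sequence of cutoff functions. -/
theorem exists_cutoff (n : ℕ) : ∃ (χ : ℕ → E n → ℝ) (C : ℝ),
    (∀ m, ContDiff ℝ 1 (χ m)) ∧ (∀ m, HasCompactSupport (χ m)) ∧
    (∀ m x, 0 ≤ χ m x) ∧ (∀ m x, χ m x ≤ 1) ∧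
    (∀ x, ∀ᶠ m in atTop, χ m x = 1) ∧
    (∀ m x (j : Fin n), |fderiv ℝ (χ m) x (basisVec j)| ≤ C * ((m : ℝ) + 1)⁻¹) := by
  let b : ContDiffBump (0 : E n) := ⟨1, 2, one_pos, one_lt_two⟩
  have hb : ContDiff ℝ 1 b := b.contDiff
  have hbs : HasCompactSupport b := b.hasCompactSupport
  obtain ⟨C, hC⟩ := (hb.continuous_fderiv (by simp)).bounded_above_of_compact_support
    (hbs.fderiv (𝕜 := ℝ))
  have hpos : ∀ m : ℕ, (0 : ℝ) < ((m : ℝ) + 1)⁻¹ := fun m => by positivity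
  refine ⟨fun m x => b (((m : ℝ) + 1)⁻¹ • x), C, fun m => ?_, fun m => ?_, fun m x => b.nonneg,
    fun m x => b.le_one, fun x => ?_, fun m x j => ?_⟩
  · exact hb.comp (contDiff_const_smul _)
  · exact hbs.comp_smul (hpos m).ne'
  · obtain ⟨M, hM⟩ := exists_nat_ge ‖x‖
    filter_upwards [eventually_ge_atTop M] with m hm
    refine b.one_of_mem_closedBall ?_
    have hm' : (M : ℝ) ≤ m := by exact_mod_cast hm
    rw [mem_closedBall_zero_iff, norm_smul, Real.norm_of_nonneg (hpos m).le,
      inv_mul_le_iff₀ (by positivity)]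
    change ‖x‖ ≤ ((m : ℝ) + 1) * 1
    linarith
  · have hd : HasFDerivAt (fun x => b (((m : ℝ) + 1)⁻¹ • x))
        ((fderiv ℝ b (((m : ℝ) + 1)⁻¹ • x)).comp
          (((m : ℝ) + 1)⁻¹ • ContinuousLinearMap.id ℝ (E n))) x :=
      ((hb.differentiable (by simp) _).hasFDerivAt).comp x
        ((hasFDerivAt_id x).const_smul (((m : ℝ) + 1)⁻¹))
    rw [hd.fderiv]
    simp only [ContinuousLinearMap.comp_apply, smul_apply, ContinuousLinearMap.id_apply, map_smul,
      smul_eq_mul, abs_mul]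
    rw [abs_of_pos (hpos m), mul_comm]
    refine mul_le_mul_of_nonneg_right ?_ (hpos m).le
    have := (fderiv ℝ b (((m : ℝ) + 1)⁻¹ • x)).le_opNorm (basisVec j)
    rw [norm_basisVec, mul_one, Real.norm_eq_abs] at this
    exact this.trans (hC _)

theorem hasFDerivAt_normSq (φ : 𝓢(E n, ℂ)) (x : E n) (j : Fin n) :
    fderiv ℝ (fun x => ‖φ x‖ ^ 2) x (basisVec j) = 2 * inner ℝ (φ x) (dS j φ x) := by
  rw [((φ.hasFDerivAt x).norm_sq).fderiv, dS_apply]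
  simp
  ring

theorem contDiff_normSq (φ : 𝓢(E n, ℂ)) : ContDiff ℝ 1 (fun x => ‖φ x‖ ^ 2) :=
  (φ.smooth 1).norm_sq ℝ

theorem integrable_normSq (φ : 𝓢(E n, ℂ)) : Integrable fun x => ‖φ x‖ ^ 2 := by
  simpa using integrable_mul_normSq (Function.HasTemperateGrowth.const 1) φ

/-- The commutator of a repulsive potential with the multiplier `2 A · ∇ + div A`. -/
theorem potential_form_ge {V : E n → ℝ} (hV : ContDiff ℝ 1 V) {CV : ℝ} (hCV : ∀ x, |V x| ≤ CV)
    {A A' : Fin n → E n → ℝ} (hA : ∀ j, HasPartial (A j) j (A' j)) {CA : ℝ}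
    (hCA : ∀ j x, |A j x| ≤ CA) {Θ : E n → ℝ} (hΘ : Θ.HasTemperateGrowth) (hΘ0 : ∀ x, 0 ≤ Θ x)
    (hW : ∀ x, -Θ x ≤ -∑ j, fderiv ℝ V x (basisVec j) * A j x)
    (φ : 𝓢(E n, ℂ)) {Γ : 𝓢(E n, ℂ)}
    (hΓ : ∀ x, inner ℝ (φ x) (Γ x) =
      ∑ j, (A j x * (2 * inner ℝ (φ x) (dS j φ x)) + A' j x * ‖φ x‖ ^ 2)) :
    -∫ x, Θ x * ‖φ x‖ ^ 2 ≤ ∫ x, V x * inner ℝ (φ x) (Γ x) := by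
  -- No bound on `∇V` is available, so `V` is cut off before integrating by parts. Only a one-sided
  -- bound on `∇V · A` is used afterwards.
  obtain ⟨χ, C, hχ, hχs, hχ0, hχ1, hχlim, hχ'⟩ := exists_cutoff n
  have hint : Integrable fun x => V x * inner ℝ (φ x) (Γ x) :=
    (integrable_inner φ Γ).bdd_mul hV.continuous.aestronglyMeasurable
      (Eventually.of_forall fun x => hCV x)
  have hlim : Tendsto (fun m => ∫ x, χ m x * (V x * inner ℝ (φ x) (Γ x))) atTop
      (𝓝 (∫ x, V x * inner ℝ (φ x) (Γ x))) := by
    refine tendsto_integral_of_dominated_convergence (fun x => ‖V x * inner ℝ (φ x) (Γ x)‖)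
      (fun m => ((hχ m).continuous.aestronglyMeasurable).mul hint.1) hint.norm
      (fun m => Eventually.of_forall fun x => ?_) (Eventually.of_forall fun x => ?_)
    · rw [norm_mul, Real.norm_of_nonneg (hχ0 m x)]
      exact mul_le_of_le_one_left (norm_nonneg _) (hχ1 m x)
    · refine tendsto_const_nhds.congr' ?_
      filter_upwards [hχlim x] with m hm
      rw [hm, one_mul]
  have hi2 := integrable_normSq φ
  have hiΘ := integrable_mul_normSq hΘ φ
  -- The gradient of the cutoff falls on it, producing an error of at most `K/(m + 1)`.
  set K : ℝ := n * (CV * C * CA) * ∫ x, ‖φ x‖ ^ 2 with hK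
  have hlow : ∀ m : ℕ, -(∫ x, Θ x * ‖φ x‖ ^ 2) - K * ((m : ℝ) + 1)⁻¹ ≤
      ∫ x, χ m x * (V x * inner ℝ (φ x) (Γ x)) := by
    intro m
    have hp : ContDiff ℝ 1 (fun x => χ m x * V x) := (hχ m).mul hV
    have hps : HasCompactSupport (fun x => χ m x * V x) := (hχs m).mul_right
    have hq : ∀ j, ContDiff ℝ 1 (fun x => A j x * ‖φ x‖ ^ 2) := fun j =>
      ((hA j).temp.1.of_le (by simp)).mul (contDiff_normSq φ)
    have hq' : ∀ j x, fderiv ℝ (fun x => A j x * ‖φ x‖ ^ 2) x (basisVec j) =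
        A j x * (2 * inner ℝ (φ x) (dS j φ x)) + A' j x * ‖φ x‖ ^ 2 := by
      intro j x
      rw [fderiv_fun_mul ((hA j).temp.1.differentiable (by simp) x)
        ((contDiff_normSq φ).differentiable (by simp) x), add_apply, smul_apply, smul_apply,
        hasFDerivAt_normSq, (hA j).fderiv_eq, smul_eq_mul, smul_eq_mul, mul_comm (‖φ x‖ ^ 2)]
    have hp' : ∀ j x, fderiv ℝ (fun x => χ m x * V x) x (basisVec j) =
        χ m x * fderiv ℝ V x (basisVec j) + fderiv ℝ (χ m) x (basisVec j) * V x := by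
      intro j x
      rw [fderiv_fun_mul ((hχ m).differentiable (by simp) x) (hV.differentiable (by simp) x),
        add_apply, smul_apply, smul_apply, smul_eq_mul, smul_eq_mul, mul_comm (V x)]
    have hcp : ∀ j, Continuous fun x => fderiv ℝ (fun x => χ m x * V x) x (basisVec j) :=
      fun j => (hp.continuous_fderiv (by simp)).clm_apply continuous_const
    have hcq : ∀ j, Continuous fun x => fderiv ℝ (fun x => A j x * ‖φ x‖ ^ 2) x (basisVec j) :=
      fun j => ((hq j).continuous_fderiv (by simp)).clm_apply continuous_const
    have hi3 : ∀ j, Integrable fun x => fderiv ℝ (fun x => χ m x * V x) x (basisVec j) *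
        (A j x * ‖φ x‖ ^ 2) := fun j =>
      ((hcp j).mul (hq j).continuous).integrable_of_hasCompactSupport
        ((hps.fderiv_apply (𝕜 := ℝ) _).mul_right)
    have hi4 : ∀ j, Integrable fun x => χ m x * V x *
        fderiv ℝ (fun x => A j x * ‖φ x‖ ^ 2) x (basisVec j) := fun j =>
      (hp.continuous.mul (hcq j)).integrable_of_hasCompactSupport hps.mul_right
    have hibp : ∀ j, ∫ x, χ m x * V x * fderiv ℝ (fun x => A j x * ‖φ x‖ ^ 2) x (basisVec j) =
        -∫ x, fderiv ℝ (fun x => χ m x * V x) x (basisVec j) * (A j x * ‖φ x‖ ^ 2) := fun j =>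
      integral_mul_fderiv_eq_neg_fderiv_mul_of_integrable (hi3 j) (hi4 j)
        ((hp.continuous.mul (hq j).continuous).integrable_of_hasCompactSupport hps.mul_right)
        (fun x _ => hp.differentiable (by simp) x)
        (fun x _ => (hq j).differentiable (by simp) x)
    have h1 : ∫ x, χ m x * (V x * inner ℝ (φ x) (Γ x)) =
        ∫ x, -∑ j, fderiv ℝ (fun x => χ m x * V x) x (basisVec j) * (A j x * ‖φ x‖ ^ 2) := by
      have h2 : ∀ x, χ m x * (V x * inner ℝ (φ x) (Γ x)) = ∑ j, χ m x * V x *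
          fderiv ℝ (fun x => A j x * ‖φ x‖ ^ 2) x (basisVec j) := fun x => by
        simp only [hΓ, hq', Finset.mul_sum, mul_assoc]
      simp only [h2]
      rw [integral_finsetSum _ (fun j _ => hi4 j), integral_neg,
        integral_finsetSum _ (fun j _ => hi3 j), ← Finset.sum_neg_distrib]
      exact Finset.sum_congr rfl fun j _ => hibp j
    have h3 : -(∫ x, Θ x * ‖φ x‖ ^ 2) - K * ((m : ℝ) + 1)⁻¹ =
        ∫ x, (-(Θ x * ‖φ x‖ ^ 2) - n * (CV * C * CA) * ((m : ℝ) + 1)⁻¹ * ‖φ x‖ ^ 2) := by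
      rw [integral_sub (f := fun x => -(Θ x * ‖φ x‖ ^ 2)) hiΘ.neg (hi2.const_mul _), integral_neg, integral_const_mul, hK]
      ring
    rw [h1, h3]
    refine integral_mono (hiΘ.neg.sub (hi2.const_mul _))
      (integrable_finsetSum _ (fun j _ => hi3 j)).neg fun x => ?_
    have h4 : ∑ j, fderiv ℝ (fun x => χ m x * V x) x (basisVec j) * (A j x * ‖φ x‖ ^ 2) =
        χ m x * ‖φ x‖ ^ 2 * (∑ j, fderiv ℝ V x (basisVec j) * A j x) +
          (∑ j, fderiv ℝ (χ m) x (basisVec j) * V x * A j x) * ‖φ x‖ ^ 2 := by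
      rw [Finset.mul_sum, Finset.sum_mul, ← Finset.sum_add_distrib]
      refine Finset.sum_congr rfl fun j _ => ?_
      rw [hp']
      ring
    have h5 : ∑ j, fderiv ℝ (χ m) x (basisVec j) * V x * A j x ≤
        n * (CV * C * CA) * ((m : ℝ) + 1)⁻¹ := by
      have h6 : ∀ j, fderiv ℝ (χ m) x (basisVec j) * V x * A j x ≤
          CV * C * CA * ((m : ℝ) + 1)⁻¹ := by
        intro j
        have h7 := hχ' m x j
        have h8 : 0 ≤ CV := (abs_nonneg _).trans (hCV x)
        calc _ ≤ |fderiv ℝ (χ m) x (basisVec j) * V x * A j x| := le_abs_self _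
          _ = |fderiv ℝ (χ m) x (basisVec j)| * |V x| * |A j x| := by rw [abs_mul, abs_mul]
          _ ≤ C * ((m : ℝ) + 1)⁻¹ * CV * CA :=
            mul_le_mul (mul_le_mul h7 (hCV x) (abs_nonneg _) ((abs_nonneg _).trans h7)) (hCA j x)
              (abs_nonneg _) (mul_nonneg ((abs_nonneg _).trans h7) h8)
          _ = _ := by ring
      refine (Finset.sum_le_sum fun j _ => h6 j).trans_eq ?_
      simp
      ring
    -- Since `Θ ≥ 0` and `0 ≤ χ ≤ 1`, the lower bound `-Θ` survives multiplication by the cutoff.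
    have h9 : χ m x * Θ x ≤ Θ x := mul_le_of_le_one_left (hΘ0 x) (hχ1 m x)
    have h10 := mul_le_mul_of_nonneg_left (hW x) (hχ0 m x)
    have h11 : (0 : ℝ) ≤ ‖φ x‖ ^ 2 := by positivity
    simp only [h4]
    have h12 : -Θ x ≤ -(χ m x * ∑ j, fderiv ℝ V x (basisVec j) * A j x) := by linarith
    have h13 := mul_le_mul_of_nonneg_right h12 h11
    have h14 := mul_le_mul_of_nonneg_right h5 h11
    linarith
  have hlim0 : Tendsto (fun m : ℕ => -(∫ x, Θ x * ‖φ x‖ ^ 2) - K * ((m : ℝ) + 1)⁻¹) atTop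
      (𝓝 (-∫ x, Θ x * ‖φ x‖ ^ 2)) := by
    have h := (tendsto_one_div_add_atTop_nhds_zero_nat (𝕜 := ℝ)).const_mul K
    simp only [one_div, mul_zero] at h
    simpa using h.const_sub (-(∫ x, Θ x * ‖φ x‖ ^ 2))
  exact le_of_tendsto_of_tendsto' hlim0 hlim hlow

/-! ### Sums over the centers -/

theorem sum_Icc_neg_succ (u : ℤ → ℝ) (N : ℕ) :
    ∑ k ∈ Finset.Icc (-((N + 1 : ℕ) : ℤ)) ((N + 1 : ℕ) : ℤ), u k =
      ∑ k ∈ Finset.Icc (-(N : ℤ)) N, u k + (u (N + 1) + u (-(N + 1))) := by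
  have h : Finset.Icc (-((N + 1 : ℕ) : ℤ)) ((N + 1 : ℕ) : ℤ) =
      insert ((N : ℤ) + 1) (insert (-((N : ℤ) + 1)) (Finset.Icc (-(N : ℤ)) N)) := by
    ext k
    simp only [Finset.mem_insert, Finset.mem_Icc]
    omega
  rw [h, Finset.sum_insert, Finset.sum_insert]
  · ring
  · simp only [Finset.mem_Icc]; omega
  · simp only [Finset.mem_insert, Finset.mem_Icc]; omega

theorem sum_Icc_neg_reflect (u : ℤ → ℝ) (N : ℕ) :
    ∑ k ∈ Finset.Icc (-(N : ℤ)) N, u (-k) = ∑ k ∈ Finset.Icc (-(N : ℤ)) N, u k := by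
  induction N with
  | zero => simp
  | succ N ih => rw [sum_Icc_neg_succ u N, sum_Icc_neg_succ (fun k => u (-k)) N, ih, neg_neg]; ring

theorem sum_Icc_neg_telescope (u : ℤ → ℝ) (N : ℕ) :
    ∑ k ∈ Finset.Icc (-(N : ℤ)) N, u (k + 1) =
      ∑ k ∈ Finset.Icc (-(N : ℤ)) N, u k + (u (N + 1) - u (-N)) := by
  induction N with
  | zero => simp
  | succ N ih =>
    rw [sum_Icc_neg_succ u N, sum_Icc_neg_succ (fun k => u (k + 1)) N, ih,
      show -((N : ℤ) + 1) + 1 = -(N : ℤ) by ring]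
    push_cast
    ring

theorem sum_range_le_sum_Icc {u : ℤ → ℝ} (hu : ∀ k, 0 ≤ u k) (N : ℕ) :
    ∑ m ∈ Finset.range N, u m ≤ ∑ k ∈ Finset.Icc (-(N : ℤ)) N, u k := by
  have h : ∑ m ∈ Finset.range N, u m =
      ∑ k ∈ (Finset.range N).map ⟨fun m : ℕ => (m : ℤ), Nat.cast_injective⟩, u k := by
    rw [Finset.sum_map]; rfl
  rw [h]
  refine Finset.sum_le_sum_of_subset_of_nonneg (fun k hk => ?_) fun k _ _ => hu k
  simp only [Finset.mem_map, Finset.mem_range, Function.Embedding.coeFn_mk] at hk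
  obtain ⟨m, hm, rfl⟩ := hk
  simp only [Finset.mem_Icc]
  omega

/-- The axial component of `∇F` at axial distance `t` and squared transverse distance `q`. -/
def axialF (a σ q t : ℝ) : ℝ := t * kfun 0 σ (a * (t ^ 2 + q))

/-- The sum over the centers of the axial components of `∇F_c`. -/
def axialSum (a σ q : ℝ) (N : ℕ) (t : ℝ) : ℝ := ∑ k ∈ Finset.Icc (-(N : ℤ)) N, axialF a σ q (t - k)

theorem axialF_neg (a σ q t : ℝ) : axialF a σ q (-t) = -axialF a σ q t := by
  rw [axialF, axialF, neg_sq, neg_mul]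

/-- By the recursion the derivative equals `(1 + a(t² + q))^(-σ) + 2σ a q · kfun 2 (σ + 1)`, a sum
of nonnegative terms. It expresses the convexity of `F` along the axis. -/
theorem monotone_axialF {a σ q : ℝ} (ha : 0 < a) (hσ : 0 ≤ σ) (hq : 0 ≤ q) :
    Monotone (axialF a σ q) := by
  have hd : ∀ t, HasDerivAt (axialF a σ q) (kfun 0 σ (a * (t ^ 2 + q)) +
      t * (-σ * kfun 2 (σ + 1) (a * (t ^ 2 + q)) * (a * (2 * t)))) t := by
    intro t
    have h0 : 0 ≤ a * (t ^ 2 + q) := by positivity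
    have h1 : HasDerivAt (fun t : ℝ => a * (t ^ 2 + q)) (a * (2 * t)) t := by
      simpa using ((hasDerivAt_pow 2 t).add_const q).const_mul a
    have h2 := (hasDerivAt_id t).mul
      (HasDerivAt.comp (h := fun t : ℝ => a * (t ^ 2 + q)) t
        (hasDerivAt_kfun 0 hσ (by linarith)) h1)
    refine h2.congr_deriv ?_
    simp
  refine monotone_of_deriv_nonneg (fun t => (hd t).differentiableAt) fun t => ?_
  rw [(hd t).deriv]
  have h0 : 0 ≤ a * (t ^ 2 + q) := by positivity
  have h2 := kfun_recursion 0 σ h0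
  have hk := kfun_nonneg 2 (σ + 1) h0
  have hg : 0 ≤ (1 + a * (t ^ 2 + q)) ^ (-σ) := Real.rpow_nonneg (by positivity) _
  have h3 : 0 ≤ σ * kfun 2 (σ + 1) (a * (t ^ 2 + q)) * (a * q) := by positivity
  push_cast at h2
  nlinarith

theorem abs_axialF_le {a σ q : ℝ} (ha : 0 < a) (hσ : 1 / 2 < σ) (hq : 0 ≤ q) (t : ℝ) :
    |axialF a σ q t| ≤ profileBound a σ := by
  have h0 : 0 ≤ kfun 0 σ (a * (t ^ 2 + q)) := kfun_nonneg _ _ (by positivity)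
  have h1 := profile_le ha hσ (Real.sqrt_nonneg (t ^ 2 + q))
  rw [profile_eq, Real.sq_sqrt (by positivity)] at h1
  rw [axialF, abs_mul, abs_of_nonneg h0]
  refine (mul_le_mul_of_nonneg_right ?_ h0).trans h1
  exact Real.abs_le_sqrt (by linarith)

theorem axialSum_neg (a σ q : ℝ) (N : ℕ) (t : ℝ) :
    axialSum a σ q N (-t) = -axialSum a σ q N t := by
  rw [axialSum, axialSum, ← sum_Icc_neg_reflect, ← Finset.sum_neg_distrib]
  refine Finset.sum_congr rfl fun k _ => ?_
  rw [← axialF_neg]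
  congr 1
  push_cast
  ring

theorem monotone_axialSum {a σ q : ℝ} (ha : 0 < a) (hσ : 0 ≤ σ) (hq : 0 ≤ q) (N : ℕ) :
    Monotone (axialSum a σ q N) := fun s t hst =>
  Finset.sum_le_sum fun k _ => monotone_axialF ha hσ hq (by linarith)

theorem axialSum_zero (a σ q : ℝ) (N : ℕ) : axialSum a σ q N 0 = 0 := by
  have h := axialSum_neg a σ q N 0
  rw [neg_zero] at h
  linarith

/-- A unit shift of the argument is a unit shift of the centers, so the sums telescope: each step
changes only the two end terms, and each of these is at most the bound for `f`. Starting from `0` by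
oddness, the estimate does not depend on `N`. -/
theorem axialSum_natCast_le {a σ q : ℝ} (ha : 0 < a) (hσ : 1 / 2 < σ) (hq : 0 ≤ q) (N m : ℕ) :
    axialSum a σ q N m ≤ m * (2 * profileBound a σ) := by
  induction m with
  | zero => simp [axialSum_zero]
  | succ m ih =>
    have h := sum_Icc_neg_telescope (fun k => axialF a σ q (((m + 1 : ℕ) : ℝ) - k)) N
    have h1 : ∑ k ∈ Finset.Icc (-(N : ℤ)) N, axialF a σ q (((m + 1 : ℕ) : ℝ) - ((k + 1 : ℤ) : ℝ)) =
        axialSum a σ q N m := by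
      refine Finset.sum_congr rfl fun k _ => ?_
      congr 1
      push_cast
      ring
    simp only [h1] at h
    rw [axialSum] at ih
    have h2 := abs_le.1 (abs_axialF_le ha hσ hq (((m + 1 : ℕ) : ℝ) - ((N + 1 : ℤ) : ℝ)))
    have h3 := abs_le.1 (abs_axialF_le ha hσ hq (((m + 1 : ℕ) : ℝ) - ((-N : ℤ) : ℝ)))
    rw [axialSum] at h
    rw [axialSum]
    push_cast at *
    linarith

theorem abs_axialSum_le {a σ q L : ℝ} (ha : 0 < a) (hσ : 1 / 2 < σ) (hq : 0 ≤ q) (N : ℕ)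
    {ℓ : ℕ} (hℓ : L ≤ ℓ) {t : ℝ} (ht : |t| ≤ L) :
    |axialSum a σ q N t| ≤ ℓ * (2 * profileBound a σ) := by
  have hm := monotone_axialSum ha (by linarith : 0 ≤ σ) hq N
  have h1 := axialSum_natCast_le ha hσ hq N ℓ
  rw [abs_le] at ht ⊢
  constructor
  · have h2 : axialSum a σ q N (-ℓ) ≤ axialSum a σ q N t := hm (by linarith)
    rw [axialSum_neg] at h2
    linarith
  · exact (hm (by linarith)).trans h1

/-- The sum over the centers of `f(|x - c|) / |x - c|`. -/
def transverseSum (a σ q : ℝ) (N : ℕ) (t : ℝ) : ℝ :=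
  ∑ k ∈ Finset.Icc (-(N : ℤ)) N, kfun 0 σ (a * ((t - k) ^ 2 + q))

theorem transverseSum_nonneg {a σ q : ℝ} (ha : 0 < a) (hq : 0 ≤ q) (N : ℕ) (t : ℝ) :
    0 ≤ transverseSum a σ q N t :=
  Finset.sum_nonneg fun _ _ => kfun_nonneg _ _ (by positivity)

/-! ### Divergence of the transverse sum -/

theorem monotone_profile {a : ℝ} (ha : 0 < a) (σ : ℝ) : MonotoneOn (profile a σ) (Set.Ici 0) := by
  intro r hr s _ hrs
  have hc : Continuous fun s : ℝ => (1 + a * s ^ 2) ^ (-σ) :=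
    Continuous.rpow_const (by fun_prop) fun s => Or.inl (by positivity)
  refine intervalIntegral.integral_mono_interval le_rfl hr hrs
    (Eventually.of_forall fun s => Real.rpow_nonneg (by positivity) _) (hc.intervalIntegrable _ _)

theorem profile_pos {a : ℝ} (ha : 0 < a) (σ : ℝ) {r : ℝ} (hr : 0 < r) : 0 < profile a σ r := by
  have hc : Continuous fun s : ℝ => (1 + a * s ^ 2) ^ (-σ) :=
    Continuous.rpow_const (by fun_prop) fun s => Or.inl (by positivity)
  exact intervalIntegral.intervalIntegral_pos_of_pos (hc.intervalIntegrable _ _)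
    (fun s => Real.rpow_pos_of_pos (by positivity) _) hr

/-- Let `r = |x - c_k|`. The quantity is `f(r) ρ/r`, where `f(r) ≥ f(δ)` by monotonicity and `r ≤ L
+ k + ρ`, so it decays no faster than `1/(k + 1)`, uniformly in `ρ ≥ δ`. -/
theorem mul_kfun_ge {a σ L δ ρ t : ℝ} (ha : 0 < a) (hL : 0 ≤ L) (hδ : 0 < δ) (hρ : δ ≤ ρ)
    (ht : |t| ≤ L) (k : ℕ) :
    profile a σ δ * δ / (L + δ + 1) * (1 / ((k : ℝ) + 1)) ≤
      ρ * kfun 0 σ (a * ((t - k) ^ 2 + ρ ^ 2)) := by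
  have hρ0 : 0 < ρ := hδ.trans_le hρ
  set r := √((t - k) ^ 2 + ρ ^ 2) with hr
  have hr2 : r ^ 2 = (t - k) ^ 2 + ρ ^ 2 := Real.sq_sqrt (by positivity)
  have hrρ : ρ ≤ r := Real.le_sqrt_of_sq_le (by nlinarith [sq_nonneg (t - k)])
  have hr0 : 0 < r := hρ0.trans_le hrρ
  have hk : (0 : ℝ) ≤ k := Nat.cast_nonneg k
  have htk : |t - k| ≤ L + k := by
    refine (abs_sub _ _).trans ?_
    rw [abs_of_nonneg hk]
    linarith
  have hr1 : r ≤ L + k + ρ := by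
    refine Real.sqrt_le_iff.2 ⟨by positivity, ?_⟩
    have h1 : (t - k) ^ 2 ≤ (L + k) ^ 2 := sq_le_sq' (by linarith [(abs_le.1 htk).1]) (abs_le.1 htk).2
    nlinarith [mul_nonneg (add_nonneg hL hk) hρ0.le]
  have hp : profile a σ δ ≤ r * kfun 0 σ (a * r ^ 2) := by
    rw [← profile_eq]
    exact monotone_profile ha σ hδ.le hr0.le (hρ.trans hrρ)
  have hp0 := profile_pos ha σ hδ
  rw [← hr2]
  have h2 : δ / (L + δ + 1) * (1 / ((k : ℝ) + 1)) ≤ ρ / r := by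
    rw [div_mul_div_comm, mul_one, div_le_div_iff₀ (by positivity) hr0]
    have h3 : δ * r ≤ δ * (L + k + ρ) := by gcongr
    have h4 : δ * (L + k) ≤ ρ * (L + k) := by gcongr
    nlinarith [mul_nonneg hρ0.le hk, mul_nonneg (mul_nonneg hρ0.le hk) hL,
      mul_nonneg (mul_nonneg hρ0.le hk) hδ.le]
  calc profile a σ δ * δ / (L + δ + 1) * (1 / ((k : ℝ) + 1)) =
      profile a σ δ * (δ / (L + δ + 1) * (1 / ((k : ℝ) + 1))) := by ring
    _ ≤ r * kfun 0 σ (a * r ^ 2) * (ρ / r) := mul_le_mul hp h2 (by positivity) (hp0.le.trans hp)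
    _ = ρ * kfun 0 σ (a * r ^ 2) := by field_simp

/-- The centers `0, …, N - 1` alone already contribute a multiple of a divergent harmonic sum. -/
theorem exists_transverseSum_ge {a L δ : ℝ} (σ : ℝ) (ha : 0 < a) (hL : 0 ≤ L) (hδ : 0 < δ) (B : ℝ) :
    ∃ N₀ : ℕ, ∀ N, N₀ ≤ N → ∀ ρ t : ℝ, δ ≤ ρ → |t| ≤ L →
      B ≤ ρ * transverseSum a σ (ρ ^ 2) N t := by
  have hc : 0 < profile a σ δ * δ / (L + δ + 1) := by
    have := profile_pos ha σ hδ
    positivity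
  have h := (tendsto_atTop.1 (Real.tendsto_sum_range_one_div_nat_succ_atTop.const_mul_atTop hc)) B
  obtain ⟨N₀, hN₀⟩ := eventually_atTop.1 h
  refine ⟨N₀, fun N hN ρ t hρ ht => (hN₀ N hN).trans ?_⟩
  have hρ0 : 0 ≤ ρ := hδ.le.trans hρ
  rw [transverseSum, Finset.mul_sum, Finset.mul_sum]
  refine le_trans ?_ (sum_range_le_sum_Icc (u := fun k : ℤ =>
    ρ * kfun 0 σ (a * ((t - k) ^ 2 + ρ ^ 2))) (fun k => mul_nonneg hρ0
      (kfun_nonneg _ _ (by positivity))) N)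
  refine Finset.sum_le_sum fun k _ => ?_
  exact_mod_cast mul_kfun_ge ha hL hδ hρ ht k

/-! ### Axially repulsive potentials -/

theorem clm_eq_sum (ℓ : E n →L[ℝ] ℝ) (v : E n) : ℓ v = ∑ j, v j * ℓ (basisVec j) := by
  conv_lhs => rw [← (EuclideanSpace.basisFun (Fin n) ℝ).sum_repr v, map_sum]
  simp

section Axial

variable [NeZero n]

theorem transverse_zero (x : E n) : (transverse x) 0 = 0 := by
  simp [transverse, axis]

theorem axis_zero : (axis n) 0 = 1 := by simp [axis]

theorem eq_axis_add_transverse (x : E n) : x = x 0 • axis n + transverse x := by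
  simp [transverse]

theorem coord_axis_add (x : E n) (s t : ℝ) : (s • axis n + t • transverse x) 0 = s := by
  simp [transverse_zero, axis_zero]

theorem transverse_axis_add (x : E n) (s t : ℝ) :
    transverse (s • axis n + t • transverse x) = t • transverse x := by
  rw [transverse, coord_axis_add]
  simp

theorem norm_sq_sub_axis (x : E n) (s : ℝ) :
    ‖x - s • axis n‖ ^ 2 = (x 0 - s) ^ 2 + ‖transverse x‖ ^ 2 := by
  have h1 : x - s • axis n = (x 0 - s) • axis n + transverse x := by
    rw [transverse, sub_smul]; abel
  have h2 : inner ℝ ((x 0 - s) • axis n) (transverse x) = 0 := by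
    rw [real_inner_smul_left, real_inner_comm, axis, inner_basisVec, transverse_zero, mul_zero]
  have h3 : ‖axis n‖ = 1 := norm_basisVec 0
  rw [h1, norm_add_sq_real, h2, norm_smul, h3, mul_one, Real.norm_eq_abs, sq_abs]
  ring

theorem norm_sq_eq_axis (x : E n) : ‖x‖ ^ 2 = x 0 ^ 2 + ‖transverse x‖ ^ 2 := by
  have := norm_sq_sub_axis x 0
  simpa using this

/-! ### Boundedness of an axially repulsive potential -/

theorem AxiallyRepulsive.hasDerivAt_line {L : ℝ} {V : E n → ℝ} (hV : AxiallyRepulsive L V)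
    (p v : E n) (t : ℝ) :
    HasDerivAt (fun t : ℝ => V (p + t • v)) (fderiv ℝ V (p + t • v) v) t := by
  have h1 : HasDerivAt (fun t : ℝ => p + t • v) v t := by
    simpa using ((hasDerivAt_id t).smul_const v).const_add p
  exact ((hV.contDiff.differentiable (by simp)) (p + t • v)).hasFDerivAt.comp_hasDerivAt t h1

/-- By (A2), `V` does not increase along a ray leaving the axis perpendicularly. -/
theorem AxiallyRepulsive.le_axis {L : ℝ} {V : E n → ℝ} (hV : AxiallyRepulsive L V) (x : E n) :
    V x ≤ V (x 0 • axis n) := by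
  have hanti : AntitoneOn (fun t : ℝ => V (x 0 • axis n + t • transverse x)) (Set.Ici 0) := by
    refine antitoneOn_of_deriv_nonpos (convex_Ici 0)
      (fun t _ => (hV.hasDerivAt_line _ _ t).continuousAt.continuousWithinAt)
      (fun t _ => (hV.hasDerivAt_line _ _ t).differentiableAt.differentiableWithinAt) fun t ht => ?_
    rw [interior_Ici, Set.mem_Ioi] at ht
    rw [(hV.hasDerivAt_line _ _ t).deriv]
    have h := hV.transverse_repulsive (x 0 • axis n + t • transverse x)
    rw [transverse_axis_add, map_smul, smul_eq_mul] at h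
    by_contra hc
    push Not at hc
    nlinarith [mul_pos ht hc]
  have h := hanti (Set.mem_Ici.2 le_rfl) (Set.mem_Ici.2 zero_le_one) zero_le_one
  simp only [one_smul, zero_smul, add_zero] at h
  rwa [← eq_axis_add_transverse] at h

/-- On the axis `V` does not increase as one moves away from `[-L, L]`, so its maximum over that
segment bounds it everywhere. Thus `V` is a bounded multiplication operator, and `H` is defined on
all of `D(-Δ)`. -/
theorem AxiallyRepulsive.exists_bound {L : ℝ} (hL : 0 < L) {V : E n → ℝ}
    (hV : AxiallyRepulsive L V) : ∃ C, ∀ x, |V x| ≤ C := by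
  have hc : Continuous fun s : ℝ => V (0 + s • axis n) :=
    hV.contDiff.continuous.comp (by fun_prop)
  obtain ⟨C, hC⟩ := (isCompact_Icc (a := -L) (b := L)).exists_bound_of_continuousOn hc.continuousOn
  have hcoord : ∀ s : ℝ, (0 + s • axis n : E n) 0 = s := fun s => by simp [axis_zero]
  have hright : AntitoneOn (fun s : ℝ => V (0 + s • axis n)) (Set.Ici L) := by
    refine antitoneOn_of_deriv_nonpos (convex_Ici L) hc.continuousOn
      (fun t _ => (hV.hasDerivAt_line _ _ t).differentiableAt.differentiableWithinAt) fun t ht => ?_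
    rw [interior_Ici, Set.mem_Ioi] at ht
    rw [(hV.hasDerivAt_line _ _ t).deriv]
    have h := hV.axis_repulsive (0 + t • axis n) (by rw [hcoord]; exact ht.trans_le (le_abs_self t))
    rw [hcoord] at h
    by_contra hc
    push Not at hc
    nlinarith [mul_pos (hL.trans ht) hc]
  have hleft : MonotoneOn (fun s : ℝ => V (0 + s • axis n)) (Set.Iic (-L)) := by
    refine monotoneOn_of_deriv_nonneg (convex_Iic (-L)) hc.continuousOn
      (fun t _ => (hV.hasDerivAt_line _ _ t).differentiableAt.differentiableWithinAt) fun t ht => ?_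
    rw [interior_Iic, Set.mem_Iio] at ht
    rw [(hV.hasDerivAt_line _ _ t).deriv]
    have h := hV.axis_repulsive (0 + t • axis n)
      (by rw [hcoord]; exact (by linarith : L < -t).trans_le (neg_le_abs t))
    rw [hcoord] at h
    by_contra hc
    push Not at hc
    nlinarith [mul_pos (hL.trans (by linarith : L < -t)) (neg_pos.2 hc)]
  refine ⟨C, fun x => ?_⟩
  rw [abs_of_nonneg (hV.nonneg x)]
  refine (hV.le_axis x).trans ?_
  rw [← zero_add (x 0 • axis n)]
  have hin : ∀ s ∈ Set.Icc (-L) L, V (0 + s • axis n) ≤ C := fun s hs =>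
    (le_abs_self _).trans (hC s hs)
  rcases le_total (x 0) (-L) with h | h
  · exact (hleft h (Set.mem_Iic.2 le_rfl) h).trans (hin _ ⟨le_rfl, by linarith⟩)
  · rcases le_total (x 0) L with h' | h'
    · exact hin _ ⟨h, h'⟩
    · exact (hright (Set.mem_Ici.2 le_rfl) h' h').trans (hin _ ⟨by linarith, le_rfl⟩)

theorem norm_sq_sub_center (x : E n) (k : ℤ) :
    ‖x - center n k‖ ^ 2 = (x 0 - k) ^ 2 + ‖transverse x‖ ^ 2 := norm_sq_sub_axis x k

/-- The field `∇ ∑ₖ F_{cₖ}`. -/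
def centerField (n : ℕ) [NeZero n] (a σ : ℝ) (N : ℕ) (j : Fin n) (x : E n) : ℝ :=
  ∑ k ∈ Finset.Icc (-(N : ℤ)) N, partialF a σ (center n k) j x

/-- Because the centers lie on the axis, all the vectors `x - c_k` share the transverse part `y`.
Only scalar sums over `k` remain. -/
theorem sum_fderiv_centerField {a σ : ℝ} (ha : 0 < a) (hσ : 0 ≤ σ) (N : ℕ) (V : E n → ℝ) (x : E n) :
    ∑ j, fderiv ℝ V x (basisVec j) * centerField n a σ N j x =
      axialSum a σ (‖transverse x‖ ^ 2) N (x 0) * fderiv ℝ V x (axis n) +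
        transverseSum a σ (‖transverse x‖ ^ 2) N (x 0) * fderiv ℝ V x (transverse x) := by
  simp only [centerField, partialF_eq ha hσ, Finset.mul_sum]
  rw [Finset.sum_comm, axialSum, transverseSum, Finset.sum_mul, Finset.sum_mul,
    ← Finset.sum_add_distrib]
  refine Finset.sum_congr rfl fun k _ => ?_
  have h1 : x - center n k = (x 0 - (k : ℝ)) • axis n + transverse x := by
    rw [transverse, sub_smul, center]; abel
  have h2 := clm_eq_sum (fderiv ℝ V x) (x - center n k)
  have h3 : fderiv ℝ V x (x - center n k) =
      (x 0 - (k : ℝ)) * fderiv ℝ V x (axis n) + fderiv ℝ V x (transverse x) := by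
    rw [h1, map_add, map_smul, smul_eq_mul]
  rw [norm_sq_sub_center, axialF]
  calc ∑ j, fderiv ℝ V x (basisVec j) * ((x - center n k) j *
        kfun 0 σ (a * ((x 0 - k) ^ 2 + ‖transverse x‖ ^ 2))) =
      (∑ j, (x - center n k) j * fderiv ℝ V x (basisVec j)) *
        kfun 0 σ (a * ((x 0 - k) ^ 2 + ‖transverse x‖ ^ 2)) := by
        rw [Finset.sum_mul]
        exact Finset.sum_congr rfl fun j _ => by ring
    _ = _ := by rw [← h2, h3]; ring

/-- Away from a thin tube around the segment `|x₁| ≤ L` of the axis, the field `∇ ∑ₖ F_{cₖ}`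
points in a direction along which `V` decreases; in the tube the error is uniformly bounded. -/
theorem AxiallyRepulsive.exists_tube_bound {L : ℝ} (hL : 0 < L) {V : E n → ℝ}
    (hV : AxiallyRepulsive L V) {a σ : ℝ} (ha : 0 < a) (hσ : 1 / 2 < σ) :
    ∃ C, ∀ δ, 0 < δ → δ < L → ∃ N₀ : ℕ, ∀ N, N₀ ≤ N → ∀ x : E n,
      (|x 0| ≤ L ∧ ‖transverse x‖ < δ →
        -C ≤ -∑ j, fderiv ℝ V x (basisVec j) * centerField n a σ N j x) ∧
      (¬(|x 0| ≤ L ∧ ‖transverse x‖ < δ) →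
        0 ≤ -∑ j, fderiv ℝ V x (basisVec j) * centerField n a σ N j x) := by
  have hσ0 : 0 ≤ σ := by linarith
  obtain ⟨ℓ, hℓ⟩ := exists_nat_ge L
  -- The ball of radius `2L` contains every tube with `δ < L`. The bound on `∂₁V`, and with it the
  -- constant `P * M`, is therefore fixed before `δ`.
  obtain ⟨M, hM⟩ := (isCompact_closedBall (0 : E n) (2 * L)).exists_bound_of_continuousOn
    ((hV.contDiff.continuous_fderiv (by simp)).clm_apply
      (continuous_const (y := axis n))).continuousOn
  set P : ℝ := ℓ * (2 * profileBound a σ) with hP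
  have hP0 : 0 ≤ P := by have := profileBound_nonneg ha σ; positivity
  refine ⟨P * M, fun δ hδ hδL => ?_⟩
  obtain ⟨Λ, hΛ, hΛ'⟩ := hV.axis_controlled δ hδ hδL
  -- `P` bounds the axial sum and `Λ` is the constant of (A3). Once `ρ` times the transverse sum
  -- exceeds `P * Λ`, the transverse term dominates the axial one.
  obtain ⟨N₀, hN₀⟩ := exists_transverseSum_ge σ ha hL.le hδ (P * Λ)
  refine ⟨N₀, fun N hN x => ?_⟩
  rw [sum_fderiv_centerField ha hσ0]
  have hq : 0 ≤ ‖transverse x‖ ^ 2 := by positivity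
  have hS := transverseSum_nonneg (σ := σ) ha hq N (x 0)
  have hT := hV.transverse_repulsive x
  have hST := mul_nonneg hS hT
  refine ⟨fun ⟨hx, hy⟩ => ?_, fun hx => ?_⟩
  · have h1 := abs_axialSum_le ha hσ hq N hℓ hx
    have h2 : |fderiv ℝ V x (axis n)| ≤ M := by
      refine hM x ?_
      rw [mem_closedBall_zero_iff]
      refine abs_le_of_sq_le_sq' ?_ (by positivity) |>.2
      have h3 : x 0 ^ 2 ≤ L ^ 2 := sq_le_sq' (abs_le.1 hx).1 (abs_le.1 hx).2
      rw [norm_sq_eq_axis]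
      nlinarith [norm_nonneg (transverse x)]
    have h3 : |axialSum a σ (‖transverse x‖ ^ 2) N (x 0) * fderiv ℝ V x (axis n)| ≤ P * M := by
      rw [abs_mul]
      exact mul_le_mul h1 h2 (abs_nonneg _) hP0
    have h4 := (abs_le.1 h3).2
    linarith
  · rcases le_or_gt |x 0| L with hx0 | hx0
    · have hδy : δ ≤ ‖transverse x‖ := by
        by_contra hc
        exact hx ⟨hx0, not_le.1 hc⟩
      have hy0 : 0 < ‖transverse x‖ := hδ.trans_le hδy
      have h1 := abs_axialSum_le ha hσ hq N hℓ hx0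
      have h2 := hΛ' x hx0 hδy
      rw [map_smul, smul_eq_mul, abs_mul, abs_of_nonneg (inv_nonneg.2 hy0.le),
        abs_of_nonpos
          (show fderiv ℝ V x (transverse x) ≤ 0 by linarith)] at h2
      have h3 := hN₀ N hN ‖transverse x‖ (x 0) hδy hx0
      have h4 : |axialSum a σ (‖transverse x‖ ^ 2) N (x 0) * fderiv ℝ V x (axis n)| ≤
          P * (Λ * (‖transverse x‖⁻¹ * -fderiv ℝ V x (transverse x))) := by
        rw [abs_mul]
        exact mul_le_mul h1 h2 (abs_nonneg _) hP0
      have h5 : P * (Λ * (‖transverse x‖⁻¹ * -fderiv ℝ V x (transverse x))) ≤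
          transverseSum a σ (‖transverse x‖ ^ 2) N (x 0) * -fderiv ℝ V x (transverse x) := by
        have h6 := mul_le_mul_of_nonneg_right h3 (mul_nonneg (inv_nonneg.2 hy0.le) hT)
        calc _ = P * Λ * (‖transverse x‖⁻¹ * -fderiv ℝ V x (transverse x)) := by ring
          _ ≤ _ := h6
          _ = _ := by field_simp
      have h7 := (abs_le.1 h4).2
      linarith
    · have h1 := hV.axis_repulsive x hx0
      have hm := monotone_axialSum ha hσ0 hq N
      have h2 : axialSum a σ (‖transverse x‖ ^ 2) N (x 0) * fderiv ℝ V x (axis n) ≤ 0 := by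
        rcases lt_abs.1 hx0 with h | h
        · have hpos : 0 < x 0 := hL.trans h
          have h3 : 0 ≤ axialSum a σ (‖transverse x‖ ^ 2) N (x 0) := by
            rw [← axialSum_zero a σ (‖transverse x‖ ^ 2) N]; exact hm hpos.le
          refine mul_nonpos_of_nonneg_of_nonpos h3 ?_
          by_contra hc
          push Not at hc
          nlinarith [mul_pos hpos hc]
        · have hneg : x 0 < 0 := by linarith
          have h3 : axialSum a σ (‖transverse x‖ ^ 2) N (x 0) ≤ 0 := by
            rw [← axialSum_zero a σ (‖transverse x‖ ^ 2) N]; exact hm hneg.le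
          refine mul_nonpos_of_nonpos_of_nonneg h3 ?_
          by_contra hc
          push Not at hc
          nlinarith [mul_pos_of_neg_of_neg hneg hc]
      linarith

/-- An average of regularized Hardy weights with centers on the segment `|x₁| ≤ L` of the axis. -/
def segmentWeight (n : ℕ) [NeZero n] (β a σ : ℝ) (s : Finset ℤ) (m : ℕ) (x : E n) : ℝ :=
  ∑ i ∈ s, β / s.card * (weight a σ (center n 0) x * weight a σ (center n 0) x *
    (‖x - ((i : ℝ) / m) • axis n‖ ^ 2 + (((m : ℝ) ^ 2)⁻¹))⁻¹)

/-- The averaged Hardy weights can be made large in a thin tube around the segment. -/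
theorem exists_segmentWeight_ge (n : ℕ) [NeZero n] {L β a : ℝ} (σ : ℝ) (hL : 0 < L) (hβ : 0 < β)
    (ha : 0 < a) (hσ : 0 ≤ σ) (C : ℝ) :
    ∃ (s : Finset ℤ) (m : ℕ) (δ : ℝ), s.Nonempty ∧ 0 < m ∧ 0 < δ ∧ δ < L ∧
      ∀ x : E n, |x 0| ≤ L ∧ ‖transverse x‖ < δ → C ≤ segmentWeight n β a σ s m x := by
  obtain ⟨ℓ, hℓ⟩ := exists_nat_ge L
  set w : ℝ := (1 + a * (L ^ 2 + L ^ 2)) ^ (-σ) with hw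
  have hw0 : 0 < w := Real.rpow_pos_of_pos (by positivity) _
  -- There are at most `(2ℓ + 1) m` centers, and the nearest contributes at least `w m²/3`. The
  -- average is thus at least `β w m / (3 (2ℓ + 1))`, and `m` is taken large enough for this to
  -- exceed `C`.
  obtain ⟨m₀, hm₀⟩ := exists_nat_ge (C * (3 * (2 * ℓ + 1)) / (β * w))
  set m : ℕ := m₀ + 1 with hm
  have hm1 : (1 : ℝ) ≤ m := by rw [hm]; push_cast; linarith [Nat.cast_nonneg (α := ℝ) m₀]
  have hmpos : (0 : ℝ) < m := by linarith
  set s : Finset ℤ := Finset.Icc (-((ℓ * m : ℕ) : ℤ)) ((ℓ * m : ℕ) : ℤ) with hs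
  have hne : s.Nonempty := ⟨0, Finset.mem_Icc.2 ⟨neg_nonpos.2 (Int.natCast_nonneg _), Int.natCast_nonneg _⟩⟩
  have hcard : (s.card : ℝ) ≤ (2 * ℓ + 1) * m := by
    have h1 : s.card = 2 * (ℓ * m) + 1 := by
      rw [hs, Int.card_Icc]
      generalize ℓ * m = p
      omega
    rw [h1, Nat.cast_add, Nat.cast_mul, Nat.cast_mul]
    simp only [Nat.cast_ofNat, Nat.cast_one]
    linarith
  have hcard0 : (0 : ℝ) < s.card := by exact_mod_cast hne.card_pos
  have hδ1 : 0 < min ((m : ℝ)⁻¹) (L / 2) := lt_min (by positivity) (by positivity)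
  refine ⟨s, m, min ((m : ℝ)⁻¹) (L / 2), hne, by omega, hδ1,
    (min_le_right _ _).trans_lt (by linarith), fun x ⟨hx, hy⟩ => ?_⟩
  have hy1 : ‖transverse x‖ ≤ (m : ℝ)⁻¹ := hy.le.trans (min_le_left _ _)
  have hy2 : ‖transverse x‖ ≤ L := hy.le.trans ((min_le_right _ _).trans (by linarith))
  have hy0 := norm_nonneg (transverse x)
  have hxb := abs_le.1 hx
  -- The center `i/m` is within `1/m` of `x 0`.
  set i : ℤ := ⌊x 0 * m⌋ with hi
  have hi1 : (i : ℝ) ≤ x 0 * m := Int.floor_le _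
  have hi2 : x 0 * m < i + 1 := Int.lt_floor_add_one _
  have his : i ∈ s := by
    rw [hs, Finset.mem_Icc]
    constructor
    · rw [hi, Int.le_floor]
      push_cast
      nlinarith
    · have : (i : ℝ) ≤ ((ℓ * m : ℕ) : ℤ) := by
        push_cast
        nlinarith
      exact_mod_cast this
  have hterm : ∀ k ∈ s, 0 ≤ β / s.card * (weight a σ (center n 0) x * weight a σ (center n 0) x *
      (‖x - ((k : ℝ) / m) • axis n‖ ^ 2 + (((m : ℝ) ^ 2)⁻¹))⁻¹) := fun k _ =>
    mul_nonneg (by positivity) (mul_nonneg (mul_self_nonneg _) (by positivity))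
  refine le_trans ?_ (Finset.single_le_sum hterm his)
  have hwx : w ≤ weight a σ (center n 0) x * weight a σ (center n 0) x := by
    rw [weight_mul_weight ha, hw]
    refine Real.rpow_le_rpow_of_nonpos (by positivity) ?_ (by linarith)
    rw [norm_sq_sub_center]
    have h1 : x 0 ^ 2 ≤ L ^ 2 := sq_le_sq' hxb.1 hxb.2
    have h2 : ‖transverse x‖ ^ 2 ≤ L ^ 2 := by gcongr
    push_cast
    rw [sub_zero]
    gcongr
  -- Axial distance, transverse distance and regularization each contribute at most `m⁻²` to the
  -- denominator.
  have hH : (m : ℝ) ^ 2 / 3 ≤ (‖x - ((i : ℝ) / m) • axis n‖ ^ 2 + (((m : ℝ) ^ 2)⁻¹))⁻¹ := by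
    rw [show (m : ℝ) ^ 2 / 3 = (3 * ((m : ℝ) ^ 2)⁻¹)⁻¹ by field_simp]
    refine inv_anti₀ (by positivity) ?_
    rw [norm_sq_sub_axis]
    have h1 : (x 0 - i / m) ^ 2 ≤ ((m : ℝ) ^ 2)⁻¹ := by
      have h2 : x 0 - i / m = (x 0 * m - i) / m := by field_simp
      rw [h2, div_pow, div_eq_mul_inv]
      have h3 : (x 0 * m - i) ^ 2 ≤ 1 := by nlinarith
      exact mul_le_of_le_one_left (by positivity) h3
    have h4 : ‖transverse x‖ ^ 2 ≤ ((m : ℝ) ^ 2)⁻¹ := by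
      rw [← inv_pow]; gcongr
    linarith
  have hm0 : C * (3 * (2 * ℓ + 1)) ≤ m * (β * w) := by
    have h1 := (div_le_iff₀ (by positivity)).1 hm₀
    refine h1.trans (mul_le_mul_of_nonneg_right ?_ (by positivity))
    rw [hm]; push_cast; linarith
  calc C ≤ m * (β * w) / (3 * (2 * ℓ + 1)) := (le_div_iff₀ (by positivity)).2 hm0
    _ = β / ((2 * ℓ + 1) * m) * (w * ((m : ℝ) ^ 2 / 3)) := by field_simp
    _ ≤ β / s.card * (weight a σ (center n 0) x * weight a σ (center n 0) x *
      (‖x - ((i : ℝ) / m) • axis n‖ ^ 2 + (((m : ℝ) ^ 2)⁻¹))⁻¹) := by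
      refine mul_le_mul ?_ (mul_le_mul hwx hH (by positivity) (mul_self_nonneg _)) (by positivity)
        (by positivity)
      gcongr

end Axial

/-! ### The estimate on the core -/

section Core

variable [NeZero n]

theorem segmentWeight_nonneg {β : ℝ} (hβ : 0 ≤ β) (a σ : ℝ) (s : Finset ℤ) (m : ℕ) (x : E n) :
    0 ≤ segmentWeight n β a σ s m x :=
  Finset.sum_nonneg fun i _ => mul_nonneg (by positivity)
    (mul_nonneg (mul_self_nonneg _) (by positivity))

theorem hasTemperateGrowth_segmentWeight_term {a : ℝ} (ha : 0 < a) (σ : ℝ) {m : ℕ} (hm : 0 < m)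
    (i : ℤ) : (fun x : E n => weight a σ (center n 0) x * weight a σ (center n 0) x *
      (‖x - ((i : ℝ) / m) • axis n‖ ^ 2 + (((m : ℝ) ^ 2)⁻¹))⁻¹).HasTemperateGrowth := by
  have hw := (hasPartial_weight (σ := σ) ha (center n 0) 0).temp
  have hm' : (0 : ℝ) < m := by exact_mod_cast hm
  exact (hw.mul hw).mul (hasTemperateGrowth_hardy (by positivity) _)

theorem hasTemperateGrowth_segmentWeight {a : ℝ} (ha : 0 < a) (β σ : ℝ) (s : Finset ℤ) {m : ℕ}
    (hm : 0 < m) : (segmentWeight n β a σ s m).HasTemperateGrowth :=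
  hasTemperateGrowth_fun_sum s fun i _ => (Function.HasTemperateGrowth.const (β / s.card)).mul
    (hasTemperateGrowth_segmentWeight_term ha σ hm i)

/-- The averaged Hardy weights are form bounded by the Dirichlet form of `⟨x⟩^(-σ) φ`. -/
theorem integral_segmentWeight_le (hn : 3 ≤ n) {a β : ℝ} (ha : 0 < a) (hβ : 0 ≤ β) (σ : ℝ)
    {s : Finset ℤ} (hs : s.Nonempty) {m : ℕ} (hm : 0 < m) (φ : 𝓢(E n, ℂ)) :
    ∫ x, segmentWeight n β a σ s m x * ‖φ x‖ ^ 2 ≤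
      β * (4 / ((n : ℝ) - 2) ^ 2) * dirichlet (mulS (weight a σ (center n 0)) φ) := by
  have hn' : (3 : ℝ) ≤ n := by exact_mod_cast hn
  have hn2 : 0 < ((n : ℝ) - 2) ^ 2 := pow_pos (by linarith) 2
  have hw := (hasPartial_weight (σ := σ) ha (center n 0) 0).temp
  set D := dirichlet (mulS (weight a σ (center n 0)) φ) with hD
  have hcard : (0 : ℝ) < s.card := by exact_mod_cast hs.card_pos
  have hterm : ∀ i : ℤ, ∫ x, (weight a σ (center n 0) x * weight a σ (center n 0) x *
      (‖x - ((i : ℝ) / m) • axis n‖ ^ 2 + (((m : ℝ) ^ 2)⁻¹))⁻¹) * ‖φ x‖ ^ 2 ≤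
        4 / ((n : ℝ) - 2) ^ 2 * D := by
    intro i
    have hη : 0 < ((m : ℝ) ^ 2)⁻¹ := by positivity
    have h := hardy (by omega) hη (((i : ℝ) / m) • axis n) (mulS (weight a σ (center n 0)) φ)
    rw [realInner_mulS_self (hasTemperateGrowth_hardy hη _)] at h
    have h2 : ∫ x, (weight a σ (center n 0) x * weight a σ (center n 0) x *
        (‖x - ((i : ℝ) / m) • axis n‖ ^ 2 + (((m : ℝ) ^ 2)⁻¹))⁻¹) * ‖φ x‖ ^ 2 =
        ∫ x, (‖x - ((i : ℝ) / m) • axis n‖ ^ 2 + (((m : ℝ) ^ 2)⁻¹))⁻¹ *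
          ‖mulS (weight a σ (center n 0)) φ x‖ ^ 2 := by
      refine integral_congr_ae (Eventually.of_forall fun x => ?_)
      simp only [mulS_apply hw, norm_mul, Complex.norm_real, Real.norm_eq_abs, mul_pow, sq_abs]
      ring
    rw [h2]
    calc _ = 4 / ((n : ℝ) - 2) ^ 2 * (((n : ℝ) - 2) ^ 2 / 4 *
          ∫ x, (‖x - ((i : ℝ) / m) • axis n‖ ^ 2 + (((m : ℝ) ^ 2)⁻¹))⁻¹ *
          ‖mulS (weight a σ (center n 0)) φ x‖ ^ 2) := by
            rw [← mul_assoc, div_mul_div_cancel₀ (hn2.ne'), div_self four_ne_zero, one_mul]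
      _ ≤ _ := mul_le_mul_of_nonneg_left h (by positivity)
  have hsum : ∫ x, segmentWeight n β a σ s m x * ‖φ x‖ ^ 2 =
      ∑ i ∈ s, β / s.card * ∫ x, (weight a σ (center n 0) x * weight a σ (center n 0) x *
      (‖x - ((i : ℝ) / m) • axis n‖ ^ 2 + (((m : ℝ) ^ 2)⁻¹))⁻¹) * ‖φ x‖ ^ 2 := by
    simp only [segmentWeight, Finset.sum_mul]
    rw [integral_finsetSum]
    · refine Finset.sum_congr rfl fun i _ => ?_
      rw [← integral_const_mul]
      exact integral_congr_ae (Eventually.of_forall fun x => by ring)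
    · intro i _
      exact integrable_mul_normSq ((Function.HasTemperateGrowth.const (β / s.card)).mul
        (hasTemperateGrowth_segmentWeight_term ha σ hm i)) φ
  rw [hsum]
  calc _ ≤ ∑ i ∈ s, β / s.card * (4 / ((n : ℝ) - 2) ^ 2 * D) :=
        Finset.sum_le_sum fun i _ => mul_le_mul_of_nonneg_left (hterm i) (by positivity)
    _ = _ := by
        rw [Finset.sum_const, nsmul_eq_mul]
        field_simp

/-- The operator `i γ_N` on Schwartz functions. -/
def centerGammaS (n : ℕ) [NeZero n] (a σ : ℝ) (N : ℕ) (φ : 𝓢(E n, ℂ)) : 𝓢(E n, ℂ) :=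
  ∑ k ∈ Finset.Icc (-(N : ℤ)) N, gammaS a σ (center n k) φ

theorem inner_centerGammaS {a σ : ℝ} (ha : 0 < a) (hσ : 0 ≤ σ) (N : ℕ) (φ : 𝓢(E n, ℂ)) (x : E n) :
    inner ℝ (φ x) (centerGammaS n a σ N φ x) =
      ∑ j, (centerField n a σ N j x * (2 * inner ℝ (φ x) (dS j φ x)) +
        (∑ k ∈ Finset.Icc (-(N : ℤ)) N, hessF a σ (center n k) j j x) * ‖φ x‖ ^ 2) := by
  have h : centerGammaS n a σ N φ x = ∑ k ∈ Finset.Icc (-(N : ℤ)) N, ∑ j,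
      (mulS (partialF a σ (center n k) j) (dS j φ) x + mulS (hessF a σ (center n k) j j) φ x +
        mulS (partialF a σ (center n k) j) (dS j φ) x) := by
    simp only [centerGammaS, gammaS_eq ha hσ, sum_apply, add_apply]
  rw [h, inner_sum]
  simp only [inner_sum, inner_add_right]
  rw [Finset.sum_comm]
  refine Finset.sum_congr rfl fun j _ => ?_
  rw [centerField, Finset.sum_mul, Finset.sum_mul, ← Finset.sum_add_distrib]
  refine Finset.sum_congr rfl fun k _ => ?_
  have hp := hasPartial_partialF ha hσ (center n k) j j
  rw [inner_mulS hp.temp, inner_mulS hp.temp', real_inner_self_eq_norm_sq]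
  ring

/-- Off the tube the potential term has the right sign, and in the tube the averaged Hardy weights
exceed the error. Those weights are controlled by the Dirichlet form for the center `0`, one of the
nonnegative virial forms in the sum. -/
theorem AxiallyRepulsive.exists_core_estimate (hn : 3 ≤ n) {a σ L : ℝ} (ha : 0 < a)
    (hσ : 1 / 2 < σ) (hσ' : σ < 4 * ((n : ℝ) - 2) ^ 2) (hL : 0 < L) {V : E n → ℝ}
    (hV : AxiallyRepulsive L V) {ε : ℝ} (hε : 0 < ε) :
    ∃ N₀ : ℕ, ∀ N, N₀ ≤ N → ∀ φ : 𝓢(E n, ℂ),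
      -(ε * ∑ k ∈ Finset.Icc (-(N : ℤ)) N, virialS a σ (center n k) φ) ≤
        2 * ∫ x, V x * inner ℝ (φ x) (centerGammaS n a σ N φ x) := by
  have hσ0 : 0 ≤ σ := by linarith
  have hn' : (3 : ℝ) ≤ n := by exact_mod_cast hn
  have hn2 : 0 < ((n : ℝ) - 2) ^ 2 := pow_pos (by linarith) 2
  set κ : ℝ := 4 - σ / ((n : ℝ) - 2) ^ 2 with hκ
  have hκ0 : 0 < κ := by
    rw [hκ, sub_pos, div_lt_iff₀ hn2]
    exact hσ'
  -- Chosen so that `β · 4/(n-2)² = εκ/2`; the other factor `1/2` offsets the 2 in front of the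
  -- integral of `V`.
  set β : ℝ := ε * κ * ((n : ℝ) - 2) ^ 2 / 8 with hβ
  have hβ0 : 0 < β := by positivity
  obtain ⟨CV, hCV⟩ := hV.exists_bound hL
  -- The order matters: first `C`, then the weights and the width `δ` of the tube depending on `C`,
  -- and last `N₀` depending on `δ`.
  obtain ⟨C, hC⟩ := hV.exists_tube_bound hL ha hσ
  obtain ⟨s, m, δ, hs, hm, hδ, hδL, htube⟩ := exists_segmentWeight_ge n σ hL hβ0 ha hσ0 C
  obtain ⟨N₀, hN₀⟩ := hC δ hδ hδL
  refine ⟨N₀, fun N hN φ => ?_⟩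
  have hA : ∀ j : Fin n, HasPartial (centerField n a σ N j) j
      (fun x => ∑ k ∈ Finset.Icc (-(N : ℤ)) N, hessF a σ (center n k) j j x) := fun j =>
    HasPartial.sum _ fun k _ => hasPartial_partialF ha hσ0 (center n k) j j
  have hCA : ∀ j x, |centerField n a σ N j x| ≤
      ∑ k ∈ Finset.Icc (-(N : ℤ)) N, profileBound a σ := fun j x =>
    (Finset.abs_sum_le_sum_abs _ _).trans
      (Finset.sum_le_sum fun k _ => abs_partialF_le ha hσ (center n k) j x)
  have hpot := potential_form_ge hV.contDiff hCV hA hCA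
    (hasTemperateGrowth_segmentWeight (n := n) ha β σ s hm)
    (segmentWeight_nonneg hβ0.le a σ s m) (fun x => by
      by_cases hx : |x 0| ≤ L ∧ ‖transverse x‖ < δ
      · linarith [(hN₀ N hN x).1 hx, htube x hx]
      · linarith [(hN₀ N hN x).2 hx, segmentWeight_nonneg (n := n) hβ0.le a σ s m x])
    φ (inner_centerGammaS ha hσ0 N φ)
  have hseg := integral_segmentWeight_le hn ha hβ0.le σ hs hm φ
  have hnonneg : ∀ k ∈ Finset.Icc (-(N : ℤ)) N, 0 ≤ virialS a σ (center n k) φ := fun k _ =>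
    (mul_nonneg hκ0.le (dirichlet_nonneg _)).trans (virialS_ge_dirichlet hn ha hσ0 (center n k) φ)
  have h0 : κ * dirichlet (mulS (weight a σ (center n 0)) φ) ≤
      ∑ k ∈ Finset.Icc (-(N : ℤ)) N, virialS a σ (center n k) φ :=
    (virialS_ge_dirichlet hn ha hσ0 (center n 0) φ).trans
      (Finset.single_le_sum hnonneg (Finset.mem_Icc.2 ⟨by simp, by simp⟩))
  have h1 : β * (4 / ((n : ℝ) - 2) ^ 2) = ε * κ / 2 := by
    have hn1 : (n : ℝ) - 2 ≠ 0 := by linarith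
    rw [hβ]
    field_simp
    norm_num
  rw [h1] at hseg
  have h2 := mul_le_mul_of_nonneg_left h0 hε.le
  linarith

end Core

/-! ### Passage to the operator domain -/

theorem re_inner_mulOp {V : E n → ℝ} {φ η : 𝓢(E n, ℂ)} {v : L2 n}
    (hv : (toL2 φ, v) ∈ (mulOp V).graph) :
    (inner ℂ v (toL2 η)).re = ∫ x, V x * inner ℝ (φ x) (η x) := by
  have hi : Integrable fun x => (inner ℂ (v x) (toL2 η x) : ℂ) := L2.integrable_inner v (toL2 η)
  have h1 : (inner ℂ v (toL2 η) : ℂ) = ∫ x, inner ℂ (v x) (toL2 η x) := rfl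
  have h2 : (∫ x, inner ℂ (v x) (toL2 η x) : ℂ).re = ∫ x, (inner ℂ (v x) (toL2 η x) : ℂ).re :=
    (integral_re hi).symm
  rw [h1, h2]
  refine integral_congr_ae ?_
  filter_upwards [mem_graph_mulOp.1 hv, φ.coeFn_toLp 2 volume, η.coeFn_toLp 2 volume] with x h3 h4 h5
  have h4' : toL2 φ x = φ x := h4
  have h5' : toL2 η x = η x := h5
  rw [h3, h4', h5', ← Complex.real_smul, inner_smul_left_eq_smul]
  simp

theorem re_inner_neg_laplacian_gammaS (a σ : ℝ) (c : E n) (φ : 𝓢(E n, ℂ)) :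
    2 * (inner ℂ (-toL2 (Δ φ)) (toL2 (gammaS a σ c φ))).re = virialS a σ c φ := by
  have h := realInner_laplacian φ (gammaS a σ c φ)
  rw [realInner_def] at h
  rw [inner_neg_left, Complex.neg_re, virialS]
  change 2 * -(inner ℂ ((Δ φ).toLp 2 volume) ((gammaS a σ c φ).toLp 2 volume) : ℂ).re = _
  rw [h, neg_neg]

theorem re_inner_weighted {w : E n → ℝ} (hw : w.HasTemperateGrowth) (φ : 𝓢(E n, ℂ)) :
    (inner ℂ (toL2 φ) (toL2 (mulS w (Δ (mulS w φ))))).re = -dirichlet (mulS w φ) := by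
  have h := realInner_def φ (mulS w (Δ (mulS w φ)))
  rw [realInner_mulS hw, realInner_comm, realInner_laplacian] at h
  exact h.symm

/-- All operators involved converge along a core sequence for `ψ`, so both inequalities are limits
of those on Schwartz functions. The first follows because `i[H, γ_N]` is the sum of the kinetic and
potential commutators. -/
theorem exists_forall_commForm_ge [NeZero n] (hn : 3 ≤ n) {a σ L : ℝ} (ha : 0 < a)
    (hσ : 1 / 2 < σ) (hσ' : σ < 4 * ((n : ℝ) - 2) ^ 2) (hL : 0 < L) {V : E n → ℝ}
    (hV : AxiallyRepulsive L V) {ε : ℝ} (hε : 0 < ε) (hε' : ε < 1) :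
    ∃ N₀ : ℕ, ∀ N : ℕ, N₀ ≤ N → ∀ ψ : L2 n, ∀ hΔ : ψ ∈ (-laplacian n).domain,
      ∃ (hH : ψ ∈ (schrodinger V).domain) (hγ : ψ ∈ (multiCenterMultiplier n a σ N).domain)
        (hW : ψ ∈ (weightedLaplacian n a σ N).domain),
        (1 - ε) * commForm (-laplacian n) (multiCenterMultiplier n a σ N) ψ hΔ hγ ≤
          commForm (schrodinger V) (multiCenterMultiplier n a σ N) ψ hH hγ ∧
        -((1 - ε) * (4 - σ / ((n : ℝ) - 2) ^ 2)) * opForm (weightedLaplacian n a σ N) ψ hW ≤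
          (1 - ε) * commForm (-laplacian n) (multiCenterMultiplier n a σ N) ψ hΔ hγ := by
  have hσ0 : 0 ≤ σ := by linarith
  obtain ⟨CV, hCV⟩ := hV.exists_bound hL
  obtain ⟨N₀, hN₀⟩ := hV.exists_core_estimate hn ha hσ hσ' hL hε
  refine ⟨N₀, fun N hN ψ hΔ => ?_⟩
  obtain ⟨χ, hχ⟩ : ∃ χ, (ψ, χ) ∈ (laplacian n).graph :=
    ⟨laplacian n ⟨ψ, hΔ⟩, (laplacian n).mem_graph ⟨ψ, hΔ⟩⟩
  obtain ⟨φ, hφ, hφ'⟩ := exists_schwartz_approx hχ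
  have h : CoreSeq φ ψ χ := ⟨hφ, hφ'⟩
  choose γ hγ hγg using fun k : ℤ => h.exists_multiplier ha hσ (center n k)
  choose u hu hug using fun k : ℤ => h.exists_weighted ha hσ0 (center n k) (by omega)
  obtain ⟨v, hv⟩ := exists_graph_mulOp hV.contDiff.continuous hCV ψ
  choose w hw using fun m => exists_graph_mulOp hV.contDiff.continuous hCV (toL2 (φ m))
  have hwv : Tendsto w atTop (𝓝 v) := tendsto_graph_mulOp hCV hw hv hφ
  set S := Finset.Icc (-(N : ℤ)) N with hS
  have hΓg : (ψ, (-Complex.I) • ∑ k ∈ S, γ k) ∈ (multiCenterMultiplier n a σ N).graph := by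
    rw [Finset.smul_sum]
    exact mem_graph_sum S fun k _ => hγg k
  have hUg : (ψ, ∑ k ∈ S, u k) ∈ (weightedLaplacian n a σ N).graph :=
    mem_graph_sum S fun k _ => hug k
  have hΔg := mem_graph_neg hχ
  have hHg : (ψ, -χ + v) ∈ (schrodinger V).graph := mem_graph_add hΔg hv
  have hΓ : Tendsto (fun m => toL2 (centerGammaS n a σ N (φ m))) atTop (𝓝 (∑ k ∈ S, γ k)) := by
    simp only [centerGammaS, toL2_sum]
    exact tendsto_finsetSum _ fun k _ => hγ k
  have hre : ∀ {f g : ℕ → L2 n} {f₀ g₀ : L2 n}, Tendsto f atTop (𝓝 f₀) → Tendsto g atTop (𝓝 g₀) →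
      Tendsto (fun m => (inner ℂ (f m) (g m)).re) atTop (𝓝 (inner ℂ f₀ g₀).re) := fun hf hg =>
    (Complex.continuous_re.tendsto _).comp (hf.inner hg)
  have hQ : Tendsto (fun m => ∑ k ∈ S, virialS a σ (center n k) (φ m)) atTop
      (𝓝 (2 * (inner ℂ (-χ) (∑ k ∈ S, γ k)).re)) := by
    refine ((hre hφ'.neg hΓ).const_mul 2).congr fun m => ?_
    rw [centerGammaS, toL2_sum, inner_sum, Complex.re_sum, Finset.mul_sum]
    exact Finset.sum_congr rfl fun k _ => re_inner_neg_laplacian_gammaS a σ _ _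
  have hP : Tendsto (fun m => 2 * ∫ x, V x * inner ℝ (φ m x) (centerGammaS n a σ N (φ m) x)) atTop
      (𝓝 (2 * (inner ℂ v (∑ k ∈ S, γ k)).re)) :=
    ((hre hwv hΓ).const_mul 2).congr fun m => by rw [re_inner_mulOp (hw m)]
  have hD : Tendsto (fun m => -∑ k ∈ S, dirichlet (mulS (weight a σ (center n k)) (φ m))) atTop
      (𝓝 (inner ℂ ψ (∑ k ∈ S, u k)).re) := by
    refine (hre hφ (tendsto_finsetSum S fun k _ => hu k)).congr fun m => ?_
    rw [inner_sum, Complex.re_sum, ← Finset.sum_neg_distrib]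
    exact Finset.sum_congr rfl fun k _ =>
      re_inner_weighted (hasPartial_weight ha (center n k) 0).temp _
  refine ⟨mem_domain_of_graph hHg, mem_domain_of_graph hΓg, mem_domain_of_graph hUg, ?_, ?_⟩
  · rw [commForm_eq hΔg hΓg, commForm_eq hHg hΓg, inner_add_left, Complex.add_re]
    have h1 := le_of_tendsto_of_tendsto' (hQ.const_mul ε).neg hP fun m => hN₀ N hN (φ m)
    linarith
  · rw [commForm_eq hΔg hΓg, opForm_eq hUg]
    refine le_of_tendsto_of_tendsto' (hD.const_mul _) (hQ.const_mul (1 - ε)) fun m => ?_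
    rw [neg_mul_neg, mul_assoc, Finset.mul_sum]
    exact mul_le_mul_of_nonneg_left (Finset.sum_le_sum fun k _ =>
      virialS_ge_dirichlet hn ha hσ0 (center n k) (φ m)) (by linarith)

end MultiCenter

end

theorem mainTheorem1 (n : ℕ) [NeZero n] (hn : 3 ≤ n) (a σ L : ℝ) (ha : 0 < a)
    (hσ : 1 / 2 < σ) (hσ' : σ < 4 * ((n : ℝ) - 2) ^ 2) (hL : 0 < L)
    (V : MultiCenter.E n → ℝ) (hV : MultiCenter.AxiallyRepulsive L V)
    (ε : ℝ) (hε : 0 < ε) (hε' : ε < 1) :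
    ∃ Nε : ℕ, ∀ N : ℕ, Nε ≤ N →
      ∀ ψ : MultiCenter.L2 n, ∀ hΔ : ψ ∈ (-MultiCenter.laplacian n).domain,
        ∃ (hH : ψ ∈ (MultiCenter.schrodinger V).domain)
          (hγ : ψ ∈ (MultiCenter.multiCenterMultiplier n a σ N).domain)
          (hW : ψ ∈ (MultiCenter.weightedLaplacian n a σ N).domain),
          (1 - ε) * MultiCenter.commForm (-MultiCenter.laplacian n)
              (MultiCenter.multiCenterMultiplier n a σ N) ψ hΔ hγ ≤
            MultiCenter.commForm (MultiCenter.schrodinger V)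
              (MultiCenter.multiCenterMultiplier n a σ N) ψ hH hγ ∧
          -((1 - ε) * (4 - σ / ((n : ℝ) - 2) ^ 2)) *
              MultiCenter.opForm (MultiCenter.weightedLaplacian n a σ N) ψ hW ≤
            (1 - ε) * MultiCenter.commForm (-MultiCenter.laplacian n)
              (MultiCenter.multiCenterMultiplier n a σ N) ψ hΔ hγ :=
  MultiCenter.exists_forall_commForm_ge hn ha hσ hσ' hL hV hε hε'
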